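/- Let $(\mathcal A,\varphi,\varphi_2)$ be a second order probability space: $\mathcal A$ is a unital $*$-algebra over $\mathbb C$, $\varphi:\mathcal A\to\mathbb C$ is linear and tracial with $\varphi(1)=1$, and $\varphi_2:\mathcal A\times\mathcal A\to\mathbb C$ is bilinear, symmetric, tracial in each variable, with $\varphi_2(1,a)=\varphi_2(a,1)=0$ for all $a\in\mathcal A$. The free cumulants $\kappa_n$ and the second order cumulants $\kappa_{p,q}$ are defined recursively by the moment-cumulant formulas $$\varphi(a_1\cdots a_n)=\sum_{\pi\in NC(n)}\kappa_\pi(a_1,\dots,a_n),$$ $$\varphi_2(a_1\cdots a_p,\,a_{p+1}\cdots a_{p+q})=\sum_{\pi\in S_{NC}(p,q)}\kappa_\pi(a_1,\dots,a_{p+q})+\sum_{(\mathcal U,\pi)\in\mathcal{PS}_{NC}(p,q)'}\kappa_{(\mathcal U,\pi)}(a_1,\dots,a_{p+q}),$$ where $NC(n)$ is the set of non-crossing partitions of $\{1,\dots,n\}$, $S_{NC}(p,q)$ is the set of non-crossing annular permutations (with at least one cycle meeting both circles), $\kappa_\pi$ is the product of the cumulants $\kappa_l$ along the cycles of $\pi$,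 and $\mathcal{PS}_{NC}(p,q)'$ is the set of pairs $(\mathcal U,\pi)$ with $\pi=\pi_1\times\pi_2$, where $\pi_1$ and $\pi_2$ are non-crossing partitions of $\{1,\dots,p\}$ and of $\{p+1,\dots,p+q\}$, and $\mathcal U$ is obtained from $\pi$ by joining exactly one cycle of $\pi_1$ with exactly one cycle of $\pi_2$; in $\kappa_{(\mathcal U,\pi)}$ the joined pair contributes a factor $\kappa_{k,l}$, and every other cycle a first order cumulant. Write $a^{(1)}=a$ and $a^{(-1)}=a^*$. An element $a\in\mathcal A$ is *$R$-diagonal* if $\kappa_n(a^{(\epsilon_1)},\dots,a^{(\epsilon_n)})=0$ for all $n\ge1$ and all signs $\epsilon_i\in\{-1,1\}$, unless $n$ is even and $\epsilon_i+\epsilon_{i+1}=0$ for $1\le i<n$. It is *second order $R$-diagonal* if it is $R$-diagonal and, for all $p,q\ge1$ and all signs, $\kappa_{p,q}(a^{(\epsilon_1)},\dots,a^{(\epsilon_{p+q})})=0$ unless $p$ and $q$ are even and the signs alternate on each circle, that is, $\epsilon_i+\epsilon_{i+1}=0$ for $1\le i<p$ and for $p+1\le i<p+q$; and moreover, for all $p,q\ge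 1$, all cumulants $\kappa_{2p,2q}(a^{(\epsilon_1)},\dots,a^{(\epsilon_{2p+2q})})$ with signs alternating on each circle have the same value, so that in particular $\kappa_{2p,2q}(a,a^*,\dots,a,a^*)=\kappa_{2p,2q}(a^*,a,\dots,a^*,a)$. Let $u\in\mathcal A$ be a second order Haar unitary, that is, $uu^*=u^*u=1$, and for all integers $k,l\ge1$: $\varphi(u^k)=\varphi(u^{*k})=0$, $\varphi_2(u^k,u^{*l})=k\,\delta_{k,l}$, and $\varphi_2(u^k,u^l)=\varphi_2(u^{*k},u^{*l})=0$. Then $u$ is second order $R$-diagonal. Moreover, for all positive integers $p,q$ and all $\epsilon_1,\dots,\epsilon_{p+q}\in\{-1,1\}$, $$\kappa_{p,q}(u^{\epsilon_1},\dots,u^{\epsilon_{p+q}})=0$$ unless $p$ and $q$ are even and $\epsilon_i+\epsilon_{i+1}=0$ for $1\le i<p$ and for $p+1\le i<p+q$. -/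

import Mathlib

/-! Second order noncommutative probability spaces, their first and second order free cumulants,
second order Haar unitaries and second order `R`-diagonal elements. -/

namespace SecondOrder

open Equiv

/-! ### Cycles of permutations of `{0, …, n - 1}` -/

/-- The least elements of the cycles of `π` (fixed points are cycles of length one); they index
the cycles of `π`. -/
def cycleMins {n : ℕ} (π : Perm (Fin n)) : Finset (Fin n) :=
  {i | ∀ j, π.SameCycle i j → i ≤ j}

/-- The number `#(π)` of cycles of `π`, fixed points included. -/
def numCycles {n : ℕ} (π : Perm (Fin n)) : ℕ := (cycleMins π).card

/-- The length `|π| = n - #(π)`. -/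
def permLength {n : ℕ} (π : Perm (Fin n)) : ℕ := n - numCycles π

/-- The number of elements of the cycle of `π` through `i`. -/
noncomputable def cycleLength {n : ℕ} (π : Perm (Fin n)) (i : Fin n) : ℕ := Function.minimalPeriod π i

/-- The subword `(a i, a (π i), a (π² i), …)` of `a` read along the cycle of `π` through `i`. -/
def cycleWord {A : Type*} {n : ℕ} (π : Perm (Fin n)) (i : Fin n) (a : Fin n → A) :
    Fin (cycleLength π i) → A :=
  fun k => a ((π ^ (k : ℕ)) i)

/-! ### Non-crossing partitions and non-crossing annular permutations

The permutation `γ_n = (1, 2, …, n)` is `finRotate n`. -/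

/-- The permutation `γ_{m,n} = (1, …, m)(m + 1, …, m + n)`. -/
def annularRotation (m n : ℕ) : Perm (Fin (m + n)) :=
  finSumFinEquiv.permCongr (Perm.sumCongr (finRotate m) (finRotate n))

/-- The non-crossing partitions of `{1, …, n}`, a partition being regarded as the permutation whose
cycles are the blocks written in increasing order. Among all permutations these are
the ones with `|γ_n| = |π| + |π⁻¹ γ_n|`. -/
def NC (n : ℕ) : Finset (Perm (Fin n)) :=
  {π | permLength (finRotate n) = permLength π + permLength (π⁻¹ * finRotate n)}

/-- The non-crossing annular permutations `S_NC(m, n)`: some cycle of `π` meets both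
cycles of `γ_{m,n}`, and `|γ_{m,n}| + 2 = |π| + |π⁻¹ γ_{m,n}|`. -/
def annularNC (m n : ℕ) : Finset (Perm (Fin (m + n))) :=
  {π | (∃ (i : Fin m) (j : Fin n), π.SameCycle (Fin.castAdd n i) (Fin.natAdd m j)) ∧
    permLength (annularRotation m n) + 2 =
      permLength π + permLength (π⁻¹ * annularRotation m n)}

/-! ### Facts that make the recursions below well-founded -/

theorem cycleLength_pos {n : ℕ} (π : Perm (Fin n)) (i : Fin n) : 0 < cycleLength π i :=
  Function.minimalPeriod_pos_of_mem_periodicPts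
    (Function.Injective.mem_periodicPts π.injective i)

theorem cycleLength_le {n : ℕ} (π : Perm (Fin n)) (i : Fin n) : cycleLength π i ≤ n := by
  have h := Finset.card_le_card_of_injOn (s := Finset.range (cycleLength π i))
    (t := (Finset.univ : Finset (Fin n))) (fun k => (π^[k]) i) (by simp) (by
      intro x hx y hy hxy
      exact Function.iterate_injOn_Iio_minimalPeriod (by simpa [cycleLength] using hx)
        (by simpa [cycleLength] using hy) hxy)
  simpa using h

theorem numCycles_le {n : ℕ} (π : Perm (Fin n)) : numCycles π ≤ n := by
  simpa [numCycles] using Finset.card_le_univ (cycleMins π)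

theorem numCycles_pos {n : ℕ} (π : Perm (Fin n)) (i : Fin n) : 0 < numCycles π := by
  have : NeZero n := ⟨by have := i.2; omega⟩
  exact Finset.card_pos.2 ⟨0, by simp [cycleMins]⟩

theorem sameCycle_of_cycleLength_eq {n : ℕ} {π : Perm (Fin n)} {i : Fin n}
    (h : cycleLength π i = n) (j : Fin n) : π.SameCycle i j := by
  have hinj : Function.Injective (fun k : Fin n => (π^[(k : ℕ)]) i) := by
    intro x y hxy
    exact Fin.ext (Function.iterate_injOn_Iio_minimalPeriod
      (show (x : ℕ) < cycleLength π i by omega) (show (y : ℕ) < cycleLength π i by omega) hxy)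
  obtain ⟨k, hk⟩ := (Finite.injective_iff_surjective.1 hinj) j
  exact ⟨(k : ℕ), by simpa [zpow_natCast, Perm.iterate_eq_pow] using hk⟩

theorem eq_one_of_permLength_eq_zero {n : ℕ} {σ : Perm (Fin n)} (h : permLength σ = 0) :
    σ = 1 := by
  have h1 : (cycleMins σ).card = Fintype.card (Fin n) := by
    have := numCycles_le σ
    simp only [permLength] at h
    simp only [numCycles] at *
    rw [Fintype.card_fin]
    omega
  have h2 : cycleMins σ = Finset.univ := (Finset.card_eq_iff_eq_univ _).1 h1
  have h3 : ∀ i j, σ.SameCycle i j → i ≤ j := by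
    intro i
    have : i ∈ cycleMins σ := by rw [h2]; exact Finset.mem_univ i
    simpa [cycleMins] using this
  ext1 i
  have hi : σ.SameCycle i (σ i) := ⟨1, by simp⟩
  exact le_antisymm (h3 _ _ hi.symm) (h3 _ _ hi)

theorem eq_finRotate_of_cycleLength_eq {n : ℕ} {π : Perm (Fin n)} (hπ : π ∈ NC n) (i : Fin n)
    (h : cycleLength π i = n) : π = finRotate n := by
  have hle : numCycles π ≤ 1 := Finset.card_le_one.2 fun x hx y hy => by
    have hx' : ∀ j, π.SameCycle x j → x ≤ j := by simpa [cycleMins] using hx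
    have hy' : ∀ j, π.SameCycle y j → y ≤ j := by simpa [cycleMins] using hy
    have hxy : π.SameCycle x y :=
      (sameCycle_of_cycleLength_eq h x).symm.trans (sameCycle_of_cycleLength_eq h y)
    exact le_antisymm (hx' y hxy) (hy' x hxy.symm)
  have hrot := numCycles_pos (finRotate n) i
  have hmem : permLength (finRotate n) = permLength π + permLength (π⁻¹ * finRotate n) := by
    simpa [NC] using hπ
  have h0 : permLength (π⁻¹ * finRotate n) = 0 := by
    simp only [permLength] at *
    omega
  exact (inv_mul_eq_one.1 (eq_one_of_permLength_eq_zero h0))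

theorem cycleLength_lt {n : ℕ} {π : Perm (Fin n)} (hπ : π ∈ (NC n).erase (finRotate n))
    (i : Fin n) : cycleLength π i < n :=
  lt_of_le_of_ne (cycleLength_le π i) fun h =>
    (Finset.mem_erase.1 hπ).1 (eq_finRotate_of_cycleLength_eq (Finset.mem_erase.1 hπ).2 i h)

theorem cycleLength_add_lt {m n : ℕ} {π : Perm (Fin m) × Perm (Fin n)}
    (hπ : π ∈ (NC m ×ˢ NC n).erase (finRotate m, finRotate n)) (i : Fin m) (j : Fin n) :
    cycleLength π.1 i + cycleLength π.2 j < m + n := by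
  obtain ⟨hne, hmem⟩ := Finset.mem_erase.1 hπ
  obtain ⟨h1, h2⟩ := Finset.mem_product.1 hmem
  have hi := cycleLength_le π.1 i
  have hj := cycleLength_le π.2 j
  by_contra hlt
  exact hne (Prod.ext (eq_finRotate_of_cycleLength_eq h1 i (by omega))
    (eq_finRotate_of_cycleLength_eq h2 j (by omega)))

/-! ### Second order probability spaces and their cumulants -/

/-- The functionals `φ` and `φ₂` that make a unital complex `*`-algebra `A` a second order
probability space: `φ` is linear, unital and tracial, and `φ₂` is bilinear, symmetric, tracial in
each variable, and vanishes when one of its arguments is `1`. -/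
structure SecondOrderSpace (A : Type*) [Ring A] [Algebra ℂ A] where
  φ : A →ₗ[ℂ] ℂ
  φ_one : φ 1 = 1
  φ_tracial : ∀ a b, φ (a * b) = φ (b * a)
  φ₂ : A →ₗ[ℂ] A →ₗ[ℂ] ℂ
  φ₂_symm : ∀ a b, φ₂ a b = φ₂ b a
  φ₂_tracial_left : ∀ a b c, φ₂ (a * b) c = φ₂ (b * a) c
  φ₂_tracial_right : ∀ a b c, φ₂ c (a * b) = φ₂ c (b * a)
  φ₂_one_left : ∀ a, φ₂ 1 a = 0
  φ₂_one_right : ∀ a, φ₂ a 1 = 0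

section Cumulants

variable {A : Type*} [Ring A] [Algebra ℂ A]

/-- The free cumulants `κ_n(a₁, …, a_n)`, defined recursively by the moment-cumulant formula
`φ(a₁ ⋯ a_n) = ∑_{π ∈ NC(n)} κ_π(a₁, …, a_n)`: the term of the partition with one block
is `κ_n(a₁, …, a_n)`, and all other terms are moved to the other side. -/
noncomputable def cumulant (P : SecondOrderSpace A) (n : ℕ) (a : Fin n → A) : ℂ :=
  P.φ (List.ofFn a).prod -
    ∑ π ∈ ((NC n).erase (finRotate n)).attach, ∏ i ∈ cycleMins π.1,
      cumulant P (cycleLength π.1 i) (cycleWord π.1 i a)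
termination_by n
decreasing_by exact cycleLength_lt π.2 i

/-- The multiplicative extension `κ_π(a₁, …, a_n)`: the product of the cumulants of the
subwords of `a` along the cycles of `π`, each cycle being started at its least element. -/
noncomputable def permCumulant (P : SecondOrderSpace A) {n : ℕ} (π : Perm (Fin n))
    (a : Fin n → A) : ℂ :=
  ∏ i ∈ cycleMins π, cumulant P (cycleLength π i) (cycleWord π i a)

/-- The second order cumulants `κ_{m,n}(a₁, …, a_m; b₁, …, b_n)`, defined recursively by the
moment-cumulant formula
`φ₂(a₁ ⋯ a_m, b₁ ⋯ b_n) = ∑_{π ∈ S_NC(m,n)} κ_π(a, b) + ∑_{(𝒰, π) ∈ PS_NC(m,n)'} κ_{(𝒰,π)}(a, b)`.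
An element of `PS_NC(m,n)'` is a product `π = π₁ × π₂` of non-crossing partitions of the two
circles, where `𝒰` joins one cycle of `π₁` (that of `i`) and one cycle of `π₂` (that of `j`);
its term is a second order cumulant of the joined cycles, multiplied by the first order cumulants of
all other cycles. The term of `π₁ = γ_m`, `π₂ = γ_n` is `κ_{m,n}(a; b)`. -/
noncomputable def cumulant₂ (P : SecondOrderSpace A) (m n : ℕ) (a : Fin m → A) (b : Fin n → A) :
    ℂ :=
  P.φ₂ (List.ofFn a).prod (List.ofFn b).prod -
    ∑ π ∈ annularNC m n, permCumulant P π (Fin.append a b) -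
    ∑ π ∈ ((NC m ×ˢ NC n).erase (finRotate m, finRotate n)).attach,
      ∑ i ∈ cycleMins π.1.1, ∑ j ∈ cycleMins π.1.2,
        cumulant₂ P (cycleLength π.1.1 i) (cycleLength π.1.2 j)
            (cycleWord π.1.1 i a) (cycleWord π.1.2 j b) *
          (∏ r ∈ (cycleMins π.1.1).erase i,
            cumulant P (cycleLength π.1.1 r) (cycleWord π.1.1 r a)) *
          ∏ s ∈ (cycleMins π.1.2).erase j,
            cumulant P (cycleLength π.1.2 s) (cycleWord π.1.2 s b)
termination_by m + n
decreasing_by exact cycleLength_add_lt π.2 i j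

end Cumulants

/-! ### Haar unitaries and `R`-diagonal elements -/

section Elements

variable {A : Type*} [Ring A] [Algebra ℂ A] [StarRing A]

/-- A second order Haar unitary: a unitary `u` with `φ(u^k) = 0` for all integers `k ≠ 0`
and `φ₂(u^k, u^{-l}) = |k| δ_{k,l}` for all integers `k, l ≠ 0`. The integer powers are
written out as powers of `u` and `star u`. -/
structure IsSecondOrderHaarUnitary (P : SecondOrderSpace A) (u : A) : Prop where
  unitary : u ∈ unitary A
  φ_pow : ∀ k : ℕ, 1 ≤ k → P.φ (u ^ k) = 0
  φ_star_pow : ∀ k : ℕ, 1 ≤ k → P.φ (star u ^ k) = 0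
  φ₂_pow_star_pow : ∀ k l : ℕ, 1 ≤ k → 1 ≤ l →
    P.φ₂ (u ^ k) (star u ^ l) = if k = l then (k : ℂ) else 0
  φ₂_pow_pow : ∀ k l : ℕ, 1 ≤ k → 1 ≤ l → P.φ₂ (u ^ k) (u ^ l) = 0
  φ₂_star_pow_star_pow : ∀ k l : ℕ, 1 ≤ k → 1 ≤ l → P.φ₂ (star u ^ k) (star u ^ l) = 0

/-- `a^(1) = a` and `a^(-1) = a*`; the signs `1` and `-1` are the elements of `ℤˣ`. -/
def signed (a : A) (ε : ℤˣ) : A := if ε = 1 then a else star a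

/-- The signs `ε₁, …, ε_n` alternate: consecutive signs add up to zero. -/
def Alternating {n : ℕ} (ε : Fin n → ℤˣ) : Prop :=
  ∀ i j : Fin n, (j : ℕ) = i + 1 → (ε i : ℤ) + (ε j : ℤ) = 0

/-- The sign pattern of the word `a, a*, a, a*, …`. -/
def altSigns (n : ℕ) : Fin n → ℤˣ := fun i => (-1) ^ (i : ℕ)

/-- `a` is `R`-diagonal: all `*`-cumulants of `a` vanish except possibly
`κ_{2l}(a, a*, …, a, a*)` and `κ_{2l}(a*, a, …, a*, a)`. -/
def IsRDiagonal (P : SecondOrderSpace A) (a : A) : Prop :=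
  ∀ n : ℕ, 1 ≤ n → ∀ ε : Fin n → ℤˣ, ¬ (Even n ∧ Alternating ε) →
    cumulant P n (fun i => signed a (ε i)) = 0

/-- `a` is second order `R`-diagonal: it is `R`-diagonal, its second order `*`-cumulants
`κ_{p,q}` vanish unless `p`, `q` are even and `a`, `a*` alternate on each of the two circles, and
all these alternating cumulants of order `(2p, 2q)` have the common value
`κ_{2p,2q}(a, a*, …, a, a*)` (in particular `κ_{2p,2q}(a*, a, …, a*, a)` is equal to it). -/
structure IsSecondOrderRDiagonal (P : SecondOrderSpace A) (a : A) : Prop where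
  isRDiagonal : IsRDiagonal P a
  cumulant₂_eq_zero : ∀ p q : ℕ, 1 ≤ p → 1 ≤ q → ∀ (ε : Fin p → ℤˣ) (η : Fin q → ℤˣ),
    ¬ (Even p ∧ Even q ∧ Alternating ε ∧ Alternating η) →
      cumulant₂ P p q (fun i => signed a (ε i)) (fun j => signed a (η j)) = 0
  cumulant₂_alternating : ∀ p q : ℕ, 1 ≤ p → 1 ≤ q →
    ∀ (ε : Fin (2 * p) → ℤˣ) (η : Fin (2 * q) → ℤˣ), Alternating ε → Alternating η →
      cumulant₂ P (2 * p) (2 * q) (fun i => signed a (ε i)) (fun j => signed a (η j)) =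
        cumulant₂ P (2 * p) (2 * q) (fun i => signed a (altSigns (2 * p) i))
          (fun j => signed a (altSigns (2 * q) j))

end Elements

end SecondOrder

/-! Call a sign that agrees with its successor on the same circle a repetition; a circle of one
point always has one. A circle without repetitions has even length and alternating signs
(`even_and_alternating`), so the vanishing statements reduce to one claim: a cumulant of `u`, `u*`
with a repetition on a circle is zero. The equality of all alternating cumulants is separate and
holds for every element. It follows from the rotation invariance `cumulant₂_comp_finRotate`, which
comes from traciality.

The main tool is a form of the formula for cumulants with products as entries. Fix a point `i`.
Every permutation is uniquely `σ * swap i j` with `σ i = γ i`, where `j` is the preimage of `γ i`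
(`sum_perm_eq`). If `j` lies in the cycle of `σ` through `i`, the transposition splits this cycle
and the sum of the two lengths in the non-crossing condition is unchanged. Otherwise it joins two
cycles and that sum grows by two, which turns a disc condition into an annular one. Grouping the
moment-cumulant formulas by `σ` (`sum_geodesic_eq`, `sum_annulus_add_sum_geodesic`) produces
`mergedCumulant` and `mergedCumulant₂`, the cumulants in which the entries at `i` and `σ i` are
multiplied.

If that product is `1`, the moment equals the moment of the word with both letters deleted, and the
permutations having `(i, γ i)` as a cycle already account for it. By induction on the cycle lengths
the merged cumulants vanish, except for a first order cycle of length two, which gives `1`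
(`mergedCumulant_eq`, `mergedCumulant₂_eq_zero`).

For a Haar unitary, suppose that a repetition is followed by a change of sign: signs `s, s, -s` at
`h`, `i`, `γ i`. Merging `i` with `γ i` gives zero, and the summand `j = i` is the wanted cumulant.
In every other summand the repetition survives in the cycle of `i`, so the summand vanishes by
induction. If no repetition is followed by a change, the signs on the circle are constant. The first
order claim is then `φ(u^k) = 0`. In second order, with opposite constant signs and equal lengths
`k`, the only annular permutations that contribute are the `k` spoke diagrams, each with value `1`;
they cancel `φ₂(u^k, u*^k) = k`. In the remaining cases the signs have nonzero sum, no annular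
permutation contributes, and the moment is zero. -/

namespace SecondOrder

open Equiv

/-! ### Cycles and transpositions -/

section Cycles

variable {α : Type*} {π σ : Perm α} {i j x y : α}

/-- An equivalence relation that contains the graph of a permutation contains its cycles. -/
theorem rel_of_sameCycle {r : α → α → Prop} (hr : Equivalence r) (h : ∀ x, r x (π x))
    (hxy : π.SameCycle x y) : r x y := by
  obtain ⟨k, rfl⟩ := hxy
  induction k with
  | zero => exact hr.refl _
  | succ k ih => rw [add_comm, zpow_add, zpow_one]; exact hr.trans ih (h _)
  | pred k ih =>
    refine hr.trans ih (hr.symm ?_)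
    have := h ((π ^ (-(k : ℤ) - 1)) x)
    rwa [← Perm.mul_apply, ← zpow_one_add, add_sub_cancel] at this

theorem mem_of_sameCycle {S : Set α} (h : ∀ x, x ∈ S ↔ π x ∈ S) (hxy : π.SameCycle x y) :
    x ∈ S ↔ y ∈ S :=
  rel_of_sameCycle (r := fun x y => x ∈ S ↔ y ∈ S)
    ⟨fun _ => Iff.rfl, fun h => h.symm, fun h k => h.trans k⟩ h hxy

theorem sameCycle_apply_self (π : Perm α) (x : α) : π.SameCycle x (π x) := ⟨1, by simp⟩

theorem sameCycle_of_maps {β : Type*} {ρ : Perm β} {f : β → α} (hf : ∀ x, f (ρ x) = π (f x))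
    {x y : β} (h : ρ.SameCycle x y) : π.SameCycle (f x) (f y) :=
  rel_of_sameCycle (r := fun x y => π.SameCycle (f x) (f y))
    ⟨fun _ => .rfl, fun h => h.symm, fun h k => h.trans k⟩
    (fun x => by rw [hf]; exact sameCycle_apply_self π _) h

theorem sameCycle_map_iff {β : Type*} {ρ : Perm β} {f : β → α} (hi : f.Injective)
    (hf : ∀ x, f (ρ x) = π (f x)) {x y : β} : π.SameCycle (f x) (f y) ↔ ρ.SameCycle x y := by
  refine ⟨fun h => ?_, sameCycle_of_maps hf⟩
  have hz : ∀ (k : ℤ) x, f ((ρ ^ k) x) = (π ^ k) (f x) := by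
    intro k
    induction k with
    | zero => simp
    | succ k ih => intro x; rw [zpow_add_one, zpow_add_one, Perm.mul_apply, ih, hf, Perm.mul_apply]
    | pred k ih =>
      intro x
      rw [zpow_sub_one, zpow_sub_one, Perm.mul_apply, ih, Perm.mul_apply]
      congr 1
      rw [Perm.eq_inv_iff_eq, ← hf]; simp
  obtain ⟨k, hk⟩ := h
  exact ⟨k, hi (by rw [hz, hk])⟩

/-- A cycle that meets the range of `f` lies inside it. -/
theorem exists_of_sameCycle_map {β : Type*} {ρ : Perm β} {f : β → α}
    (hf : ∀ x, f (ρ x) = π (f x)) {x : β} {y : α} (h : π.SameCycle (f x) y) :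
    ∃ z, ρ.SameCycle x z ∧ f z = y := by
  have := rel_of_sameCycle (π := π) (r := fun a b => (∃ z, ρ.SameCycle x z ∧ f z = a) ↔
      (∃ z, ρ.SameCycle x z ∧ f z = b))
    ⟨fun _ => Iff.rfl, fun h => h.symm, fun h k => h.trans k⟩ (by
      intro a
      constructor
      · rintro ⟨z, hz, rfl⟩
        exact ⟨ρ z, Perm.sameCycle_apply_right.2 hz, hf z⟩
      · rintro ⟨z, hz, h⟩
        refine ⟨ρ.symm z, Perm.sameCycle_symm_apply_right.2 hz, π.injective ?_⟩
        rw [← hf, ← h]; simp) h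
  exact this.1 ⟨x, .rfl, rfl⟩

variable [DecidableEq α]

theorem mul_swap_apply_left (π : Perm α) (i j : α) : (π * swap i j) i = π j := by simp
theorem mul_swap_apply_right (π : Perm α) (i j : α) : (π * swap i j) j = π i := by simp
theorem mul_swap_apply_of_ne (π : Perm α) (hi : x ≠ i) (hj : x ≠ j) :
    (π * swap i j) x = π x := by
  simp [swap_apply_of_ne_of_ne hi hj]

variable [Finite α]

/-- Multiplication with a transposition of points of different cycles joins these cycles. -/
theorem sameCycle_mul_swap_of_not (h : ¬ π.SameCycle i j) : (π * swap i j).SameCycle i j := by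
  -- The product sends `i` to `π j` and then follows `π` along the cycle of `j`, which avoids `i`.
  -- After `orderOf π` steps the orbit is back at `j`.
  have key : ∀ k : ℕ, (π * swap i j).SameCycle i ((π ^ (k + 1)) j) := by
    intro k
    induction k with
    | zero => exact ⟨1, by simp⟩
    | succ k ih =>
      rw [pow_succ', Perm.mul_apply]
      by_cases hj : (π ^ (k + 1)) j = j
      · rw [hj]; exact ⟨1, by simp⟩
      · have hi : (π ^ (k + 1)) j ≠ i := fun hi => h (Perm.SameCycle.symm ⟨(k + 1 : ℕ), by
          rw [zpow_natCast]; exact hi⟩)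
        rw [← mul_swap_apply_of_ne π hi hj]
        exact Perm.sameCycle_apply_right.2 ih
  have := key (orderOf π - 1)
  rwa [Nat.sub_add_cancel (orderOf_pos π), pow_orderOf_eq_one, Perm.one_apply] at this

/-- The right-hand side is an equivalence relation containing the graph of the product. Conversely,
`i` and `j` are joined, so the cycles of the product absorb the graph of `π`. -/
theorem sameCycle_mul_swap_iff (h : ¬ π.SameCycle i j) : (π * swap i j).SameCycle x y ↔
    π.SameCycle x y ∨
      ((π.SameCycle i x ∨ π.SameCycle j x) ∧ (π.SameCycle i y ∨ π.SameCycle j y)) := by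
  have hij := sameCycle_mul_swap_of_not h
  have hmono : ∀ {x y}, π.SameCycle x y → (π * swap i j).SameCycle x y := by
    intro x y hxy
    refine rel_of_sameCycle (Perm.SameCycle.equivalence _) (fun x => ?_) hxy
    by_cases hi : x = i
    · subst hi
      exact hij.trans ⟨1, by simp⟩
    by_cases hj : x = j
    · subst hj
      exact hij.symm.trans ⟨1, by simp⟩
    exact ⟨1, by simp [swap_apply_of_ne_of_ne hi hj]⟩
  constructor
  · refine rel_of_sameCycle (r := fun x y => π.SameCycle x y ∨
      ((π.SameCycle i x ∨ π.SameCycle j x) ∧ (π.SameCycle i y ∨ π.SameCycle j y)))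
      ⟨fun x => Or.inl .rfl, ?_, ?_⟩ ?_
    · rintro x y (h | ⟨h, k⟩)
      exacts [Or.inl h.symm, Or.inr ⟨k, h⟩]
    · rintro x y z (h | ⟨h, k⟩) (h' | ⟨h', k'⟩)
      · exact Or.inl (h.trans h')
      · exact Or.inr ⟨h'.imp (fun t => t.trans h.symm) (fun t => t.trans h.symm), k'⟩
      · exact Or.inr ⟨h, k.imp (fun t => t.trans h') (fun t => t.trans h')⟩
      · exact Or.inr ⟨h, k'⟩
    · intro x
      by_cases hi : x = i
      · subst hi
        rw [mul_swap_apply_left]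
        exact Or.inr ⟨Or.inl .rfl, Or.inr (sameCycle_apply_self _ _)⟩
      by_cases hj : x = j
      · subst hj
        rw [mul_swap_apply_right]
        exact Or.inr ⟨Or.inr .rfl, Or.inl (sameCycle_apply_self _ _)⟩
      rw [mul_swap_apply_of_ne π hi hj]
      exact Or.inl (sameCycle_apply_self _ _)
  · rintro (h | ⟨h1, h2⟩)
    · exact hmono h
    · have key : ∀ {z}, (π.SameCycle i z ∨ π.SameCycle j z) → (π * swap i j).SameCycle i z := by
        rintro z (h | h)
        exacts [hmono h, hij.trans (hmono h)]
      exact (key h1).symm.trans (key h2)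

/-- Multiplication with a transposition of two points of a cycle separates these points. -/
theorem not_sameCycle_mul_swap (h : π.SameCycle i j) (hij : i ≠ j) :
    ¬ (π * swap i j).SameCycle i j := by
  classical
  -- With the least such `k`, the cycle of the product through `i` is `π j, π² j, …, π ^ k j = i`,
  -- and it never reaches `j`.
  have hex : ∃ k : ℕ, 0 < k ∧ (π ^ k) j = i := by
    obtain ⟨k, hk, -, e⟩ := h.symm.exists_pow_eq''
    exact ⟨k, hk, e⟩
  obtain ⟨hk0, hk⟩ := Nat.find_spec hex
  set k := Nat.find hex
  have hmin : ∀ m, 0 < m → m < k → (π ^ m) j ≠ i := fun m h0 hm e => Nat.find_min hex hm ⟨h0, e⟩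
  have hne : ∀ m, 0 < m → m ≤ k → (π ^ m) j ≠ j := by
    intro m h0 hm e
    rcases hm.eq_or_lt with rfl | hlt
    · exact hij (hk.symm.trans e)
    · refine hmin (k - m) (by omega) (by omega) ?_
      have : (π ^ (k - m)) ((π ^ m) j) = i := by
        rw [← Perm.mul_apply, ← pow_add, Nat.sub_add_cancel hm, hk]
      rwa [e] at this
  have key : ∀ n : ℕ, ∃ m, 0 < m ∧ m ≤ k ∧ ((π * swap i j) ^ n) i = (π ^ m) j := by
    intro n
    induction n with
    | zero => exact ⟨k, hk0, le_rfl, by simp [hk]⟩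
    | succ n ih =>
      obtain ⟨m, h0, hm, e⟩ := ih
      rw [pow_succ', Perm.mul_apply, e]
      rcases hm.eq_or_lt with rfl | hlt
      · exact ⟨1, one_pos, hk0, by rw [hk]; simp⟩
      · exact ⟨m + 1, by omega, by omega, by
          rw [mul_swap_apply_of_ne π (hmin m h0 hlt) (hne m h0 hm), pow_succ', Perm.mul_apply]⟩
  intro hs
  obtain ⟨n, hn⟩ := hs.exists_nat_pow_eq
  obtain ⟨m, h0, hm, e⟩ := key n
  exact hne m h0 hm (e.symm.trans hn)

end Cycles

/-! ### Transversals of the cycles of a permutation -/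

section Transversal

variable {n : ℕ} {π σ : Perm (Fin n)} {i j : Fin n}

/-- `R` contains exactly one point of each cycle of `π`. -/
structure IsTransversal (π : Perm (Fin n)) (R : Finset (Fin n)) : Prop where
  exists_mem : ∀ x, ∃ r ∈ R, π.SameCycle x r
  eq_of_sameCycle : ∀ r ∈ R, ∀ s ∈ R, π.SameCycle r s → r = s

theorem mem_cycleMins {x : Fin n} : x ∈ cycleMins π ↔ ∀ y, π.SameCycle x y → x ≤ y := by
  simp [cycleMins]

theorem isTransversal_cycleMins (π : Perm (Fin n)) : IsTransversal π (cycleMins π) where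
  exists_mem x := by
    obtain ⟨r, hr, hmin⟩ := Finset.exists_min_image
      (Finset.univ.filter (fun y => π.SameCycle x y)) id ⟨x, by simp [Perm.SameCycle.rfl]⟩
    simp only [Finset.mem_filter, Finset.mem_univ, true_and] at hr hmin
    exact ⟨r, mem_cycleMins.2 fun y hy => hmin y (hr.trans hy), hr⟩
  eq_of_sameCycle r hr s hs h :=
    le_antisymm (mem_cycleMins.1 hr s h) (mem_cycleMins.1 hs r h.symm)

/-- Cumulants are defined with cycles started at their least points, but relabelling, splitting and
joining do not respect least points. This map transfers products and sums to whichever transversal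
is convenient. -/
theorem IsTransversal.exists_equiv {R S : Finset (Fin n)} (hR : IsTransversal π R)
    (hS : IsTransversal π S) : ∃ e : Fin n → Fin n, Set.BijOn e R S ∧
      ∀ x, π.SameCycle x (e x) := by
  choose e he hs using hS.exists_mem
  refine ⟨e, ⟨fun x _ => he x, ?_, ?_⟩, hs⟩
  · intro x hx y hy h
    exact hR.eq_of_sameCycle x hx y hy ((hs x).trans (h ▸ (hs y).symm))
  · intro y hy
    obtain ⟨r, hr, h⟩ := hR.exists_mem y
    exact ⟨r, hr, (hS.eq_of_sameCycle y hy _ (he r) (h.trans (hs r))).symm⟩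

theorem IsTransversal.card_eq {R : Finset (Fin n)} (hR : IsTransversal π R) :
    R.card = numCycles π := by
  obtain ⟨e, he, -⟩ := hR.exists_equiv (isTransversal_cycleMins π)
  exact Finset.card_bij (fun x _ => e x) (fun x hx => he.1 hx)
    (fun x hx y hy h => he.2.1 hx hy h) (fun y hy => by
      obtain ⟨x, hx, h⟩ := he.2.2 hy
      exact ⟨x, hx, h⟩)

theorem IsTransversal.prod_eq {M : Type*} [CommMonoid M] {R S : Finset (Fin n)}
    (hR : IsTransversal π R) (hS : IsTransversal π S) {f : Fin n → M}
    (hf : ∀ x y, π.SameCycle x y → f x = f y) : ∏ x ∈ R, f x = ∏ x ∈ S, f x := by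
  obtain ⟨e, he, hs⟩ := hR.exists_equiv hS
  exact Finset.prod_bij (fun x _ => e x) (fun x hx => he.1 hx)
    (fun x hx y hy h => he.2.1 hx hy h) (fun y hy => by
      obtain ⟨x, hx, h⟩ := he.2.2 hy
      exact ⟨x, hx, h⟩) (fun x _ => hf _ _ (hs x))

theorem IsTransversal.image {m : ℕ} {ρ : Perm (Fin m)} {R : Finset (Fin n)}
    (hR : IsTransversal π R) (e : Fin n ≃ Fin m) (he : ∀ x, e (π x) = ρ (e x)) :
    IsTransversal ρ (R.map e.toEmbedding) where
  exists_mem x := by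
    obtain ⟨r, hr, h⟩ := hR.exists_mem (e.symm x)
    refine ⟨e r, by simpa using hr, ?_⟩
    simpa using sameCycle_of_maps he h
  eq_of_sameCycle r hr s hs h := by
    simp only [Finset.mem_map_equiv] at hr hs
    have := hR.eq_of_sameCycle _ hr _ hs
      ((sameCycle_map_iff e.injective he).1 (by simpa using h))
    exact e.symm.injective this

/-- The least elements of the cycles of `π` that do not contain `i`. -/
def otherMins (π : Perm (Fin n)) (i : Fin n) : Finset (Fin n) :=
  (cycleMins π).filter fun z => ¬ π.SameCycle i z

theorem mem_otherMins {x : Fin n} :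
    x ∈ otherMins π i ↔ x ∈ cycleMins π ∧ ¬ π.SameCycle i x := by
  simp [otherMins]

theorem not_mem_otherMins_of_sameCycle (h : π.SameCycle i j) : j ∉ otherMins π i :=
  fun hj => (mem_otherMins.1 hj).2 h

theorem isTransversal_insert_otherMins (π : Perm (Fin n)) (i : Fin n) :
    IsTransversal π (insert i (otherMins π i)) where
  exists_mem x := by
    by_cases h : π.SameCycle x i
    · exact ⟨i, by simp, h⟩
    · obtain ⟨r, hr, hx⟩ := (isTransversal_cycleMins π).exists_mem x
      exact ⟨r, Finset.mem_insert_of_mem (mem_otherMins.2 ⟨hr, fun h' => h (hx.trans h'.symm)⟩), hx⟩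
  eq_of_sameCycle r hr s hs h := by
    rcases Finset.mem_insert.1 hr with rfl | hr <;> rcases Finset.mem_insert.1 hs with rfl | hs
    · rfl
    · exact absurd h (mem_otherMins.1 hs).2
    · exact absurd h.symm (mem_otherMins.1 hr).2
    · exact (isTransversal_cycleMins π).eq_of_sameCycle _ (mem_otherMins.1 hr).1 _
        (mem_otherMins.1 hs).1 h

theorem sameCycle_iff_of_sameCycle_mul_swap (h : σ.SameCycle i j) (hij : i ≠ j) {x y : Fin n} :
    σ.SameCycle x y ↔ (σ * swap i j).SameCycle x y ∨
      (((σ * swap i j).SameCycle i x ∨ (σ * swap i j).SameCycle j x) ∧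
        ((σ * swap i j).SameCycle i y ∨ (σ * swap i j).SameCycle j y)) := by
  have := sameCycle_mul_swap_iff (x := x) (y := y) (not_sameCycle_mul_swap h hij)
  rwa [mul_assoc, swap_mul_self, mul_one] at this

/-- Splitting a cycle. -/
theorem isTransversal_split (h : σ.SameCycle i j) (hij : i ≠ j) :
    IsTransversal (σ * swap i j) (insert i (insert j (otherMins σ i))) where
  exists_mem x := by
    obtain ⟨r, hr, hx⟩ := (isTransversal_insert_otherMins σ i).exists_mem x
    rcases (sameCycle_iff_of_sameCycle_mul_swap h hij).1 hx with h' | ⟨h' | h', -⟩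
    · exact ⟨r, by simp only [Finset.mem_insert] at hr ⊢; tauto, h'⟩
    · exact ⟨i, by simp, h'.symm⟩
    · exact ⟨j, by simp, h'.symm⟩
  eq_of_sameCycle r hr s hs h' := by
    have hσ := (sameCycle_iff_of_sameCycle_mul_swap h hij).2 (Or.inl h')
    have hn := not_sameCycle_mul_swap h hij
    have hT := (isTransversal_insert_otherMins σ i).eq_of_sameCycle
    simp only [Finset.mem_insert] at hr hs
    rcases hr with rfl | rfl | hr <;> rcases hs with rfl | rfl | hs
    · rfl
    · exact absurd h' hn
    · exact absurd hσ (mem_otherMins.1 hs).2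
    · exact absurd h'.symm hn
    · rfl
    · exact absurd (h.trans hσ) (mem_otherMins.1 hs).2
    · exact absurd hσ.symm (mem_otherMins.1 hr).2
    · exact absurd (h.trans hσ.symm) (mem_otherMins.1 hr).2
    · exact hT _ (by simp [hr]) _ (by simp [hs]) hσ

/-- Joining two cycles. -/
theorem isTransversal_join {y : Fin n} (h : ¬ σ.SameCycle i j) (hy : y ∈ otherMins σ i)
    (hj : σ.SameCycle y j) :
    IsTransversal (σ * swap i j) (insert i ((otherMins σ i).erase y)) where
  exists_mem x := by
    obtain ⟨r, hr, hx⟩ := (isTransversal_insert_otherMins σ i).exists_mem x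
    by_cases hry : r = y
    · subst hry
      exact ⟨i, by simp, (sameCycle_mul_swap_iff h).2 (Or.inr ⟨Or.inr (hx.trans hj).symm,
        Or.inl .rfl⟩)⟩
    · exact ⟨r, by simp only [Finset.mem_insert, Finset.mem_erase] at hr ⊢; tauto,
        (sameCycle_mul_swap_iff h).2 (Or.inl hx)⟩
  eq_of_sameCycle r hr s hs h' := by
    have hT := (isTransversal_insert_otherMins σ i).eq_of_sameCycle
    have key : ∀ z ∈ (otherMins σ i).erase y, ¬ (σ.SameCycle i z ∨ σ.SameCycle j z) := by
      intro z hz hor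
      obtain ⟨hzy, hz⟩ := Finset.mem_erase.1 hz
      rcases hor with h1 | h1
      · exact (mem_otherMins.1 hz).2 h1
      · exact hzy (hT _ (by simp [hz]) _ (by simp [hy]) (h1.symm.trans hj.symm))
    have hsub : ∀ z ∈ insert i ((otherMins σ i).erase y), z ∈ insert i (otherMins σ i) := by
      intro z hz; simp only [Finset.mem_insert, Finset.mem_erase] at hz ⊢; tauto
    rcases (sameCycle_mul_swap_iff h).1 h' with h1 | ⟨h1, h2⟩
    · exact hT _ (hsub _ hr) _ (hsub _ hs) h1
    · rcases Finset.mem_insert.1 hr with rfl | hr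
      · rcases Finset.mem_insert.1 hs with rfl | hs
        · rfl
        · exact absurd h2 (key _ hs)
      · exact absurd h1 (key _ hr)

end Transversal

/-! ### The length function -/

section Length

variable {n : ℕ} {π σ γ : Perm (Fin n)} {i j : Fin n}

theorem permLength_add_numCycles (π : Perm (Fin n)) : permLength π + numCycles π = n := by
  have := numCycles_le π
  simp only [permLength]; omega

theorem numCycles_eq_card_otherMins (π : Perm (Fin n)) (i : Fin n) :
    numCycles π = (otherMins π i).card + 1 := by
  rw [← (isTransversal_insert_otherMins π i).card_eq,
    Finset.card_insert_of_notMem (not_mem_otherMins_of_sameCycle .rfl)]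

theorem permLength_split (h : σ.SameCycle i j) (hij : i ≠ j) :
    permLength σ = permLength (σ * swap i j) + 1 := by
  have h1 := (isTransversal_split h hij).card_eq
  rw [Finset.card_insert_of_notMem (by
    simp only [Finset.mem_insert, not_or]
    exact ⟨hij, not_mem_otherMins_of_sameCycle .rfl⟩),
    Finset.card_insert_of_notMem (not_mem_otherMins_of_sameCycle h)] at h1
  have h2 := numCycles_eq_card_otherMins σ i
  have := permLength_add_numCycles σ
  have := permLength_add_numCycles (σ * swap i j)
  omega

/-- Joining is undone by the same transposition, which then splits a cycle. -/
theorem permLength_join (h : ¬ σ.SameCycle i j) :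
    permLength (σ * swap i j) = permLength σ + 1 := by
  have h1 := permLength_split (sameCycle_mul_swap_of_not h)
    (fun e => h (e ▸ .rfl))
  rwa [mul_assoc, swap_mul_self, mul_one] at h1

theorem permLength_mul_swap_le (σ : Perm (Fin n)) (i j : Fin n) :
    permLength (σ * swap i j) ≤ permLength σ + 1 := by
  by_cases h : σ.SameCycle i j
  · by_cases hij : i = j
    · subst hij
      rw [swap_self]
      exact Nat.le_succ _
    · have := permLength_split h hij; omega
  · exact (permLength_join h).le

/-- Moved to the right of `σ`, the transposition becomes `swap i (σ⁻¹ j)`. It joins the fixed point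
`i` to another cycle. -/
theorem permLength_swap_mul_of_fixed (h : σ i = i) (hij : i ≠ j) :
    permLength (swap i j * σ) = permLength σ + 1 := by
  have e : swap i j * σ = σ * swap i (σ⁻¹ j) := by
    rw [mul_swap_eq_swap_mul, h]; simp
  rw [e]
  refine permLength_join fun hs => hij ?_
  have := (hs.eq_of_left h)
  rw [Perm.eq_inv_iff_eq, h] at this
  exact this

theorem permLength_one : permLength (1 : Perm (Fin n)) = 0 := by
  have : numCycles (1 : Perm (Fin n)) = n := by
    have : cycleMins (1 : Perm (Fin n)) = Finset.univ := by
      ext x; simp [mem_cycleMins]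
    rw [numCycles, this]; simp
  simp [permLength, this]

/-- The triangle inequality for the length function, with the fact that the cycles of a
permutation on a geodesic from `1` to `γ` lie in cycles of `γ`. -/
theorem permLength_le_add (γ π : Perm (Fin n)) :
    permLength γ ≤ permLength π + permLength (π⁻¹ * γ) ∧
      (permLength γ = permLength π + permLength (π⁻¹ * γ) →
        ∀ x y, π.SameCycle x y → γ.SameCycle x y) := by
  generalize hk : permLength (π⁻¹ * γ) = k
  induction k generalizing π with
  | zero =>
    have := eq_one_of_permLength_eq_zero hk
    rw [inv_mul_eq_one] at this
    subst this
    exact ⟨le_rfl, fun _ _ _ h => h⟩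
  | succ k ih =>
    obtain ⟨i, hi⟩ : ∃ i, (π⁻¹ * γ) i ≠ i := by
      by_contra! h
      have : π⁻¹ * γ = 1 := Perm.ext h
      rw [this, permLength_one] at hk
      omega
    set j := (π⁻¹ * γ) i with hj
    have e : (π * swap i j)⁻¹ * γ = swap i j * (π⁻¹ * γ) := by simp [mul_assoc]
    have hfix : ((π * swap i j)⁻¹ * γ) i = i := by rw [e, Perm.mul_apply, ← hj]; simp
    have hlen : permLength ((π * swap i j)⁻¹ * γ) = k := by
      have := permLength_swap_mul_of_fixed hfix (Ne.symm hi)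
      rw [e, ← mul_assoc, swap_mul_self, one_mul, hk, ← e] at this
      omega
    obtain ⟨h1, h2⟩ := ih _ hlen
    have h3 := permLength_mul_swap_le π i j
    refine ⟨by omega, fun heq x y hxy => h2 (by omega) x y ?_⟩
    by_cases hs : π.SameCycle i j
    · have := permLength_split hs (Ne.symm hi)
      omega
    · exact (sameCycle_mul_swap_iff hs).2 (Or.inl hxy)

/-- The permutations on a geodesic from `1` to `γ`. -/
def geodesic (γ : Perm (Fin n)) : Finset (Perm (Fin n)) :=
  {π | permLength γ = permLength π + permLength (π⁻¹ * γ)}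

theorem mem_geodesic : π ∈ geodesic γ ↔
    permLength γ = permLength π + permLength (π⁻¹ * γ) := by simp [geodesic]

theorem NC_eq_geodesic (n : ℕ) : NC n = geodesic (finRotate n) := rfl

theorem sameCycle_of_mem_geodesic (h : π ∈ geodesic γ) {x y : Fin n} (hxy : π.SameCycle x y) :
    γ.SameCycle x y :=
  (permLength_le_add γ π).2 (mem_geodesic.1 h) x y hxy

theorem self_mem_geodesic (γ : Perm (Fin n)) : γ ∈ geodesic γ := by
  simp [mem_geodesic, permLength_one]

end Length

/-! ### Words along cycles -/

section CycleMap

variable {n m : ℕ} {π : Perm (Fin n)} {ρ : Perm (Fin m)}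

theorem finRotate_val (x : Fin n) :
    (finRotate n x : ℕ) = if (x : ℕ) + 1 = n then 0 else (x : ℕ) + 1 := by
  cases n with
  | zero => exact x.elim0
  | succ n =>
    rw [coe_finRotate]
    simp [Fin.ext_iff]

theorem cycleLength_map {f : Fin m → Fin n} (hi : f.Injective) (hf : ∀ x, f (ρ x) = π (f x))
    (x : Fin m) : cycleLength π (f x) = cycleLength ρ x := by
  refine Function.minimalPeriod_eq_minimalPeriod_iff.2 fun k => ?_
  have h : f (ρ^[k] x) = π^[k] (f x) := (Function.Semiconj.iterate_right hf k) x
  rw [Function.IsPeriodicPt, Function.IsPeriodicPt, Function.IsFixedPt, Function.IsFixedPt, ← h,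
    hi.eq_iff]

theorem map_pow {f : Fin m → Fin n} (hf : ∀ x, f (ρ x) = π (f x)) (k : ℕ) (x : Fin m) :
    f ((ρ ^ k) x) = (π ^ k) (f x) := by
  rw [← Perm.iterate_eq_pow, ← Perm.iterate_eq_pow]
  exact (Function.Semiconj.iterate_right hf k) x

theorem cycleLength_congr {x y : Fin n} (h : π.SameCycle x y) :
    cycleLength π x = cycleLength π y := by
  obtain ⟨k, rfl⟩ := h
  refine (cycleLength_map (f := fun z => (π ^ k) z) (π ^ k).injective (fun z => ?_) x).symm
  rw [← Perm.mul_apply, ← Perm.mul_apply, ← zpow_one_add, ← zpow_add_one, add_comm]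

/-- The enumeration `x, π x, π² x, …` of the cycle of `π` through `x`. -/
def cycleMap (π : Perm (Fin n)) (x : Fin n) : Fin (cycleLength π x) → Fin n :=
  fun k => (π ^ (k : ℕ)) x

theorem cycleMap_injective (π : Perm (Fin n)) (x : Fin n) : (cycleMap π x).Injective := by
  intro k l h
  simp only [cycleMap, ← Perm.iterate_eq_pow] at h
  exact Fin.ext (Function.iterate_injOn_Iio_minimalPeriod k.2 l.2 h)

theorem pow_cycleLength (π : Perm (Fin n)) (x : Fin n) : (π ^ cycleLength π x) x = x := by
  rw [← Perm.iterate_eq_pow]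
  exact Function.iterate_minimalPeriod

theorem cycleMap_finRotate (π : Perm (Fin n)) (x : Fin n) (k : Fin (cycleLength π x)) :
    cycleMap π x (finRotate _ k) = π (cycleMap π x k) := by
  simp only [cycleMap, finRotate_val, ← Perm.mul_apply, ← pow_succ']
  split_ifs with h
  · rw [h, pow_cycleLength]; rfl
  · rfl

theorem cycleMap_zero (π : Perm (Fin n)) (x : Fin n) : cycleMap π x ⟨0, cycleLength_pos π x⟩ = x := by
  simp [cycleMap]

theorem sameCycle_cycleMap (π : Perm (Fin n)) (x : Fin n) (k) : π.SameCycle x (cycleMap π x k) :=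
  ⟨k, by simp [cycleMap]⟩

theorem exists_cycleMap_eq {x y : Fin n} (h : π.SameCycle x y) : ∃ k, cycleMap π x k = y := by
  have := exists_of_sameCycle_map (cycleMap_finRotate π x) (x := ⟨0, cycleLength_pos π x⟩) (y := y)
    (by rwa [cycleMap_zero])
  obtain ⟨z, -, hz⟩ := this
  exact ⟨z, hz⟩

theorem finRotate_pow_zero (h : 0 < n) {k : ℕ} (hk : k < n) :
    (finRotate n ^ k) ⟨0, h⟩ = ⟨k, hk⟩ := by
  induction k with
  | zero => rfl
  | succ k ih =>
    rw [pow_succ', Perm.mul_apply, ih (by omega)]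
    ext
    rw [finRotate_val]
    simp only
    rw [if_neg (by omega)]

theorem sameCycle_finRotate (x y : Fin n) : (finRotate n).SameCycle x y := by
  have h : 0 < n := by have := x.2; omega
  have key : ∀ z : Fin n, (finRotate n).SameCycle ⟨0, h⟩ z := fun z =>
    ⟨(z : ℕ), by rw [zpow_natCast, finRotate_pow_zero h z.2]⟩
  exact (key x).symm.trans (key y)

theorem cycleLength_finRotate (x : Fin n) : cycleLength (finRotate n) x = n := by
  have h : 0 < n := by have := x.2; omega
  refine le_antisymm (cycleLength_le _ _) ?_
  by_contra! hlt
  have h1 := pow_cycleLength (finRotate n) ⟨0, h⟩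
  rw [cycleLength_congr (sameCycle_finRotate _ x), finRotate_pow_zero h hlt, Fin.ext_iff] at h1
  exact (cycleLength_pos _ x).ne' h1

theorem cycleMins_finRotate (h : 0 < n) : cycleMins (finRotate n) = {⟨0, h⟩} := by
  ext x
  rw [mem_cycleMins, Finset.mem_singleton]
  constructor
  · exact fun hx => Fin.le_antisymm (hx _ (sameCycle_finRotate _ _)) (Fin.le_def.2 (Nat.zero_le _))
  · rintro rfl y -
    exact Fin.le_def.2 (Nat.zero_le _)

theorem otherMins_finRotate (x : Fin n) : otherMins (finRotate n) x = ∅ :=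
  Finset.eq_empty_of_forall_notMem fun _ hy => (mem_otherMins.1 hy).2 (sameCycle_finRotate _ _)

end CycleMap

/-! ### First order cumulants -/

section First

variable {A : Type*} [Ring A] [Algebra ℂ A] (P : SecondOrderSpace A)

theorem cumulant_congr {m n : ℕ} (h : m = n) {a : Fin m → A} {b : Fin n → A}
    (hab : ∀ k, a k = b (Fin.cast h k)) : cumulant P m a = cumulant P n b := by
  subst h
  congr 1
  exact funext hab

/-- The cumulant of the word along the cycle of `π` through `x`. -/
noncomputable def cycleCumulant {n : ℕ} (π : Perm (Fin n)) (w : Fin n → A) (x : Fin n) : ℂ :=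
  cumulant P (cycleLength π x) (cycleWord π x w)

theorem cycleCumulant_map {m n : ℕ} {π : Perm (Fin n)} {ρ : Perm (Fin m)} {f : Fin m → Fin n}
    (hi : f.Injective) (hf : ∀ x, f (ρ x) = π (f x)) (w : Fin n → A) (x : Fin m) :
    cycleCumulant P π w (f x) = cycleCumulant P ρ (fun k => w (f k)) x := by
  refine cumulant_congr P (cycleLength_map hi hf x) fun k => ?_
  simp only [cycleWord, Fin.val_cast, map_pow hf]

theorem cycleCumulant_finRotate {n : ℕ} (h : 0 < n) (w : Fin n → A) :
    cycleCumulant P (finRotate n) w ⟨0, h⟩ = cumulant P n w := by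
  refine cumulant_congr P (cycleLength_finRotate _) fun k => ?_
  simp only [cycleWord]
  rw [finRotate_pow_zero h (k.2.trans_le (cycleLength_le _ _))]
  rfl

theorem cycleCumulant_eq_cumulant_cycleMap {n : ℕ} (π : Perm (Fin n)) (w : Fin n → A)
    (x : Fin n) : cycleCumulant P π w x =
      cumulant P (cycleLength π x) (fun k => w (cycleMap π x k)) := rfl

/-- The cumulant as a moment minus terms with shorter cycles. -/
theorem cumulant_eq_sub (n : ℕ) (a : Fin n → A) : cumulant P n a = P.φ (List.ofFn a).prod -
    ∑ π ∈ (NC n).erase (finRotate n), ∏ x ∈ cycleMins π, cycleCumulant P π a x := by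
  rw [cumulant, ← Finset.sum_attach ((NC n).erase (finRotate n))]
  rfl

theorem moment_eq_sum {n : ℕ} (h : 0 < n) (a : Fin n → A) : P.φ (List.ofFn a).prod =
    ∑ π ∈ NC n, ∏ x ∈ cycleMins π, cycleCumulant P π a x := by
  have := cumulant_eq_sub P n a
  rw [← Finset.add_sum_erase _ _ (show finRotate n ∈ NC n from self_mem_geodesic _),
    cycleMins_finRotate h, Finset.prod_singleton, cycleCumulant_finRotate, this]
  ring

theorem ofFn_comp_finRotate_prod {M : Type*} [Monoid M] {n : ℕ} (a : Fin (n + 1) → M) :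
    (List.ofFn fun k => a (finRotate _ k)).prod =
      (List.ofFn fun k : Fin n => a k.succ).prod * a 0 := by
  rw [List.ofFn_succ', List.concat_eq_append, List.prod_append]
  simp

theorem permLength_conj {n m : ℕ} (e : Fin n ≃ Fin m) {π : Perm (Fin n)} {ρ : Perm (Fin m)}
    (he : ∀ x, e (π x) = ρ (e x)) : permLength ρ = permLength π := by
  have h := ((isTransversal_cycleMins π).image e he).card_eq
  rw [Finset.card_map] at h
  have hnm : n = m := by simpa using Fintype.card_congr e
  have h1 := permLength_add_numCycles π
  have h2 := permLength_add_numCycles ρ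
  rw [← h] at h2
  change _ + (cycleMins π).card = _ at h1
  omega

theorem mem_geodesic_conj {n m : ℕ} (e : Fin n ≃ Fin m) {γ π : Perm (Fin n)}
    {γ' ρ : Perm (Fin m)} (hγ : ∀ x, e (γ x) = γ' (e x)) (he : ∀ x, e (π x) = ρ (e x)) :
    ρ ∈ geodesic γ' ↔ π ∈ geodesic γ := by
  have h : ∀ x, e ((π⁻¹ * γ) x) = (ρ⁻¹ * γ') (e x) := by
    intro x
    rw [Perm.mul_apply, Perm.mul_apply, Perm.eq_inv_iff_eq, ← hγ, ← he]
    simp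
  rw [mem_geodesic, mem_geodesic, permLength_conj e hγ, permLength_conj e he, permLength_conj e h]

/-- The moment is invariant by traciality, and conjugation by the rotation permutes the non-crossing
partitions. It does not preserve the least points of cycles, so the induction hypothesis is first
used to start the shorter cycles anywhere (`hinv`). -/
theorem cumulant_comp_finRotate (n : ℕ) (a : Fin n → A) :
    cumulant P n (fun k => a (finRotate n k)) = cumulant P n a := by
  induction n using Nat.strong_induction_on with
  | _ n ih =>
  have hinv : ∀ {m} (π : Perm (Fin m)) (w : Fin m → A) (x : Fin m), cycleLength π x < n →
      ∀ y, π.SameCycle x y → cycleCumulant P π w x = cycleCumulant P π w y := by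
    intro m π w x hx y hxy
    have hstep : ∀ z, cycleLength π z < n →
        cycleCumulant P π w (π z) = cycleCumulant P π w z := by
      intro z hz
      rw [cycleCumulant_map P (f := π) (ρ := π) π.injective (fun _ => rfl),
        cycleCumulant_eq_cumulant_cycleMap, cycleCumulant_eq_cumulant_cycleMap,
        ← ih _ hz (fun k => w (cycleMap π z k))]
      simp only [cycleMap_finRotate]
    refine (rel_of_sameCycle (r := fun x y => cycleLength π x = cycleLength π y ∧
      (cycleLength π x < n → cycleCumulant P π w x = cycleCumulant P π w y))
      ⟨fun _ => ⟨rfl, fun _ => rfl⟩, fun h => ⟨h.1.symm, fun t => (h.2 (h.1 ▸ t)).symm⟩,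
        fun h k => ⟨h.1.trans k.1, fun t => (h.2 t).trans (k.2 (h.1 ▸ t))⟩⟩
      (fun z => ⟨cycleLength_congr (sameCycle_apply_self _ _), fun t => (hstep z t).symm⟩) hxy).2 hx
  rcases Nat.eq_zero_or_pos n with rfl | hn
  · exact congrArg _ (funext fun k => k.elim0)
  rw [cumulant_eq_sub, cumulant_eq_sub P n a]
  congr 1
  · obtain ⟨n, rfl⟩ : ∃ k, n = k + 1 := ⟨n - 1, by omega⟩
    rw [ofFn_comp_finRotate_prod, P.φ_tracial, List.ofFn_succ, List.prod_cons]
  · set γ := finRotate n with hγ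
    refine Finset.sum_equiv (MulAut.conj γ).toEquiv ?_ ?_
    · intro π
      have := mem_geodesic_conj γ (γ := γ) (γ' := γ) (π := π) (ρ := γ * π * γ⁻¹)
        (fun _ => rfl) (by simp)
      simp only [Finset.mem_erase, NC_eq_geodesic, ne_eq, MulEquiv.toEquiv_eq_coe,
        EquivLike.coe_coe, MulAut.conj_apply, ← hγ, this, mul_inv_eq_iff_eq_mul, mul_right_inj]
    · intro π hπ
      have he : ∀ x, γ (π x) = (γ * π * γ⁻¹) (γ x) := by simp
      have hmem : γ * π * γ⁻¹ ∈ (NC n).erase γ := by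
        have := mem_geodesic_conj γ (γ := γ) (γ' := γ) (fun _ => rfl) he
        simp only [Finset.mem_erase, NC_eq_geodesic, ne_eq] at hπ ⊢
        rw [← hγ, this, mul_inv_eq_iff_eq_mul, mul_right_inj]
        exact hπ
      simp only [MulEquiv.toEquiv_eq_coe, EquivLike.coe_coe, MulAut.conj_apply]
      rw [← ((isTransversal_cycleMins π).image γ he).prod_eq (isTransversal_cycleMins _)
        (fun x y => hinv _ _ _ (cycleLength_lt hmem x) y), Finset.prod_map]
      exact Finset.prod_congr rfl fun x _ =>
        (cycleCumulant_map P γ.injective he a x).symm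

/-- Rotation invariance along a cycle. From here on a first order factor belongs to the cycle rather
than to its starting point. -/
theorem cycleCumulant_congr {n : ℕ} {π : Perm (Fin n)} {w : Fin n → A} {x y : Fin n}
    (h : π.SameCycle x y) : cycleCumulant P π w x = cycleCumulant P π w y := by
  refine rel_of_sameCycle (r := fun x y => cycleCumulant P π w x = cycleCumulant P π w y)
    ⟨fun _ => rfl, fun h => h.symm, fun h k => h.trans k⟩ (fun z => ?_) h
  rw [cycleCumulant_map P (f := π) (ρ := π) π.injective (fun _ => rfl),
    cycleCumulant_eq_cumulant_cycleMap, cycleCumulant_eq_cumulant_cycleMap,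
    ← cumulant_comp_finRotate P _ (fun k => w (cycleMap π z k))]
  simp only [cycleMap_finRotate]

end First

/-! ### Products of permutations of the two circles -/

section ProdPerm

variable {m n : ℕ}

/-- The permutation of `Fin (m + n)` that acts as `π` on the first circle and as `ρ` on the
second one. -/
def prodPerm (π : Perm (Fin m)) (ρ : Perm (Fin n)) : Perm (Fin (m + n)) :=
  finSumFinEquiv.permCongr (Perm.sumCongr π ρ)

/-- The points of the first circle. -/
def circle (m n : ℕ) : Finset (Fin (m + n)) := {x | (x : ℕ) < m}

theorem mem_circle {x : Fin (m + n)} : x ∈ circle m n ↔ (x : ℕ) < m := by simp [circle]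

theorem castAdd_mem_circle (i : Fin m) : Fin.castAdd n i ∈ circle m n := by simp [mem_circle]
theorem natAdd_notMem_circle (j : Fin n) : Fin.natAdd m j ∉ circle m n := by simp [mem_circle]

variable (π : Perm (Fin m)) (ρ : Perm (Fin n))

theorem annularRotation_eq_prodPerm : annularRotation m n = prodPerm (finRotate m) (finRotate n) :=
  rfl

@[simp] theorem prodPerm_castAdd (i : Fin m) :
    prodPerm π ρ (Fin.castAdd n i) = Fin.castAdd n (π i) := by
  simp [prodPerm, Equiv.permCongr_apply]

@[simp] theorem prodPerm_natAdd (j : Fin n) :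
    prodPerm π ρ (Fin.natAdd m j) = Fin.natAdd m (ρ j) := by
  simp [prodPerm, Equiv.permCongr_apply]

theorem perm_ext_add {σ τ : Perm (Fin (m + n))}
    (h : ∀ i, σ (Fin.castAdd n i) = τ (Fin.castAdd n i))
    (h' : ∀ j, σ (Fin.natAdd m j) = τ (Fin.natAdd m j)) : σ = τ :=
  Perm.ext fun x => Fin.addCases h h' x

theorem prodPerm_mul (π' : Perm (Fin m)) (ρ' : Perm (Fin n)) :
    prodPerm π ρ * prodPerm π' ρ' = prodPerm (π * π') (ρ * ρ') :=
  perm_ext_add (by simp) (by simp)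

theorem prodPerm_inv : (prodPerm π ρ)⁻¹ = prodPerm π⁻¹ ρ⁻¹ := by
  rw [inv_eq_iff_mul_eq_one, prodPerm_mul]
  exact perm_ext_add (by simp) (by simp)

theorem prodPerm_mem_circle_iff (x : Fin (m + n)) :
    prodPerm π ρ x ∈ circle m n ↔ x ∈ circle m n := by
  refine Fin.addCases (fun i => ?_) (fun j => ?_) x
  · simp only [prodPerm_castAdd, castAdd_mem_circle]
  · simp only [prodPerm_natAdd, natAdd_notMem_circle]

theorem annularRotation_mem_circle_iff (x : Fin (m + n)) :
    annularRotation m n x ∈ circle m n ↔ x ∈ circle m n := prodPerm_mem_circle_iff _ _ x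

theorem castAdd_mem_cycleMins {i : Fin m} :
    Fin.castAdd n i ∈ cycleMins (prodPerm π ρ) ↔ i ∈ cycleMins π := by
  have hf : ∀ x, Fin.castAdd n (π x) = prodPerm π ρ (Fin.castAdd n x) := by simp
  simp only [mem_cycleMins]
  constructor
  · exact fun h y hy => h _ (sameCycle_of_maps (f := Fin.castAdd n) hf hy)
  · intro h y hy
    obtain ⟨z, hz, rfl⟩ := exists_of_sameCycle_map (f := Fin.castAdd n) hf hy
    exact h z hz

theorem natAdd_mem_cycleMins {j : Fin n} :
    Fin.natAdd m j ∈ cycleMins (prodPerm π ρ) ↔ j ∈ cycleMins ρ := by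
  have hf : ∀ x, Fin.natAdd m (ρ x) = prodPerm π ρ (Fin.natAdd m x) := by simp
  simp only [mem_cycleMins]
  constructor
  · exact fun h y hy => Nat.le_of_add_le_add_left (h _ (sameCycle_of_maps (f := Fin.natAdd m) hf hy))
  · intro h y hy
    obtain ⟨z, hz, rfl⟩ := exists_of_sameCycle_map (f := Fin.natAdd m) hf hy
    exact Nat.add_le_add_left (h z hz) m

theorem castAdd_ne_natAdd (i : Fin m) (j : Fin n) : Fin.castAdd n i ≠ Fin.natAdd m j := by
  intro h
  have := i.2
  simp only [Fin.ext_iff, Fin.val_castAdd, Fin.val_natAdd] at h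
  omega

theorem cycleMins_prodPerm : cycleMins (prodPerm π ρ) =
    (cycleMins π).map (Fin.castAddEmb n) ∪ (cycleMins ρ).map (Fin.natAddEmb m) := by
  ext x
  refine Fin.addCases (fun i => ?_) (fun j => ?_) x
  · simp [castAdd_mem_cycleMins, (castAdd_ne_natAdd _ _).symm]
  · simp [natAdd_mem_cycleMins, castAdd_ne_natAdd]

theorem disjoint_map_castAdd_natAdd (R : Finset (Fin m)) (S : Finset (Fin n)) :
    Disjoint (R.map (Fin.castAddEmb n)) (S.map (Fin.natAddEmb m)) := by
  rw [Finset.disjoint_left]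
  rintro x hx hy
  obtain ⟨i, -, rfl⟩ := Finset.mem_map.1 hx
  obtain ⟨j, -, h⟩ := Finset.mem_map.1 hy
  exact castAdd_ne_natAdd i j h.symm

theorem permLength_prodPerm : permLength (prodPerm π ρ) = permLength π + permLength ρ := by
  have h : numCycles (prodPerm π ρ) = numCycles π + numCycles ρ := by
    rw [numCycles, cycleMins_prodPerm, Finset.card_union_of_disjoint
      (disjoint_map_castAdd_natAdd _ _), Finset.card_map, Finset.card_map]
    rfl
  have := permLength_add_numCycles (prodPerm π ρ)
  have := permLength_add_numCycles π
  have := permLength_add_numCycles ρ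
  omega

/-- Lengths add over the two circles, and the triangle inequality holds on each. Equality in the sum
therefore forces equality on both. -/
theorem prodPerm_mem_geodesic (γ : Perm (Fin m)) (δ : Perm (Fin n)) :
    prodPerm π ρ ∈ geodesic (prodPerm γ δ) ↔ π ∈ geodesic γ ∧ ρ ∈ geodesic δ := by
  simp only [mem_geodesic, prodPerm_inv, prodPerm_mul, permLength_prodPerm]
  have h1 := (permLength_le_add γ π).1
  have h2 := (permLength_le_add δ ρ).1
  omega

theorem prodPerm_injective {π π' : Perm (Fin m)} {ρ ρ' : Perm (Fin n)}
    (h : prodPerm π ρ = prodPerm π' ρ') : π = π' ∧ ρ = ρ' := by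
  constructor
  · ext i
    have := congrArg (fun σ => σ (Fin.castAdd n i)) h
    simpa [Fin.ext_iff] using this
  · ext i
    have := congrArg (fun σ => σ (Fin.natAdd m i)) h
    simpa [Fin.ext_iff] using this

theorem exists_eq_prodPerm {σ : Perm (Fin (m + n))}
    (h : ∀ x ∈ circle m n, σ x ∈ circle m n) : ∃ π ρ, σ = prodPerm π ρ := by
  have hr : finSumFinEquiv.symm.permCongr σ ∈ (Perm.sumCongrHom (Fin m) (Fin n)).range := by
    refine Perm.mem_sumCongrHom_range_of_perm_mapsTo_inl ?_
    rintro _ ⟨i, rfl⟩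
    have := h _ (castAdd_mem_circle i)
    rw [mem_circle] at this
    refine ⟨⟨σ (Fin.castAdd n i), this⟩, ?_⟩
    simp only [Equiv.permCongr_apply, Equiv.symm_symm, finSumFinEquiv_apply_left]
    rw [Equiv.eq_symm_apply]
    rfl
  obtain ⟨⟨π, ρ⟩, h⟩ := hr
  refine ⟨π, ρ, ?_⟩
  have h' : Perm.sumCongr π ρ = finSumFinEquiv.symm.permCongr σ := h
  rw [prodPerm, h']
  ext x
  simp [Equiv.permCongr_apply]

/-- Cycles of a geodesic permutation lie inside cycles of the annular rotation, hence on one circle.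
The geodesic permutations are thus the products of two non-crossing partitions. -/
theorem mem_circle_iff_of_mem_geodesic {σ : Perm (Fin (m + n))}
    (h : σ ∈ geodesic (annularRotation m n)) {x y : Fin (m + n)} (hxy : σ.SameCycle x y) :
    x ∈ circle m n ↔ y ∈ circle m n :=
  mem_of_sameCycle (S := {x | x ∈ circle m n})
    (fun x => (annularRotation_mem_circle_iff x).symm) (sameCycle_of_mem_geodesic h hxy)

end ProdPerm

/-! ### Second order cumulants -/

section Marked

variable {n : ℕ}

/-- The sum over the choices of one marked point of `R` inside and one outside of `C`; the pair of
marked points contributes `g`, the other points of `R` contribute `f`. -/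
def markedSum (R C : Finset (Fin n)) (f : Fin n → ℂ) (g : Fin n → Fin n → ℂ) : ℂ :=
  ∑ x ∈ R with x ∈ C, ∑ y ∈ R with y ∉ C, g x y * ∏ z ∈ (R.erase x).erase y, f z

theorem markedSum_congr {R C : Finset (Fin n)} {f f' : Fin n → ℂ} {g g' : Fin n → Fin n → ℂ}
    (hf : ∀ x ∈ R, f x = f' x) (hg : ∀ x ∈ R, ∀ y ∈ R, x ∈ C → y ∉ C → g x y = g' x y) :
    markedSum R C f g = markedSum R C f' g' := by
  refine Finset.sum_congr rfl fun x hx => Finset.sum_congr rfl fun y hy => ?_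
  rw [Finset.mem_filter] at hx hy
  rw [hg x hx.1 y hy.1 hx.2 hy.2]
  congr 1
  exact Finset.prod_congr rfl fun z hz =>
    hf z (Finset.mem_of_mem_erase (Finset.mem_of_mem_erase hz))

theorem markedSum_bij {m : ℕ} {R C : Finset (Fin n)} {S D : Finset (Fin m)} {f : Fin n → ℂ}
    {g : Fin n → Fin n → ℂ} {f' : Fin m → ℂ} {g' : Fin m → Fin m → ℂ} (e : Fin n → Fin m)
    (he : Set.BijOn e R S) (hC : ∀ x ∈ R, e x ∈ D ↔ x ∈ C) (hf : ∀ x ∈ R, f x = f' (e x))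
    (hg : ∀ x ∈ R, ∀ y ∈ R, x ∈ C → y ∉ C → g x y = g' (e x) (e y)) :
    markedSum R C f g = markedSum S D f' g' := by
  refine Finset.sum_bij (fun x _ => e x) ?_ ?_ ?_ ?_
  · intro x hx
    rw [Finset.mem_filter] at hx ⊢
    exact ⟨he.1 hx.1, (hC x hx.1).2 hx.2⟩
  · intro x hx y hy h
    exact he.2.1 (Finset.mem_filter.1 hx).1 (Finset.mem_filter.1 hy).1 h
  · intro y hy
    rw [Finset.mem_filter] at hy
    obtain ⟨x, hx, rfl⟩ := he.2.2 hy.1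
    exact ⟨x, Finset.mem_filter.2 ⟨hx, (hC x hx).1 hy.2⟩, rfl⟩
  intro x hx
  rw [Finset.mem_filter] at hx
  refine Finset.sum_bij (fun y _ => e y) ?_ ?_ ?_ ?_
  · intro y hy
    rw [Finset.mem_filter] at hy ⊢
    exact ⟨he.1 hy.1, fun h => hy.2 ((hC y hy.1).1 h)⟩
  · intro x hx y hy h
    exact he.2.1 (Finset.mem_filter.1 hx).1 (Finset.mem_filter.1 hy).1 h
  · intro y hy
    rw [Finset.mem_filter] at hy
    obtain ⟨z, hz, rfl⟩ := he.2.2 hy.1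
    exact ⟨z, Finset.mem_filter.2 ⟨hz, fun h => hy.2 ((hC z hz).2 h)⟩, rfl⟩
  intro y hy
  rw [Finset.mem_filter] at hy
  rw [hg x hx.1 y hy.1 hx.2 hy.2]
  congr 1
  refine Finset.prod_bij (fun z _ => e z) ?_ ?_ ?_ ?_
  · intro z hz
    simp only [Finset.mem_erase] at hz ⊢
    exact ⟨fun h => hz.1 (he.2.1 hz.2.2 hy.1 h), fun h => hz.2.1 (he.2.1 hz.2.2 hx.1 h),
      he.1 hz.2.2⟩
  · intro z hz z' hz' h
    simp only [Finset.mem_erase] at hz hz'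
    exact he.2.1 hz.2.2 hz'.2.2 h
  · intro z hz
    simp only [Finset.mem_erase] at hz
    obtain ⟨z', hz', rfl⟩ := he.2.2 hz.2.2
    refine ⟨z', ?_, rfl⟩
    simp only [Finset.mem_erase]
    exact ⟨fun h => hz.1 (h ▸ rfl), fun h => hz.2.1 (h ▸ rfl), hz'⟩
  · intro z hz
    simp only [Finset.mem_erase] at hz
    exact hf z hz.2.2

theorem IsTransversal.markedSum_eq {π : Perm (Fin n)} {R S C : Finset (Fin n)}
    (hR : IsTransversal π R) (hS : IsTransversal π S) {f : Fin n → ℂ} {g : Fin n → Fin n → ℂ}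
    (hC : ∀ x y, π.SameCycle x y → (x ∈ C ↔ y ∈ C)) (hf : ∀ x y, π.SameCycle x y → f x = f y)
    (hg : ∀ x x' y y', x ∈ C → y ∉ C → π.SameCycle x x' → π.SameCycle y y' → g x y = g x' y') :
    markedSum R C f g = markedSum S C f g := by
  obtain ⟨e, he, hs⟩ := hR.exists_equiv hS
  exact markedSum_bij e he (fun x _ => (hC _ _ (hs x)).symm) (fun x _ => hf _ _ (hs x))
    (fun x _ y _ hx hy => hg _ _ _ _ hx hy (hs x) (hs y))

/-- Exchanging the roles of the circles exchanges the two marked points; needed for the symmetry of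
second order cumulants. -/
theorem markedSum_compl (R C : Finset (Fin n)) (f : Fin n → ℂ) (g : Fin n → Fin n → ℂ) :
    markedSum R Cᶜ f g = markedSum R C f (fun x y => g y x) := by
  simp only [markedSum, Finset.mem_compl, not_not]
  rw [Finset.sum_comm]
  simp only [Finset.erase_right_comm]

end Marked

/-! ### The second order moment-cumulant formula as a sum over geodesic permutations -/

section Second

variable {A : Type*} [Ring A] [Algebra ℂ A] (P : SecondOrderSpace A)

theorem cumulant₂_congr {m n m' n' : ℕ} (h : m = m') (h' : n = n') {a : Fin m → A} {b : Fin n → A}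
    {a' : Fin m' → A} {b' : Fin n' → A} (ha : ∀ k, a k = a' (Fin.cast h k))
    (hb : ∀ k, b k = b' (Fin.cast h' k)) : cumulant₂ P m n a b = cumulant₂ P m' n' a' b' := by
  subst h h'
  congr 1
  · exact funext ha
  · exact funext hb

/-- The second order cumulant of the words along the cycles of `π` through `x` and `y`. -/
noncomputable def cycleCumulant₂ {n : ℕ} (π : Perm (Fin n)) (w : Fin n → A) (x y : Fin n) : ℂ :=
  cumulant₂ P (cycleLength π x) (cycleLength π y) (cycleWord π x w) (cycleWord π y w)

theorem cycleCumulant₂_map' {m m' n : ℕ} {π : Perm (Fin n)} {ρ : Perm (Fin m)}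
    {ρ' : Perm (Fin m')} {f : Fin m → Fin n} {f' : Fin m' → Fin n}
    (hi : f.Injective) (hf : ∀ x, f (ρ x) = π (f x)) (hi' : f'.Injective)
    (hf' : ∀ x, f' (ρ' x) = π (f' x)) (w : Fin n → A) (x : Fin m) (y : Fin m') :
    cycleCumulant₂ P π w (f x) (f' y) = cumulant₂ P (cycleLength ρ x) (cycleLength ρ' y)
      (cycleWord ρ x fun k => w (f k)) (cycleWord ρ' y fun k => w (f' k)) := by
  refine cumulant₂_congr P (cycleLength_map hi hf x) (cycleLength_map hi' hf' y) (fun k => ?_)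
    (fun k => ?_)
  · simp only [cycleWord, Fin.val_cast, map_pow hf]
  · simp only [cycleWord, Fin.val_cast, map_pow hf']

theorem cycleCumulant₂_map {m n : ℕ} {π : Perm (Fin n)} {ρ : Perm (Fin m)} {f : Fin m → Fin n}
    (hi : f.Injective) (hf : ∀ x, f (ρ x) = π (f x)) (w : Fin n → A) (x y : Fin m) :
    cycleCumulant₂ P π w (f x) (f y) = cycleCumulant₂ P ρ (fun k => w (f k)) x y :=
  cycleCumulant₂_map' P hi hf hi hf w x y

theorem cycleCumulant₂_annularRotation {m n : ℕ} (hm : 0 < m) (hn : 0 < n)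
    (w : Fin (m + n) → A) :
    cycleCumulant₂ P (annularRotation m n) w (Fin.castAdd n ⟨0, hm⟩) (Fin.natAdd m ⟨0, hn⟩) =
      cumulant₂ P m n (fun i => w (Fin.castAdd n i)) (fun j => w (Fin.natAdd m j)) := by
  rw [cycleCumulant₂_map' P (ρ := finRotate m) (ρ' := finRotate n) (Fin.castAdd_injective m n)
    (by simp [annularRotation_eq_prodPerm]) (Fin.natAdd_injective n m)
    (by simp [annularRotation_eq_prodPerm])]
  refine cumulant₂_congr P (cycleLength_finRotate _) (cycleLength_finRotate _) (fun k => ?_)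
    (fun k => ?_)
  · simp only [cycleWord]
    rw [finRotate_pow_zero hm (k.2.trans_le (cycleLength_le _ _))]
    rfl
  · simp only [cycleWord]
    rw [finRotate_pow_zero hn (k.2.trans_le (cycleLength_le _ _))]
    rfl

theorem prod_erase_erase_cycleMins {m n : ℕ} (π : Perm (Fin m)) (ρ : Perm (Fin n)) (i : Fin m)
    (j : Fin n) (f : Fin (m + n) → ℂ) :
    ∏ z ∈ ((cycleMins (prodPerm π ρ)).erase (Fin.castAdd n i)).erase (Fin.natAdd m j), f z =
      (∏ r ∈ (cycleMins π).erase i, f (Fin.castAdd n r)) *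
        ∏ s ∈ (cycleMins ρ).erase j, f (Fin.natAdd m s) := by
  have h : ((cycleMins (prodPerm π ρ)).erase (Fin.castAdd n i)).erase (Fin.natAdd m j) =
      ((cycleMins π).erase i).map (Fin.castAddEmb n) ∪
        ((cycleMins ρ).erase j).map (Fin.natAddEmb m) := by
    ext x
    refine Fin.addCases (fun i => ?_) (fun j => ?_) x
    · simp [castAdd_mem_cycleMins, (castAdd_ne_natAdd _ _).symm, castAdd_ne_natAdd]
    · simp [natAdd_mem_cycleMins, castAdd_ne_natAdd, (castAdd_ne_natAdd _ _).symm]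
  rw [h, Finset.prod_union (disjoint_map_castAdd_natAdd _ _), Finset.prod_map, Finset.prod_map]
  rfl

theorem markedSum_cycleMins_prodPerm {m n : ℕ} (π : Perm (Fin m)) (ρ : Perm (Fin n))
    (f : Fin (m + n) → ℂ) (g : Fin (m + n) → Fin (m + n) → ℂ) :
    markedSum (cycleMins (prodPerm π ρ)) (circle m n) f g =
      ∑ i ∈ cycleMins π, ∑ j ∈ cycleMins ρ, g (Fin.castAdd n i) (Fin.natAdd m j) *
        ((∏ r ∈ (cycleMins π).erase i, f (Fin.castAdd n r)) *
          ∏ s ∈ (cycleMins ρ).erase j, f (Fin.natAdd m s)) := by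
  have h1 : (cycleMins (prodPerm π ρ)).filter (· ∈ circle m n) =
      (cycleMins π).map (Fin.castAddEmb n) := by
    ext x
    refine Fin.addCases (fun i => ?_) (fun j => ?_) x
    · simp [castAdd_mem_cycleMins, castAdd_mem_circle]
    · simp [castAdd_ne_natAdd, natAdd_notMem_circle]
  have h2 : (cycleMins (prodPerm π ρ)).filter (· ∉ circle m n) =
      (cycleMins ρ).map (Fin.natAddEmb m) := by
    ext x
    refine Fin.addCases (fun i => ?_) (fun j => ?_) x
    · simp [(castAdd_ne_natAdd _ _).symm, castAdd_mem_circle]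
    · simp [natAdd_mem_cycleMins, natAdd_notMem_circle]
  rw [markedSum, h1, h2, Finset.sum_map]
  refine Finset.sum_congr rfl fun i _ => ?_
  rw [Finset.sum_map]
  refine Finset.sum_congr rfl fun j _ => ?_
  rw [← prod_erase_erase_cycleMins]
  rfl

/-- The second order cumulant as a second order moment minus terms with shorter cycles. -/
theorem cumulant₂_eq_sub (m n : ℕ) (a : Fin m → A) (b : Fin n → A) :
    cumulant₂ P m n a b = P.φ₂ (List.ofFn a).prod (List.ofFn b).prod -
      ∑ π ∈ annularNC m n, ∏ x ∈ cycleMins π, cycleCumulant P π (Fin.append a b) x -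
      ∑ π ∈ (geodesic (annularRotation m n)).erase (annularRotation m n),
        markedSum (cycleMins π) (circle m n) (cycleCumulant P π (Fin.append a b))
          (cycleCumulant₂ P π (Fin.append a b)) := by
  rw [cumulant₂]
  congr 1
  rw [Finset.sum_attach ((NC m ×ˢ NC n).erase (finRotate m, finRotate n))
    (fun π => ∑ i ∈ cycleMins π.1, ∑ j ∈ cycleMins π.2,
        cumulant₂ P (cycleLength π.1 i) (cycleLength π.2 j)
            (cycleWord π.1 i a) (cycleWord π.2 j b) *
          (∏ r ∈ (cycleMins π.1).erase i,
            cumulant P (cycleLength π.1 r) (cycleWord π.1 r a)) *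
          ∏ s ∈ (cycleMins π.2).erase j,
            cumulant P (cycleLength π.2 s) (cycleWord π.2 s b))]
  -- `prodPerm` identifies the pairs of non-crossing partitions with the geodesic below the annular
  -- rotation, and the choice of two joined cycles with the two marked points.
  refine Finset.sum_bij (fun π _ => prodPerm π.1 π.2) ?_ ?_ ?_ ?_
  · rintro ⟨π, ρ⟩ h
    rw [Finset.mem_erase, Finset.mem_product] at h
    rw [Finset.mem_erase, annularRotation_eq_prodPerm, prodPerm_mem_geodesic]
    refine ⟨fun he => h.1 ?_, h.2⟩
    obtain ⟨h1, h2⟩ := prodPerm_injective he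
    exact Prod.ext h1 h2
  · rintro ⟨π, ρ⟩ - ⟨π', ρ'⟩ - h
    obtain ⟨h1, h2⟩ := prodPerm_injective h
    exact Prod.ext h1 h2
  · intro σ hσ
    rw [Finset.mem_erase] at hσ
    obtain ⟨π, ρ, rfl⟩ := exists_eq_prodPerm (σ := σ) fun x hx =>
      (mem_circle_iff_of_mem_geodesic hσ.2 (sameCycle_apply_self σ x)).1 hx
    rw [annularRotation_eq_prodPerm, prodPerm_mem_geodesic] at hσ
    refine ⟨(π, ρ), ?_, rfl⟩
    rw [Finset.mem_erase, Finset.mem_product]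
    refine ⟨fun h => hσ.1 ?_, hσ.2⟩
    simp only [Prod.mk.injEq] at h
    rw [h.1, h.2]
  · rintro ⟨π, ρ⟩ -
    have hc : ∀ x, Fin.castAdd n (π x) = prodPerm π ρ (Fin.castAdd n x) := by simp
    have hn : ∀ x, Fin.natAdd m (ρ x) = prodPerm π ρ (Fin.natAdd m x) := by simp
    rw [markedSum_cycleMins_prodPerm]
    refine Finset.sum_congr rfl fun i _ => Finset.sum_congr rfl fun j _ => ?_
    rw [mul_assoc, cycleCumulant₂_map' P (Fin.castAdd_injective m n) hc (Fin.natAdd_injective n m)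
      hn]
    simp only [cycleCumulant_map P (Fin.castAdd_injective m n) hc,
      cycleCumulant_map P (Fin.natAdd_injective n m) hn, Fin.append_left, Fin.append_right]
    rfl

end Second

/-! ### Annular permutations for an arbitrary rotation and an arbitrary set of points -/

section Annulus

variable {n m : ℕ}

/-- The permutations that have a cycle meeting both `C` and its complement and satisfy the length
condition of non-crossing annular permutations with respect to `γ`. -/
def annulus (γ : Perm (Fin n)) (C : Finset (Fin n)) : Finset (Perm (Fin n)) :=
  {π | (∃ x y, x ∈ C ∧ y ∉ C ∧ π.SameCycle x y) ∧
    permLength γ + 2 = permLength π + permLength (π⁻¹ * γ)}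

theorem mem_annulus {γ π : Perm (Fin n)} {C : Finset (Fin n)} : π ∈ annulus γ C ↔
    (∃ x y, x ∈ C ∧ y ∉ C ∧ π.SameCycle x y) ∧
      permLength γ + 2 = permLength π + permLength (π⁻¹ * γ) := by
  simp [annulus]

/-- In the form with a free `γ` and `C` the set can be relabelled and `C` replaced by its
complement. -/
theorem annularNC_eq_annulus (m n : ℕ) :
    annularNC m n = annulus (annularRotation m n) (circle m n) := by
  ext π
  rw [mem_annulus]
  simp only [annularNC, Finset.mem_filter, Finset.mem_univ, true_and]
  refine and_congr_left fun _ => ⟨?_, ?_⟩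
  · rintro ⟨i, j, h⟩
    exact ⟨_, _, castAdd_mem_circle i, natAdd_notMem_circle j, h⟩
  · rintro ⟨x, y, hx, hy, h⟩
    induction x using Fin.addCases with
    | right j => exact absurd hx (natAdd_notMem_circle j)
    | left i =>
      induction y using Fin.addCases with
      | left j => exact absurd (castAdd_mem_circle j) hy
      | right j => exact ⟨i, j, h⟩

theorem annulus_compl (γ : Perm (Fin n)) (C : Finset (Fin n)) : annulus γ Cᶜ = annulus γ C := by
  ext π
  simp only [mem_annulus, Finset.mem_compl, not_not]
  refine and_congr_left fun _ => ⟨?_, ?_⟩ <;>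
  · rintro ⟨x, y, hx, hy, h⟩
    exact ⟨y, x, hy, hx, h.symm⟩

theorem mem_annulus_conj (e : Fin n ≃ Fin m) {γ π : Perm (Fin n)} {γ' ρ : Perm (Fin m)}
    {C : Finset (Fin n)} {D : Finset (Fin m)} (hγ : ∀ x, e (γ x) = γ' (e x))
    (he : ∀ x, e (π x) = ρ (e x)) (hC : ∀ x, e x ∈ D ↔ x ∈ C) :
    ρ ∈ annulus γ' D ↔ π ∈ annulus γ C := by
  have h : ∀ x, e ((π⁻¹ * γ) x) = (ρ⁻¹ * γ') (e x) := by
    intro x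
    rw [Perm.mul_apply, Perm.mul_apply, Perm.eq_inv_iff_eq, ← hγ, ← he]
    simp
  rw [mem_annulus, mem_annulus, permLength_conj e hγ, permLength_conj e he, permLength_conj e h]
  refine and_congr_left fun _ => ⟨?_, ?_⟩
  · rintro ⟨x, y, hx, hy, hs⟩
    obtain ⟨x, rfl⟩ := e.surjective x
    obtain ⟨y, rfl⟩ := e.surjective y
    exact ⟨x, y, (hC x).1 hx, fun h => hy ((hC y).2 h), (sameCycle_map_iff e.injective he).1 hs⟩
  · rintro ⟨x, y, hx, hy, hs⟩
    exact ⟨e x, e y, (hC x).2 hx, fun h => hy ((hC y).1 h), sameCycle_of_maps he hs⟩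

theorem apply_permCongr (e : Fin n ≃ Fin m) (π : Perm (Fin n)) (x : Fin n) :
    e (π x) = e.permCongr π (e x) := by
  simp [Equiv.permCongr_apply]

theorem cycleLength_add_lt_of_mem {σ : Perm (Fin (m + n))}
    (h : σ ∈ (geodesic (annularRotation m n)).erase (annularRotation m n)) {x y : Fin (m + n)}
    (hx : x ∈ circle m n) (hy : y ∉ circle m n) : cycleLength σ x + cycleLength σ y < m + n := by
  rw [Finset.mem_erase] at h
  obtain ⟨π, ρ, rfl⟩ := exists_eq_prodPerm (σ := σ) fun x hx =>
      (mem_circle_iff_of_mem_geodesic h.2 (sameCycle_apply_self σ x)).1 hx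
  rw [annularRotation_eq_prodPerm, prodPerm_mem_geodesic] at h
  induction x using Fin.addCases with
  | right j => exact absurd hx (natAdd_notMem_circle j)
  | left i =>
    induction y using Fin.addCases with
    | left j => exact absurd (castAdd_mem_circle j) hy
    | right j =>
      rw [cycleLength_map (ρ := π) (Fin.castAdd_injective m n) (by simp),
        cycleLength_map (ρ := ρ) (Fin.natAdd_injective n m) (by simp)]
      refine cycleLength_add_lt (π := (π, ρ)) ?_ i j
      rw [Finset.mem_erase, Finset.mem_product]
      refine ⟨fun e => h.1 ?_, h.2⟩
      simp only [Prod.mk.injEq] at e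
      rw [e.1, e.2]

end Annulus

/-! ### Invariance of second order cumulants under rotation and exchange of the circles -/

section Symmetry

variable {A : Type*} [Ring A] [Algebra ℂ A] (P : SecondOrderSpace A) {n m : ℕ}

theorem sum_annulus_conj (e : Fin n ≃ Fin m) {γ : Perm (Fin n)} {γ' : Perm (Fin m)}
    {C : Finset (Fin n)} {D : Finset (Fin m)} (hγ : ∀ x, e (γ x) = γ' (e x))
    (hC : ∀ x, e x ∈ D ↔ x ∈ C) (w : Fin m → A) :
    ∑ π ∈ annulus γ C, ∏ x ∈ cycleMins π, cycleCumulant P π (fun k => w (e k)) x =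
      ∑ π ∈ annulus γ' D, ∏ x ∈ cycleMins π, cycleCumulant P π w x := by
  refine Finset.sum_equiv e.permCongr
    (fun π => (mem_annulus_conj e hγ (apply_permCongr e π) hC).symm) fun π _ => ?_
  have he := apply_permCongr e π
  rw [← ((isTransversal_cycleMins π).image e he).prod_eq (isTransversal_cycleMins _)
    (fun _ _ => cycleCumulant_congr P), Finset.prod_map]
  exact Finset.prod_congr rfl fun x _ => (cycleCumulant_map P e.injective he w x).symm

/-- The images of least points are another transversal, so independence of the starting points is
needed. `hinv` asks for it only below `γ'`, where the cycles are shorter, so that the lemma can be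
used inside the induction proving this independence. -/
theorem sum_geodesic_conj (e : Fin n ≃ Fin m) {γ : Perm (Fin n)} {γ' : Perm (Fin m)}
    {C : Finset (Fin n)} {D : Finset (Fin m)} (hγ : ∀ x, e (γ x) = γ' (e x))
    (hC : ∀ x, e x ∈ D ↔ x ∈ C) (w : Fin m → A)
    (hD : ∀ x, γ' x ∈ D ↔ x ∈ D)
    (hinv : ∀ π ∈ (geodesic γ').erase γ', ∀ x x' y y', x ∈ D → y ∉ D → π.SameCycle x x' →
      π.SameCycle y y' → cycleCumulant₂ P π w x y = cycleCumulant₂ P π w x' y') :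
    ∑ π ∈ (geodesic γ).erase γ, markedSum (cycleMins π) C (cycleCumulant P π (fun k => w (e k)))
        (cycleCumulant₂ P π (fun k => w (e k))) =
      ∑ π ∈ (geodesic γ').erase γ', markedSum (cycleMins π) D (cycleCumulant P π w)
        (cycleCumulant₂ P π w) := by
  have hmem : ∀ π, e.permCongr π ∈ (geodesic γ').erase γ' ↔ π ∈ (geodesic γ).erase γ := by
    intro π
    have hγ' : γ' = e.permCongr γ := Perm.ext fun x => by
      obtain ⟨x, rfl⟩ := e.surjective x
      rw [← hγ, apply_permCongr]
    rw [Finset.mem_erase, Finset.mem_erase, mem_geodesic_conj e hγ (apply_permCongr e π), hγ',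
      e.permCongr.injective.ne_iff]
  refine Finset.sum_equiv e.permCongr (fun π => (hmem π).symm) fun π hπ => ?_
  have he := apply_permCongr e π
  have hπ' := (hmem π).2 hπ
  have hsC : ∀ x y, (e.permCongr π).SameCycle x y → (x ∈ D ↔ y ∈ D) := fun x y h =>
    mem_of_sameCycle (S := {x | x ∈ D}) (fun x => (hD x).symm)
      (sameCycle_of_mem_geodesic (Finset.mem_of_mem_erase hπ') h)
  rw [← ((isTransversal_cycleMins π).image e he).markedSum_eq (isTransversal_cycleMins _)
    hsC (fun _ _ => cycleCumulant_congr P) (hinv _ hπ')]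
  refine markedSum_bij e ⟨?_, e.injective.injOn, ?_⟩ (fun x _ => hC x)
    (fun x _ => (cycleCumulant_map P e.injective he w x).symm)
    (fun x _ y _ _ _ => (cycleCumulant₂_map P e.injective he w x y).symm)
  · intro x hx; simpa using hx
  · intro y hy
    obtain ⟨x, hx, rfl⟩ := Finset.mem_map.1 hy
    exact ⟨x, hx, rfl⟩

/-- The bound `N` lets the same argument serve inside the induction for rotation invariance and,
once that is known, without any restriction on lengths. -/
theorem cycleCumulant₂_congr_of_lt {N : ℕ}
    (ih : ∀ m n : ℕ, m + n < N → ∀ (a : Fin m → A) (b : Fin n → A),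
      cumulant₂ P m n (fun k => a (finRotate m k)) b = cumulant₂ P m n a b ∧
      cumulant₂ P m n a (fun k => b (finRotate n k)) = cumulant₂ P m n a b)
    {π : Perm (Fin n)} {w : Fin n → A} {x x' y y' : Fin n}
    (hN : cycleLength π x + cycleLength π y < N) (hx : π.SameCycle x x') (hy : π.SameCycle y y') :
    cycleCumulant₂ P π w x y = cycleCumulant₂ P π w x' y' := by
  have h1 : cycleCumulant₂ P π w x y = cycleCumulant₂ P π w x' y := by
    refine (rel_of_sameCycle (r := fun x x' => cycleLength π x = cycleLength π x' ∧
      (cycleLength π x + cycleLength π y < N →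
        cycleCumulant₂ P π w x y = cycleCumulant₂ P π w x' y))
      ⟨fun _ => ⟨rfl, fun _ => rfl⟩, fun h => ⟨h.1.symm, fun t => (h.2 (h.1 ▸ t)).symm⟩,
        fun h k => ⟨h.1.trans k.1, fun t => (h.2 t).trans (k.2 (h.1 ▸ t))⟩⟩
      (fun z => ⟨cycleLength_congr (sameCycle_apply_self _ _), fun t => ?_⟩) hx).2 hN
    refine Eq.trans ?_ (cycleCumulant₂_map' P (f := π) (ρ := π) (f' := id) (ρ' := π) π.injective
      (fun _ => rfl) Function.injective_id (fun _ => rfl) w z y).symm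
    refine (ih _ _ t (fun k => w (cycleMap π z k)) _).1.symm.trans ?_
    simp only [cycleMap_finRotate]
    rfl
  have h2 : cycleCumulant₂ P π w x' y = cycleCumulant₂ P π w x' y' := by
    refine (rel_of_sameCycle (r := fun y y' => cycleLength π y = cycleLength π y' ∧
      (cycleLength π x' + cycleLength π y < N →
        cycleCumulant₂ P π w x' y = cycleCumulant₂ P π w x' y'))
      ⟨fun _ => ⟨rfl, fun _ => rfl⟩, fun h => ⟨h.1.symm, fun t => (h.2 (h.1 ▸ t)).symm⟩,
        fun h k => ⟨h.1.trans k.1, fun t => (h.2 t).trans (k.2 (h.1 ▸ t))⟩⟩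
      (fun z => ⟨cycleLength_congr (sameCycle_apply_self _ _), fun t => ?_⟩) hy).2
        (cycleLength_congr hx ▸ hN)
    refine Eq.trans ?_ (cycleCumulant₂_map' P (f := id) (ρ := π) (f' := π) (ρ' := π)
      Function.injective_id (fun _ => rfl) π.injective (fun _ => rfl) w x' z).symm
    refine (ih _ _ t _ (fun k => w (cycleMap π z k))).2.symm.trans ?_
    simp only [cycleMap_finRotate]
    rfl
  exact h1.trans h2

theorem φ_ofFn_comp_finRotate_left (a : Fin n → A) (c : A) :
    P.φ₂ (List.ofFn fun k => a (finRotate n k)).prod c = P.φ₂ (List.ofFn a).prod c := by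
  cases n with
  | zero => simp
  | succ n => rw [ofFn_comp_finRotate_prod, P.φ₂_tracial_left, List.ofFn_succ, List.prod_cons]

/-- Second order cumulants are invariant under rotations of each of the circles. -/
theorem cumulant₂_comp_finRotate (m n : ℕ) (a : Fin m → A) (b : Fin n → A) :
    cumulant₂ P m n (fun k => a (finRotate m k)) b = cumulant₂ P m n a b ∧
      cumulant₂ P m n a (fun k => b (finRotate n k)) = cumulant₂ P m n a b := by
  induction hN : m + n using Nat.strong_induction_on generalizing m n with
  | _ N ih =>
  subst hN
  -- Relabelling by any pair that commutes with the rotations and preserves the moment preserves the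
  -- cumulant. The two claims are the cases of a rotation on one circle and the identity on the
  -- other.
  have key : ∀ (σ : Perm (Fin m)) (τ : Perm (Fin n)),
      (∀ x, σ (finRotate m x) = finRotate m (σ x)) →
      (∀ x, τ (finRotate n x) = finRotate n (τ x)) →
      P.φ₂ (List.ofFn fun k => a (σ k)).prod (List.ofFn fun k => b (τ k)).prod =
        P.φ₂ (List.ofFn a).prod (List.ofFn b).prod →
      cumulant₂ P m n (fun k => a (σ k)) (fun k => b (τ k)) = cumulant₂ P m n a b := by
    intro σ τ hσ hτ hφ
    have hw : Fin.append (fun k => a (σ k)) (fun k => b (τ k)) =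
        fun k => Fin.append a b (prodPerm σ τ k) := by
      funext k
      refine Fin.addCases (fun i => ?_) (fun j => ?_) k
      · simp
      · simp
    have hγ : ∀ x, prodPerm σ τ (annularRotation m n x) =
        annularRotation m n (prodPerm σ τ x) := by
      intro x
      rw [annularRotation_eq_prodPerm, ← Perm.mul_apply, ← Perm.mul_apply, prodPerm_mul,
        prodPerm_mul, show σ * finRotate m = finRotate m * σ from Perm.ext hσ,
        show τ * finRotate n = finRotate n * τ from Perm.ext hτ]
    rw [cumulant₂_eq_sub, cumulant₂_eq_sub P m n a b, hφ, hw, annularNC_eq_annulus,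
      sum_annulus_conj P (prodPerm σ τ) hγ (prodPerm_mem_circle_iff σ τ),
      sum_geodesic_conj P (prodPerm σ τ) hγ (prodPerm_mem_circle_iff σ τ) _
        annularRotation_mem_circle_iff]
    intro π hπ x x' y y' hx hy hxx hyy
    exact cycleCumulant₂_congr_of_lt P (fun m' n' h a' b' => ih _ h m' n' a' b' rfl)
      (cycleLength_add_lt_of_mem hπ hx hy) hxx hyy
  constructor
  · exact key (finRotate m) 1 (fun _ => rfl) (fun _ => rfl) (φ_ofFn_comp_finRotate_left P a _)
  · refine key 1 (finRotate n) (fun _ => rfl) (fun _ => rfl) ?_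
    rw [P.φ₂_symm, φ_ofFn_comp_finRotate_left, P.φ₂_symm]
    rfl

theorem cycleCumulant₂_congr {π : Perm (Fin n)} {w : Fin n → A} {x x' y y' : Fin n}
    (hx : π.SameCycle x x') (hy : π.SameCycle y y') :
    cycleCumulant₂ P π w x y = cycleCumulant₂ P π w x' y' :=
  cycleCumulant₂_congr_of_lt P (fun m n _ a b => cumulant₂_comp_finRotate P m n a b)
    (Nat.lt_succ_self _) hx hy

/-- `finAddFlip` matches the two annular sums and replaces the first circle by its complement. The
moment is symmetric, and the shorter second order factors are symmetric by induction. -/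
theorem cumulant₂_symm (m n : ℕ) (a : Fin m → A) (b : Fin n → A) :
    cumulant₂ P m n a b = cumulant₂ P n m b a := by
  induction hN : m + n using Nat.strong_induction_on generalizing m n with
  | _ N ih =>
  subst hN
  have hw : Fin.append a b = fun k => Fin.append b a (finAddFlip k) := by
    funext k
    refine Fin.addCases (fun i => ?_) (fun j => ?_) k
    · simp
    · simp
  have hγ : ∀ x, finAddFlip (annularRotation m n x) = annularRotation n m (finAddFlip x) := by
    intro x
    simp only [annularRotation_eq_prodPerm]
    refine Fin.addCases (fun i => ?_) (fun j => ?_) x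
    · simp
    · simp
  have hC : ∀ x, finAddFlip x ∈ circle n m ↔ x ∈ (circle m n)ᶜ := by
    intro x
    refine Fin.addCases (fun i => ?_) (fun j => ?_) x
    · simp [natAdd_notMem_circle, castAdd_mem_circle]
    · simp [natAdd_notMem_circle, castAdd_mem_circle]
  have h3 := sum_geodesic_conj P finAddFlip hγ hC (Fin.append b a)
    annularRotation_mem_circle_iff (fun _ _ _ _ _ _ _ _ => cycleCumulant₂_congr P)
  rw [cumulant₂_eq_sub, cumulant₂_eq_sub P n m b a, P.φ₂_symm, annularNC_eq_annulus,
    annularNC_eq_annulus, ← sum_annulus_conj P finAddFlip hγ hC, annulus_compl, ← hw, ← h3, ← hw]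
  congr 1
  refine Finset.sum_congr rfl fun π hπ => ?_
  rw [markedSum_compl]
  refine markedSum_congr (fun _ _ => rfl) fun x _ y _ hx hy => ?_
  exact ih _ (cycleLength_add_lt_of_mem hπ hx hy) _ _ _ _ rfl

theorem moment₂_eq_sum {m n : ℕ} (hm : 0 < m) (hn : 0 < n) (a : Fin m → A) (b : Fin n → A) :
    P.φ₂ (List.ofFn a).prod (List.ofFn b).prod =
      ∑ π ∈ annulus (annularRotation m n) (circle m n),
        ∏ x ∈ cycleMins π, cycleCumulant P π (Fin.append a b) x +
      ∑ π ∈ geodesic (annularRotation m n),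
        markedSum (cycleMins π) (circle m n) (cycleCumulant P π (Fin.append a b))
          (cycleCumulant₂ P π (Fin.append a b)) := by
  rw [← Finset.add_sum_erase _ _ (self_mem_geodesic (annularRotation m n)),
    annularRotation_eq_prodPerm, markedSum_cycleMins_prodPerm, cycleMins_finRotate hm,
    cycleMins_finRotate hn, Finset.sum_singleton, Finset.sum_singleton,
    ← annularRotation_eq_prodPerm, cycleCumulant₂_annularRotation]
  simp only [Finset.erase_singleton, Finset.prod_empty, mul_one, Fin.append_left, Fin.append_right]
  rw [cumulant₂_eq_sub, annularNC_eq_annulus]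
  ring

end Symmetry

/-! ### Grouping permutations by the permutation in which `i` and `γ i` are joined -/

section Fiber

variable {n : ℕ} {γ σ : Perm (Fin n)} {i j : Fin n}

/-- A permutation `π` determines `j` as the preimage of `c`, and `σ = π * swap i j` then sends `i`
to `c`. -/
theorem sum_perm_eq {M : Type*} [AddCommMonoid M] (i c : Fin n) (F : Perm (Fin n) → M) :
    ∑ π, F π = ∑ σ with σ i = c, ∑ j, F (σ * swap i j) := by
  rw [← Finset.sum_product']
  refine (Finset.sum_bij' (fun p _ => p.1 * swap i p.2)
    (fun π _ => (π * swap i (π⁻¹ c), π⁻¹ c)) ?_ ?_ ?_ ?_ ?_).symm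
  · intro p _; exact Finset.mem_univ _
  · intro π _
    simp
  · rintro ⟨σ, j⟩ h
    simp only [Finset.mem_product, Finset.mem_filter, Finset.mem_univ, true_and, and_true] at h
    have : (σ * swap i j)⁻¹ c = j := by
      rw [Perm.inv_eq_iff_eq]; simp [h]
    simp only [this, mul_assoc, swap_mul_self, mul_one]
  · intro π _
    simp only [mul_assoc, swap_mul_self, mul_one]
  · intro p _; rfl

theorem mul_swap_inv_mul (σ γ : Perm (Fin n)) (i j : Fin n) :
    (σ * swap i j)⁻¹ * γ = swap i j * (σ⁻¹ * γ) := by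
  simp [mul_assoc]

/-- `σ i = γ i` makes `i` a fixed point of the complement `σ⁻¹ * γ`, so the complement always gets
longer by one. The length of `σ` itself changes by `-1` for a split and by `+1` for a join. -/
theorem permLength_mul_swap_inv_mul (h : σ i = γ i) (hij : i ≠ j) :
    permLength ((σ * swap i j)⁻¹ * γ) = permLength (σ⁻¹ * γ) + 1 := by
  rw [mul_swap_inv_mul]
  refine permLength_swap_mul_of_fixed ?_ hij
  rw [Perm.mul_apply, ← h]; simp

theorem mul_swap_self (σ : Perm (Fin n)) (i : Fin n) : σ * swap i i = σ := by
  rw [swap_self]; rfl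

theorem mul_swap_mem_geodesic (h : σ i = γ i) (hs : σ.SameCycle i j) :
    σ * swap i j ∈ geodesic γ ↔ σ ∈ geodesic γ := by
  by_cases hij : i = j
  · subst hij; rw [mul_swap_self]
  have h1 := permLength_mul_swap_inv_mul h hij
  have h2 := permLength_split hs hij
  rw [mem_geodesic, mem_geodesic]
  omega

/-- Joining raises the sum of lengths by two, to at least two above the triangle bound for `γ`. -/
theorem mul_swap_notMem_geodesic (h : σ i = γ i) (hs : ¬ σ.SameCycle i j) :
    σ * swap i j ∉ geodesic γ := by
  have h1 := permLength_mul_swap_inv_mul (j := j) h (fun e => hs (e ▸ .rfl))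
  have h2 := permLength_join hs
  have := (permLength_le_add γ σ).1
  rw [mem_geodesic]
  omega

variable {C : Finset (Fin n)}

/-- Splitting leaves the sum of lengths fixed. A crossing cycle survives because both pieces meet
`C`: one contains `i`, and the other contains the image `γ i` of `j`. -/
theorem mul_swap_mem_annulus (hC : ∀ x, γ x ∈ C ↔ x ∈ C) (hi : i ∈ C) (h : σ i = γ i)
    (hs : σ.SameCycle i j) : σ * swap i j ∈ annulus γ C ↔ σ ∈ annulus γ C := by
  by_cases hij : i = j
  · subst hij; rw [mul_swap_self]
  have h1 := permLength_mul_swap_inv_mul h hij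
  have h2 := permLength_split hs hij
  have hiff := fun x y => sameCycle_iff_of_sameCycle_mul_swap hs hij (x := x) (y := y)
  rw [mem_annulus, mem_annulus]
  refine and_congr ⟨?_, ?_⟩ (by omega)
  · rintro ⟨x, y, hx, hy, hxy⟩
    exact ⟨x, y, hx, hy, (hiff x y).2 (Or.inl hxy)⟩
  · rintro ⟨x, y, hx, hy, hxy⟩
    rcases (hiff x y).1 hxy with h' | ⟨-, h' | h'⟩
    · exact ⟨x, y, hx, hy, h'⟩
    · exact ⟨i, y, hi, hy, h'⟩
    · refine ⟨γ i, y, (hC i).2 hi, hy, Perm.SameCycle.trans (Perm.SameCycle.symm ?_) h'⟩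
      rw [← h, ← mul_swap_apply_right σ i j]
      exact sameCycle_apply_self _ _

/-- The increase by two is exactly the annular excess, so `σ` must be geodesic. Its cycles then do
not cross, and the joined cycle crosses only if `j` is outside `C`. -/
theorem mul_swap_mem_annulus_of_not (hC : ∀ x, γ x ∈ C ↔ x ∈ C) (hi : i ∈ C) (h : σ i = γ i)
    (hs : ¬ σ.SameCycle i j) : σ * swap i j ∈ annulus γ C ↔ σ ∈ geodesic γ ∧ j ∉ C := by
  have h1 := permLength_mul_swap_inv_mul (j := j) h (fun e => hs (e ▸ .rfl))
  have h2 := permLength_join hs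
  rw [mem_annulus, mem_geodesic, h1, h2]
  constructor
  · rintro ⟨⟨x, y, hx, hy, hxy⟩, hl⟩
    have hg : σ ∈ geodesic γ := by rw [mem_geodesic]; omega
    have hsC : ∀ {x y}, σ.SameCycle x y → (x ∈ C ↔ y ∈ C) := fun h =>
      mem_of_sameCycle (S := {x | x ∈ C}) (fun x => (hC x).symm) (sameCycle_of_mem_geodesic hg h)
    refine ⟨by omega, fun hj => ?_⟩
    rcases (sameCycle_mul_swap_iff hs).1 hxy with h' | ⟨-, h' | h'⟩
    · exact hy ((hsC h').1 hx)
    · exact hy ((hsC h').1 hi)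
    · exact hy ((hsC h').1 hj)
  · rintro ⟨hl, hj⟩
    exact ⟨⟨i, j, hi, hj, sameCycle_mul_swap_of_not hs⟩, by omega⟩

end Fiber

/-! ### Merged cumulants and the moment-cumulant formulas grouped by `σ` -/

section Merged

variable {A : Type*} [Ring A] [Algebra ℂ A] (P : SecondOrderSpace A) {n : ℕ}

theorem cycleCumulant_eq_of_agree {π ρ : Perm (Fin n)} {x : Fin n}
    (h : ∀ y, π.SameCycle x y → ρ y = π y) (w : Fin n → A) :
    cycleCumulant P ρ w x = cycleCumulant P π w x := by
  have h1 := cycleMap_finRotate π x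
  have h2 : ∀ k, cycleMap π x (finRotate _ k) = ρ (cycleMap π x k) := fun k => by
    rw [h1, h _ (sameCycle_cycleMap π x k)]
  rw [← cycleMap_zero π x, cycleCumulant_map P (cycleMap_injective π x) h1,
    cycleCumulant_map P (cycleMap_injective π x) h2]

theorem cycleCumulant₂_eq_of_agree {π ρ : Perm (Fin n)} {x y : Fin n}
    (hx : ∀ z, π.SameCycle x z → ρ z = π z) (hy : ∀ z, π.SameCycle y z → ρ z = π z)
    (w : Fin n → A) : cycleCumulant₂ P ρ w x y = cycleCumulant₂ P π w x y := by
  have h1 := fun x => cycleMap_finRotate π x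
  have h2 : ∀ {x}, (∀ z, π.SameCycle x z → ρ z = π z) →
      ∀ k, cycleMap π x (finRotate _ k) = ρ (cycleMap π x k) := fun h k => by
    rw [h1, h _ (sameCycle_cycleMap π _ k)]
  have e1 := cycleCumulant₂_map' P (cycleMap_injective π x) (h1 x) (cycleMap_injective π y) (h1 y)
    w ⟨0, cycleLength_pos π x⟩ ⟨0, cycleLength_pos π y⟩
  have e2 := cycleCumulant₂_map' P (cycleMap_injective π x) (h2 hx) (cycleMap_injective π y)
    (h2 hy) w ⟨0, cycleLength_pos π x⟩ ⟨0, cycleLength_pos π y⟩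
  rw [cycleMap_zero, cycleMap_zero] at e1 e2
  exact e2.trans e1.symm

theorem mul_swap_agree {σ : Perm (Fin n)} {i j x : Fin n} (hi : ¬ σ.SameCycle i x)
    (hj : ¬ σ.SameCycle j x) (y : Fin n) (h : σ.SameCycle x y) : (σ * swap i j) y = σ y :=
  mul_swap_apply_of_ne σ (fun e => hi (e ▸ h.symm)) (fun e => hj (e ▸ h.symm))

/-- The contribution of `σ * swap i j` to `mergedCumulant`. -/
noncomputable def splitTerm (σ : Perm (Fin n)) (w : Fin n → A) (i j : Fin n) : ℂ :=
  if i = j then cycleCumulant P σ w i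
  else cycleCumulant P (σ * swap i j) w i * cycleCumulant P (σ * swap i j) w j

/-- The contribution of `σ * swap i j` to `mergedCumulant₂`. -/
noncomputable def splitTerm₂ (σ : Perm (Fin n)) (w : Fin n → A) (i y j : Fin n) : ℂ :=
  if i = j then cycleCumulant₂ P σ w i y
  else cycleCumulant₂ P (σ * swap i j) w i y * cycleCumulant P (σ * swap i j) w j +
    cycleCumulant P (σ * swap i j) w i * cycleCumulant₂ P (σ * swap i j) w j y

/-- The cumulant of the word along the cycle of `σ` through `i` in which the entries at `i` and
`σ i` are multiplied with each other. -/
noncomputable def mergedCumulant (σ : Perm (Fin n)) (w : Fin n → A) (i : Fin n) : ℂ :=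
  ∑ j with σ.SameCycle i j, splitTerm P σ w i j

/-- The second order cumulant of the words along the cycles of `σ` through `i` and `y` in which the
entries at `i` and `σ i` are multiplied with each other. -/
noncomputable def mergedCumulant₂ (σ : Perm (Fin n)) (w : Fin n → A) (i y : Fin n) : ℂ :=
  ∑ j with σ.SameCycle i j, splitTerm₂ P σ w i y j +
    ∑ j with σ.SameCycle y j, cycleCumulant P (σ * swap i j) w i

variable {σ : Perm (Fin n)} {i j : Fin n} {w : Fin n → A}

theorem prod_cycleMins_mul_swap (h : σ.SameCycle i j) :
    ∏ x ∈ cycleMins (σ * swap i j), cycleCumulant P (σ * swap i j) w x =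
      splitTerm P σ w i j * ∏ x ∈ otherMins σ i, cycleCumulant P σ w x := by
  by_cases hij : i = j
  · subst hij
    rw [mul_swap_self, splitTerm, if_pos rfl, (isTransversal_cycleMins σ).prod_eq
      (isTransversal_insert_otherMins σ i) (fun _ _ => cycleCumulant_congr P),
      Finset.prod_insert (not_mem_otherMins_of_sameCycle .rfl)]
  · rw [(isTransversal_cycleMins _).prod_eq (isTransversal_split h hij)
      (fun _ _ => cycleCumulant_congr P), Finset.prod_insert, Finset.prod_insert, splitTerm,
      if_neg hij, mul_assoc]
    · congr 2
      refine Finset.prod_congr rfl fun x hx => ?_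
      have hx' := (mem_otherMins.1 hx).2
      exact cycleCumulant_eq_of_agree P
        (mul_swap_agree hx' fun h' => hx' (h.trans h')) w
    · exact not_mem_otherMins_of_sameCycle h
    · simp only [Finset.mem_insert, not_or]
      exact ⟨hij, not_mem_otherMins_of_sameCycle .rfl⟩

theorem prod_cycleMins_mul_swap_of_not {y : Fin n} (h : ¬ σ.SameCycle i j)
    (hy : y ∈ otherMins σ i) (hj : σ.SameCycle y j) :
    ∏ x ∈ cycleMins (σ * swap i j), cycleCumulant P (σ * swap i j) w x =
      cycleCumulant P (σ * swap i j) w i *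
        ∏ x ∈ (otherMins σ i).erase y, cycleCumulant P σ w x := by
  rw [(isTransversal_cycleMins _).prod_eq (isTransversal_join h hy hj)
      (fun _ _ => cycleCumulant_congr P), Finset.prod_insert]
  · congr 1
    refine Finset.prod_congr rfl fun x hx => ?_
    rw [Finset.mem_erase] at hx
    refine cycleCumulant_eq_of_agree P (mul_swap_agree (mem_otherMins.1 hx.2).2 fun h' => hx.1 ?_) w
    exact (isTransversal_cycleMins σ).eq_of_sameCycle _ (mem_otherMins.1 hx.2).1 _
      (mem_otherMins.1 hy).1 (h'.symm.trans hj.symm)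
  · exact fun hi => not_mem_otherMins_of_sameCycle .rfl (Finset.mem_of_mem_erase hi)

theorem markedSum_insert {R C : Finset (Fin n)} {f : Fin n → ℂ} {g : Fin n → Fin n → ℂ}
    (hR : i ∉ R) (hC : i ∈ C) : markedSum (insert i R) C f g =
      ∑ y ∈ R with y ∉ C, g i y * ∏ z ∈ R.erase y, f z + f i * markedSum R C f g := by
  rw [markedSum, markedSum, Finset.filter_insert, if_pos hC, Finset.sum_insert (by simp [hR]),
    Finset.filter_insert, if_neg (not_not.2 hC), Finset.erase_insert hR, Finset.mul_sum]
  congr 1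
  refine Finset.sum_congr rfl fun x hx => ?_
  rw [Finset.mul_sum]
  refine Finset.sum_congr rfl fun y hy => ?_
  rw [Finset.mem_filter] at hx hy
  have hix : i ≠ x := fun e => hR (e ▸ hx.1)
  have hiy : i ≠ y := fun e => hR (e ▸ hy.1)
  rw [Finset.erase_insert_of_ne hix, Finset.erase_insert_of_ne hiy, Finset.prod_insert]
  · ring
  · simp [hR]

theorem markedSum_insert_insert {R C : Finset (Fin n)} {f : Fin n → ℂ} {g : Fin n → Fin n → ℂ}
    (hij : i ≠ j) (hi : i ∉ R) (hj : j ∉ R) (hiC : i ∈ C) (hjC : j ∈ C) :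
    markedSum (insert i (insert j R)) C f g =
      ∑ y ∈ R with y ∉ C, (g i y * f j + f i * g j y) * ∏ z ∈ R.erase y, f z +
        f i * f j * markedSum R C f g := by
  rw [markedSum_insert (by simp [hij, hi]) hiC, markedSum_insert hj hjC, Finset.filter_insert,
    if_neg (not_not.2 hjC), mul_add, ← add_assoc, Finset.mul_sum, ← Finset.sum_add_distrib,
    mul_assoc]
  congr 1
  refine Finset.sum_congr rfl fun y hy => ?_
  rw [Finset.mem_filter] at hy
  have hjy : j ≠ y := fun e => hj (e ▸ hy.1)
  rw [Finset.erase_insert_of_ne hjy, Finset.prod_insert (by simp [hj])]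
  ring

/-- Either the marked cycle in `C` is away from the cycle of `σ` through `i`, which contributes the
first order factor `splitTerm`, or it is one of the pieces of that cycle, which gives `splitTerm₂`.
-/
theorem markedSum_cycleMins_mul_swap {C : Finset (Fin n)} (hC : ∀ x, σ x ∈ C ↔ x ∈ C) (hi : i ∈ C)
    (h : σ.SameCycle i j) :
    markedSum (cycleMins (σ * swap i j)) C (cycleCumulant P (σ * swap i j) w)
        (cycleCumulant₂ P (σ * swap i j) w) =
      splitTerm P σ w i j * markedSum (otherMins σ i) C (cycleCumulant P σ w)
          (cycleCumulant₂ P σ w) +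
        ∑ y ∈ otherMins σ i with y ∉ C, splitTerm₂ P σ w i y j *
          ∏ z ∈ (otherMins σ i).erase y, cycleCumulant P σ w z := by
  have hsC : ∀ {x y}, σ.SameCycle x y → (x ∈ C ↔ y ∈ C) := fun h =>
      mem_of_sameCycle (S := {x | x ∈ C}) (fun x => (hC x).symm) h
  by_cases hij : i = j
  · subst hij
    rw [mul_swap_self, (isTransversal_cycleMins σ).markedSum_eq
      (isTransversal_insert_otherMins σ i) (fun _ _ => hsC) (fun _ _ => cycleCumulant_congr P)
      (fun _ _ _ _ _ _ => cycleCumulant₂_congr P),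
      markedSum_insert (not_mem_otherMins_of_sameCycle .rfl) hi, add_comm]
    simp only [splitTerm, splitTerm₂, if_true]
  · have hsub := fun x y => (sameCycle_iff_of_sameCycle_mul_swap h hij (x := x) (y := y)).2
    have hag : ∀ x ∈ otherMins σ i, ∀ z, σ.SameCycle x z → (σ * swap i j) z = σ z := fun x hx =>
      mul_swap_agree (mem_otherMins.1 hx).2 fun h' => (mem_otherMins.1 hx).2 (h.trans h')
    rw [(isTransversal_cycleMins _).markedSum_eq
      (isTransversal_split h hij) (fun _ _ h' => hsC (hsub _ _ (Or.inl h')))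
      (fun _ _ => cycleCumulant_congr P) (fun _ _ _ _ _ _ => cycleCumulant₂_congr P),
      markedSum_insert_insert hij (not_mem_otherMins_of_sameCycle .rfl)
        (not_mem_otherMins_of_sameCycle h) hi ((hsC h).1 hi), add_comm]
    simp only [splitTerm, splitTerm₂, if_neg hij]
    congr 1
    · rw [markedSum_congr (fun x hx => cycleCumulant_eq_of_agree P (hag x hx) w)
        (fun x hx y hy _ _ => cycleCumulant₂_eq_of_agree P (hag x hx) (hag y hy) w)]
    · refine Finset.sum_congr rfl fun y _ => ?_
      congr 1
      exact Finset.prod_congr rfl fun z hz =>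
        cycleCumulant_eq_of_agree P (hag z (Finset.mem_of_mem_erase hz)) w

/-- Only splits contribute, since joins leave the geodesic. Summing over `j` in the cycle of `i`
assembles `mergedCumulant`. -/
theorem sum_geodesic_eq (γ : Perm (Fin n)) (i : Fin n) (w : Fin n → A) :
    ∑ π ∈ geodesic γ, ∏ x ∈ cycleMins π, cycleCumulant P π w x =
      ∑ σ ∈ geodesic γ with σ i = γ i,
        mergedCumulant P σ w i * ∏ x ∈ otherMins σ i, cycleCumulant P σ w x := by
  have h1 : ∑ π ∈ geodesic γ, ∏ x ∈ cycleMins π, cycleCumulant P π w x =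
      ∑ π, if π ∈ geodesic γ then ∏ x ∈ cycleMins π, cycleCumulant P π w x else 0 := by
    rw [← Finset.sum_filter]; simp
  rw [h1, sum_perm_eq i (γ i)]
  rw [show (geodesic γ).filter (fun σ => σ i = γ i) =
    (Finset.univ.filter (fun σ : Perm (Fin n) => σ i = γ i)).filter (· ∈ geodesic γ) by
      ext σ; simp [and_comm], Finset.sum_filter (· ∈ geodesic γ)]
  refine Finset.sum_congr rfl fun σ hσ => ?_
  replace hσ : σ i = γ i := (Finset.mem_filter.1 hσ).2
  rw [← Finset.sum_filter_add_sum_filter_not Finset.univ (fun j => σ.SameCycle i j)]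
  rw [Finset.sum_eq_zero (s := Finset.univ.filter (fun j => ¬ σ.SameCycle i j)), add_zero]
  · split_ifs with hg
    · rw [mergedCumulant, Finset.sum_mul]
      refine Finset.sum_congr rfl fun j hj => ?_
      replace hj := (Finset.mem_filter.1 hj).2
      rw [if_pos ((mul_swap_mem_geodesic hσ hj).2 hg), prod_cycleMins_mul_swap P hj]
    · refine Finset.sum_eq_zero fun j hj => ?_
      replace hj := (Finset.mem_filter.1 hj).2
      rw [if_neg (fun h => hg ((mul_swap_mem_geodesic hσ hj).1 h))]
  · intro j hj
    exact if_neg (mul_swap_notMem_geodesic hσ (Finset.mem_filter.1 hj).2)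

/-- The annular and the marked sum have to be grouped together: joining two cycles of a geodesic `σ`
on different circles gives an annular permutation, and its term is the second sum in
`mergedCumulant₂`. -/
theorem sum_annulus_add_sum_geodesic {γ : Perm (Fin n)} {C : Finset (Fin n)}
    (hC : ∀ x, γ x ∈ C ↔ x ∈ C) (hi : i ∈ C) (w : Fin n → A) :
    ∑ π ∈ annulus γ C, ∏ x ∈ cycleMins π, cycleCumulant P π w x +
      ∑ π ∈ geodesic γ, markedSum (cycleMins π) C (cycleCumulant P π w) (cycleCumulant₂ P π w) =
    ∑ σ ∈ annulus γ C with σ i = γ i,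
        mergedCumulant P σ w i * ∏ x ∈ otherMins σ i, cycleCumulant P σ w x +
      ∑ σ ∈ geodesic γ with σ i = γ i,
        (mergedCumulant P σ w i * markedSum (otherMins σ i) C (cycleCumulant P σ w)
            (cycleCumulant₂ P σ w) +
          ∑ y ∈ otherMins σ i with y ∉ C, mergedCumulant₂ P σ w i y *
            ∏ z ∈ (otherMins σ i).erase y, cycleCumulant P σ w z) := by
  have hu : ∀ (S : Finset (Perm (Fin n))) (F : Perm (Fin n) → ℂ),
      ∑ π ∈ S, F π = ∑ π, if π ∈ S then F π else 0 := by
    intro S F; rw [← Finset.sum_filter]; simp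
  have hf : ∀ (S : Finset (Perm (Fin n))) (F : Perm (Fin n) → ℂ),
      ∑ σ ∈ S with σ i = γ i, F σ = ∑ σ with σ i = γ i, if σ ∈ S then F σ else 0 := by
    intro S F
    rw [← Finset.sum_filter]
    refine Finset.sum_congr ?_ fun _ _ => rfl
    ext σ; simp [and_comm]
  rw [hu (annulus γ C), hu (geodesic γ), ← Finset.sum_add_distrib, sum_perm_eq i (γ i),
    hf (annulus γ C), hf (geodesic γ),
    ← Finset.sum_add_distrib]
  refine Finset.sum_congr rfl fun σ hσ => ?_
  replace hσ : σ i = γ i := (Finset.mem_filter.1 hσ).2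
  rw [← Finset.sum_filter_add_sum_filter_not Finset.univ (fun j => σ.SameCycle i j)]
  -- Splits: each of the two families stays within itself.
  have hA : ∑ j with σ.SameCycle i j, ((if σ * swap i j ∈ annulus γ C then
        ∏ x ∈ cycleMins (σ * swap i j), cycleCumulant P (σ * swap i j) w x else 0) +
      if σ * swap i j ∈ geodesic γ then markedSum (cycleMins (σ * swap i j)) C
        (cycleCumulant P (σ * swap i j) w) (cycleCumulant₂ P (σ * swap i j) w) else 0) =
      (if σ ∈ annulus γ C then
        mergedCumulant P σ w i * ∏ x ∈ otherMins σ i, cycleCumulant P σ w x else 0) +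
      if σ ∈ geodesic γ then mergedCumulant P σ w i * markedSum (otherMins σ i) C
        (cycleCumulant P σ w) (cycleCumulant₂ P σ w) + ∑ y ∈ otherMins σ i with y ∉ C,
          (∑ j with σ.SameCycle i j, splitTerm₂ P σ w i y j) *
            ∏ z ∈ (otherMins σ i).erase y, cycleCumulant P σ w z else 0 := by
    rw [Finset.sum_add_distrib]
    congr 1
    · split_ifs with hg
      · rw [mergedCumulant, Finset.sum_mul]
        refine Finset.sum_congr rfl fun j hj => ?_
        replace hj := (Finset.mem_filter.1 hj).2
        rw [if_pos ((mul_swap_mem_annulus hC hi hσ hj).2 hg), prod_cycleMins_mul_swap P hj]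
      · refine Finset.sum_eq_zero fun j hj => ?_
        replace hj := (Finset.mem_filter.1 hj).2
        rw [if_neg (fun h => hg ((mul_swap_mem_annulus hC hi hσ hj).1 h))]
    · split_ifs with hg
      · have hσC : ∀ x, σ x ∈ C ↔ x ∈ C := fun x =>
          (mem_of_sameCycle (S := {x | x ∈ C}) (fun x => (hC x).symm)
            (sameCycle_of_mem_geodesic hg (sameCycle_apply_self σ x))).symm
        simp only [mergedCumulant, Finset.sum_mul]
        rw [Finset.sum_comm (s := (otherMins σ i).filter (· ∉ C)), ← Finset.sum_add_distrib]
        refine Finset.sum_congr rfl fun j hj => ?_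
        replace hj := (Finset.mem_filter.1 hj).2
        rw [if_pos ((mul_swap_mem_geodesic hσ hj).2 hg), markedSum_cycleMins_mul_swap P hσC hi hj]
      · refine Finset.sum_eq_zero fun j hj => ?_
        replace hj := (Finset.mem_filter.1 hj).2
        rw [if_neg (fun h => hg ((mul_swap_mem_geodesic hσ hj).1 h))]
  -- Joins: only a geodesic `σ` with `j` on the other circle contributes, and the terms are sorted
  -- by the least point `y` of the cycle of `j`.
  have hB : ∑ j with ¬ σ.SameCycle i j, ((if σ * swap i j ∈ annulus γ C then
        ∏ x ∈ cycleMins (σ * swap i j), cycleCumulant P (σ * swap i j) w x else 0) +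
      if σ * swap i j ∈ geodesic γ then markedSum (cycleMins (σ * swap i j)) C
        (cycleCumulant P (σ * swap i j) w) (cycleCumulant₂ P (σ * swap i j) w) else 0) =
      if σ ∈ geodesic γ then ∑ y ∈ otherMins σ i with y ∉ C,
          (∑ j with σ.SameCycle y j, cycleCumulant P (σ * swap i j) w i) *
            ∏ z ∈ (otherMins σ i).erase y, cycleCumulant P σ w z else 0 := by
    split_ifs with hg
    · have hσC : ∀ {x y}, σ.SameCycle x y → (x ∈ C ↔ y ∈ C) := fun h =>
        mem_of_sameCycle (S := {x | x ∈ C}) (fun x => (hC x).symm) (sameCycle_of_mem_geodesic hg h)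
      simp only [Finset.sum_mul]
      rw [Finset.sum_sigma']
      symm
      refine Finset.sum_bij_ne_zero (fun p _ _ => p.2) ?_ ?_ ?_ ?_
      · rintro ⟨y, j⟩ h -
        simp only [Finset.mem_sigma, Finset.mem_filter, Finset.mem_univ, true_and] at h ⊢
        exact fun hij => (mem_otherMins.1 h.1.1).2 (hij.trans h.2.symm)
      · rintro ⟨y, j⟩ h - ⟨y', j'⟩ h' - e
        simp only [Finset.mem_sigma, Finset.mem_filter, Finset.mem_univ, true_and] at h h'
        simp only at e
        subst e
        have := (isTransversal_cycleMins σ).eq_of_sameCycle _ (mem_otherMins.1 h.1.1).1 _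
          (mem_otherMins.1 h'.1.1).1 (h.2.trans h'.2.symm)
        subst this
        rfl
      · intro j hj hne
        replace hj := (Finset.mem_filter.1 hj).2
        rw [if_neg (mul_swap_notMem_geodesic hσ hj), add_zero] at hne
        have hjC := (mul_swap_mem_annulus_of_not hC hi hσ hj).1
          (by by_contra h; exact hne (if_neg h))
        obtain ⟨y, hy, hyj⟩ := (isTransversal_cycleMins σ).exists_mem j
        have hyo : y ∈ otherMins σ i := mem_otherMins.2 ⟨hy, fun h => hj (h.trans hyj.symm)⟩
        refine ⟨⟨y, j⟩, ?_, ?_, rfl⟩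
        · simp only [Finset.mem_sigma, Finset.mem_filter, Finset.mem_univ, true_and]
          exact ⟨⟨hyo, fun h => hjC.2 ((hσC hyj).2 h)⟩, hyj.symm⟩
        · rw [if_pos ((mul_swap_mem_annulus_of_not hC hi hσ hj).2 hjC),
            prod_cycleMins_mul_swap_of_not P hj hyo hyj.symm] at hne
          exact hne
      · rintro ⟨y, j⟩ h -
        simp only [Finset.mem_sigma, Finset.mem_filter, Finset.mem_univ, true_and] at h
        have hj : ¬ σ.SameCycle i j := fun hij => (mem_otherMins.1 h.1.1).2 (hij.trans h.2.symm)
        rw [if_neg (mul_swap_notMem_geodesic hσ hj), add_zero,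
          if_pos ((mul_swap_mem_annulus_of_not hC hi hσ hj).2
            ⟨hg, fun h' => h.1.2 ((hσC h.2).2 h')⟩),
          prod_cycleMins_mul_swap_of_not P hj h.1.1 h.2]
    · refine Finset.sum_eq_zero fun j hj => ?_
      replace hj := (Finset.mem_filter.1 hj).2
      rw [if_neg (mul_swap_notMem_geodesic hσ hj),
        if_neg (fun h => hg ((mul_swap_mem_annulus_of_not hC hi hσ hj).1 h).1), add_zero]
  rw [hA, hB, add_assoc]
  congr 1
  split_ifs with hg
  · rw [add_assoc, ← Finset.sum_add_distrib]
    simp only [mergedCumulant₂, add_mul]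
  · rw [add_zero]

end Merged

/-! ### Insertion of a cycle of two neighbouring points -/

/-- `γ` arises from `γ'` by the insertion of two points `i` and `c = γ i` that are not a cycle of
their own. -/
structure IsPairInsertion {n N : ℕ} (γ' : Perm (Fin n)) (γ : Perm (Fin N)) (e : Fin n → Fin N)
    (i c : Fin N) : Prop where
  strictMono : StrictMono e
  ne_left : ∀ k, e k ≠ i
  ne_right : ∀ k, e k ≠ c
  exists_eq : ∀ x, x ≠ i → x ≠ c → ∃ k, e k = x
  ne : i ≠ c
  apply_left : γ i = c
  apply_right_ne : γ c ≠ i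
  apply_map : ∀ k, e (γ' k) = if γ (e k) = i then γ c else γ (e k)

namespace IsPairInsertion

variable {n N : ℕ} {γ' : Perm (Fin n)} {γ : Perm (Fin N)} {e : Fin n → Fin N} {i c : Fin N}

theorem cases (h : IsPairInsertion γ' γ e i c) {p : Fin N → Prop} (hi : p i) (hc : p c)
    (he : ∀ k, p (e k)) (x : Fin N) : p x := by
  by_cases h1 : x = i
  · exact h1 ▸ hi
  by_cases h2 : x = c
  · exact h2 ▸ hc
  obtain ⟨k, rfl⟩ := h.exists_eq x h1 h2
  exact he k

/-- The extension of a permutation by two fixed points. -/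
noncomputable def ext (h : IsPairInsertion γ' γ e i c) (σ : Perm (Fin n)) : Perm (Fin N) :=
  σ.viaFintypeEmbedding ⟨e, h.strictMono.injective⟩

variable (h : IsPairInsertion γ' γ e i c) (σ : Perm (Fin n))

theorem ext_map (k : Fin n) : h.ext σ (e k) = e (σ k) :=
  Perm.viaFintypeEmbedding_apply_image σ ⟨e, h.strictMono.injective⟩ k

theorem ext_left : h.ext σ i = i :=
  Perm.viaFintypeEmbedding_apply_notMem_range σ _ (by rintro ⟨k, hk⟩; exact h.ne_left k hk)

theorem ext_right : h.ext σ c = c :=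
  Perm.viaFintypeEmbedding_apply_notMem_range σ _ (by rintro ⟨k, hk⟩; exact h.ne_right k hk)

theorem card_eq (h : IsPairInsertion γ' γ e i c) : N = n + 2 := by
  have hu : (Finset.univ : Finset (Fin N)) =
      insert i (insert c (Finset.univ.map ⟨e, h.strictMono.injective⟩)) := by
    symm
    rw [Finset.eq_univ_iff_forall]
    exact h.cases (by simp) (by simp) (by simp)
  have := congrArg Finset.card hu
  rw [Finset.card_insert_of_notMem, Finset.card_insert_of_notMem] at this
  · simpa using this
  · simpa using h.ne_right
  · simpa [h.ne] using h.ne_left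

theorem permLength_ext : permLength (h.ext σ) = permLength σ := by
  have hs : ∀ k, e (σ k) = h.ext σ (e k) := fun k => (h.ext_map σ k).symm
  have hT : IsTransversal (h.ext σ)
      (insert i (insert c ((cycleMins σ).map ⟨e, h.strictMono.injective⟩))) := by
    refine ⟨h.cases ⟨i, by simp, .rfl⟩ ⟨c, by simp, .rfl⟩ fun k => ?_, ?_⟩
    · obtain ⟨r, hr, hk⟩ := (isTransversal_cycleMins σ).exists_mem k
      exact ⟨e r, by simp [hr], sameCycle_of_maps hs hk⟩
    · have hi : ∀ x, (h.ext σ).SameCycle i x → i = x := fun x hx => hx.eq_of_left (h.ext_left σ)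
      have hc : ∀ x, (h.ext σ).SameCycle c x → c = x := fun x hx => hx.eq_of_left (h.ext_right σ)
      intro r hr s hs' hrs
      simp only [Finset.mem_insert, Finset.mem_map, Function.Embedding.coeFn_mk] at hr hs'
      rcases hr with rfl | rfl | ⟨r, hr, rfl⟩
      · exact hi _ hrs
      · exact hc _ hrs
      · rcases hs' with rfl | rfl | ⟨s, hs', rfl⟩
        · exact (hi _ hrs.symm).symm
        · exact (hc _ hrs.symm).symm
        · rw [sameCycle_map_iff h.strictMono.injective hs] at hrs
          rw [(isTransversal_cycleMins σ).eq_of_sameCycle _ hr _ hs' hrs]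
  have h1 := hT.card_eq
  rw [Finset.card_insert_of_notMem, Finset.card_insert_of_notMem, Finset.card_map] at h1
  · change numCycles σ + 1 + 1 = _ at h1
    have := permLength_add_numCycles σ
    have := permLength_add_numCycles (h.ext σ)
    have := h.card_eq
    omega
  · simp only [Finset.mem_map, not_exists, not_and]
    exact fun k _ => h.ne_right k
  · simp only [Finset.mem_insert, Finset.mem_map, not_or, not_exists, not_and]
    exact ⟨h.ne, fun k _ => h.ne_left k⟩

/-- The extension of a permutation by a cycle consisting of `i` and `c`. -/
noncomputable def insertPair : Perm (Fin N) := h.ext σ * swap i c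

theorem insertPair_left : h.insertPair σ i = c := by
  rw [insertPair, mul_swap_apply_left, ext_right]

theorem insertPair_right : h.insertPair σ c = i := by
  rw [insertPair, mul_swap_apply_right, ext_left]

theorem insertPair_map (k : Fin n) : h.insertPair σ (e k) = e (σ k) := by
  rw [insertPair, mul_swap_apply_of_ne _ (h.ne_left k) (h.ne_right k), ext_map]

theorem permLength_insertPair : permLength (h.insertPair σ) = permLength σ + 1 := by
  rw [insertPair, permLength_join, permLength_ext]
  exact fun hs => h.ne (hs.eq_of_left (h.ext_left σ))

theorem permLength_eq (h : IsPairInsertion γ' γ e i c) : permLength γ = permLength γ' + 2 := by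
  obtain ⟨x, hx⟩ := γ.surjective i
  -- With `x` the predecessor of `i`, two transpositions cut `i` and then `c` out of the cycle of
  -- `γ`; what remains is `γ'` with two fixed points.
  have hxi : x ≠ i := fun e => h.ne (by rw [e, h.apply_left] at hx; exact hx.symm)
  have hxc : x ≠ c := fun e => h.apply_right_ne (e ▸ hx)
  have h1 : permLength γ = permLength (γ * swap x i) + 1 :=
    permLength_split (hx ▸ sameCycle_apply_self γ x) hxi
  have h2 : permLength (γ * swap x i) = permLength (γ * swap x i * swap x c) + 1 := by
    refine permLength_split ?_ hxc
    have : (γ * swap x i) x = c := by rw [mul_swap_apply_left, h.apply_left]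
    rw [← this]
    exact sameCycle_apply_self _ x
  have h3 : γ * swap x i * swap x c = h.ext γ' := by
    refine Perm.ext (h.cases ?_ ?_ fun k => ?_)
    · rw [mul_swap_apply_of_ne _ hxi.symm h.ne, mul_swap_apply_right, hx, h.ext_left]
    · rw [mul_swap_apply_right, mul_swap_apply_left, h.apply_left, h.ext_right]
    · rw [h.ext_map, h.apply_map]
      by_cases hk : e k = x
      · rw [hk, if_pos hx, mul_swap_apply_left, mul_swap_apply_of_ne _ hxc.symm h.ne.symm]
      · rw [mul_swap_apply_of_ne _ hk (h.ne_right k), mul_swap_apply_of_ne _ hk (h.ne_left k),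
          if_neg fun h' => hk (γ.injective (h'.trans hx.symm))]
  rw [h1, h2, h3, permLength_ext]

theorem permLength_insertPair_inv_mul :
    permLength ((h.insertPair σ)⁻¹ * γ) = permLength (σ⁻¹ * γ') + 1 := by
  obtain ⟨x, hx⟩ := γ.surjective i
  have hxi : x ≠ i := fun e => h.ne (by rw [e, h.apply_left] at hx; exact hx.symm)
  have hxc : x ≠ c := fun e => h.apply_right_ne (e ▸ hx)
  have hinv : ∀ k, (h.insertPair σ)⁻¹ (e k) = e (σ⁻¹ k) := fun k => by
    rw [Perm.inv_eq_iff_eq, h.insertPair_map]; simp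
  -- In the complement `i` is already fixed and `c` follows `x`, so a single transposition suffices.
  -- The length of `γ` grows by two, that of the permutation and of its complement by one each, and
  -- both length conditions are preserved.
  have hK : ((h.insertPair σ)⁻¹ * γ) x = c := by
    rw [Perm.mul_apply, hx, Perm.inv_eq_iff_eq, h.insertPair_right]
  have h2 : permLength ((h.insertPair σ)⁻¹ * γ) =
      permLength ((h.insertPair σ)⁻¹ * γ * swap x c) + 1 := by
    refine permLength_split ?_ hxc
    have := sameCycle_apply_self ((h.insertPair σ)⁻¹ * γ) x
    rwa [hK] at this
  have h3 : (h.insertPair σ)⁻¹ * γ * swap x c = h.ext (σ⁻¹ * γ') := by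
    refine Perm.ext (h.cases ?_ ?_ fun k => ?_)
    · rw [mul_swap_apply_of_ne _ hxi.symm h.ne, h.ext_left, Perm.mul_apply, h.apply_left,
        Perm.inv_eq_iff_eq, h.insertPair_left]
    · rw [mul_swap_apply_right, hK, h.ext_right]
    · rw [h.ext_map, Perm.mul_apply (σ⁻¹), ← hinv, h.apply_map]
      by_cases hk : e k = x
      · rw [hk, if_pos hx, mul_swap_apply_left, Perm.mul_apply]
      · rw [mul_swap_apply_of_ne _ hk (h.ne_right k), Perm.mul_apply,
          if_neg fun h' => hk (γ.injective (h'.trans hx.symm))]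
  rw [h2, h3, permLength_ext]

theorem insertPair_mem_geodesic : h.insertPair σ ∈ geodesic γ ↔ σ ∈ geodesic γ' := by
  rw [mem_geodesic, mem_geodesic, h.permLength_eq, h.permLength_insertPair,
    h.permLength_insertPair_inv_mul]
  omega

theorem sameCycle_insertPair_left {x : Fin N} (hx : (h.insertPair σ).SameCycle i x) :
    x = i ∨ x = c := by
  have := mem_of_sameCycle (S := {x | x = i ∨ x = c}) (π := h.insertPair σ) (h.cases
    (by simp [h.insertPair_left]) (by simp [h.insertPair_right])
    (fun k => by simp [h.insertPair_map, h.ne_left, h.ne_right])) hx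
  exact this.1 (Or.inl rfl)

theorem sameCycle_insertPair : (h.insertPair σ).SameCycle i c := by
  have := sameCycle_apply_self (h.insertPair σ) i
  rwa [h.insertPair_left] at this

theorem insertPair_mem_annulus {C : Finset (Fin N)} {C' : Finset (Fin n)} (hi : i ∈ C)
    (hc : c ∈ C) (hC : ∀ k, e k ∈ C ↔ k ∈ C') :
    h.insertPair σ ∈ annulus γ C ↔ σ ∈ annulus γ' C' := by
  rw [mem_annulus, mem_annulus, h.permLength_eq, h.permLength_insertPair,
    h.permLength_insertPair_inv_mul]
  have hs : ∀ k, e (σ k) = h.insertPair σ (e k) := fun k => (h.insertPair_map σ k).symm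
  refine and_congr ⟨?_, ?_⟩ (by omega)
  · rintro ⟨x, y, hx, hy, hxy⟩
    revert hx hxy
    refine h.cases (p := fun x => x ∈ C → (h.insertPair σ).SameCycle x y → _) ?_ ?_ ?_ x
    · intro _ hxy
      rcases h.sameCycle_insertPair_left σ hxy with rfl | rfl
      exacts [absurd hi hy, absurd hc hy]
    · intro _ hxy
      rcases h.sameCycle_insertPair_left σ ((h.sameCycle_insertPair σ).trans hxy) with rfl | rfl
      exacts [absurd hi hy, absurd hc hy]
    · intro k hk hxy
      obtain ⟨l, hl, rfl⟩ := exists_of_sameCycle_map hs hxy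
      exact ⟨k, l, (hC k).1 hk, fun h' => hy ((hC l).2 h'), hl⟩
  · rintro ⟨x, y, hx, hy, hxy⟩
    exact ⟨e x, e y, (hC x).2 hx, fun h' => hy ((hC y).1 h'), sameCycle_of_maps hs hxy⟩

theorem otherMins_insertPair : otherMins (h.insertPair σ) i =
    (cycleMins σ).map ⟨e, h.strictMono.injective⟩ := by
  have hs : ∀ k, e (σ k) = h.insertPair σ (e k) := fun k => (h.insertPair_map σ k).symm
  ext x
  refine h.cases (p := fun x => x ∈ _ ↔ x ∈ _) ?_ ?_ (fun k => ?_) x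
  · simp only [not_mem_otherMins_of_sameCycle Perm.SameCycle.rfl, Finset.mem_map, false_iff,
      not_exists, not_and]
    exact fun k _ => h.ne_left k
  · simp only [not_mem_otherMins_of_sameCycle (h.sameCycle_insertPair σ), Finset.mem_map, false_iff,
      not_exists, not_and]
    exact fun k _ => h.ne_right k
  · have hk : ¬ (h.insertPair σ).SameCycle i (e k) := fun h' => by
      rcases h.sameCycle_insertPair_left σ h' with h' | h'
      exacts [h.ne_left k h', h.ne_right k h']
    rw [mem_otherMins, and_iff_left hk]
    simp only [mem_cycleMins, Finset.mem_map, Function.Embedding.coeFn_mk,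
      h.strictMono.injective.eq_iff, exists_eq_right]
    constructor
    · exact fun h' y hy => h.strictMono.le_iff_le.1 (h' _ (sameCycle_of_maps hs hy))
    · intro h' y hy
      obtain ⟨z, hz, rfl⟩ := exists_of_sameCycle_map hs hy
      exact h.strictMono.le_iff_le.2 (h' z hz)

theorem insertPair_injective : Function.Injective h.insertPair := by
  intro σ τ hst
  ext1 k
  apply h.strictMono.injective
  rw [← h.insertPair_map, ← h.insertPair_map, hst]

theorem exists_insertPair_eq {τ : Perm (Fin N)} (hi : τ i = c) (hc : τ c = i) :
    ∃ σ, h.insertPair σ = τ := by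
  have hex : ∀ k, ∃ l, e l = τ (e k) := fun k => h.exists_eq _
    (fun h' => h.ne_right k (τ.injective (h'.trans hc.symm)))
    (fun h' => h.ne_left k (τ.injective (h'.trans hi.symm)))
  choose f hf using hex
  have hinj : Function.Injective f := fun k l hkl => h.strictMono.injective
    (τ.injective (by rw [← hf, ← hf, hkl]))
  refine ⟨Equiv.ofBijective f (Finite.injective_iff_bijective.1 hinj),
    Perm.ext (h.cases ?_ ?_ fun k => ?_)⟩
  · rw [h.insertPair_left, hi]
  · rw [h.insertPair_right, hc]
  · rw [h.insertPair_map, ← hf]; rfl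

theorem sum_eq_sum_insertPair (S : Finset (Perm (Fin N))) (S' : Finset (Perm (Fin n)))
    (hS : ∀ σ, h.insertPair σ ∈ S ↔ σ ∈ S') (F : Perm (Fin N) → ℂ) :
    ∑ τ ∈ S with τ i = c ∧ τ c = i, F τ = ∑ σ ∈ S', F (h.insertPair σ) := by
  symm
  refine Finset.sum_bij (fun σ _ => h.insertPair σ) ?_ (fun σ _ τ _ => @insertPair_injective _ _ _ _ _ _ _ h σ τ) ?_
    (fun _ _ => rfl)
  · intro σ hσ
    exact Finset.mem_filter.2 ⟨(hS σ).2 hσ, h.insertPair_left σ, h.insertPair_right σ⟩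
  · intro τ hτ
    obtain ⟨hτ, hi, hc⟩ := Finset.mem_filter.1 hτ
    obtain ⟨σ, rfl⟩ := h.exists_insertPair_eq hi hc
    exact ⟨σ, (hS σ).1 hτ, rfl⟩

end IsPairInsertion

theorem annularRotation_val {m n : ℕ} (x : Fin (m + n)) :
    (annularRotation m n x).val = if x.val < m then (if x.val + 1 = m then 0 else x.val + 1)
      else (if x.val + 1 = m + n then m else x.val + 1) := by
  rw [annularRotation_eq_prodPerm]
  refine Fin.addCases (fun i => ?_) (fun j => ?_) x
  · have := i.2
    simp only [prodPerm_castAdd, Fin.val_castAdd, finRotate_val]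
    split_ifs <;> omega
  · have := j.2
    simp only [prodPerm_natAdd, Fin.val_natAdd, finRotate_val]
    split_ifs <;> omega

/-- At least one point besides `0` and `1` is kept; otherwise the two points would form a cycle of
`γ` on their own. Circles of length two are treated separately below. -/
theorem isPairInsertion_finRotate (n : ℕ) : IsPairInsertion (finRotate (n + 1))
    (finRotate (n + 3)) (fun k => ⟨k + 2, by omega⟩) ⟨0, by omega⟩ ⟨1, by omega⟩ where
  strictMono _ _ h := Nat.add_lt_add_right h 2
  ne_left k h := by simp only [Fin.ext_iff] at h; omega
  ne_right k h := by simp only [Fin.ext_iff] at h; omega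
  exists_eq x h0 h1 := by
    simp only [ne_eq, Fin.ext_iff] at h0 h1
    exact ⟨⟨x - 2, by omega⟩, by ext; simp only; omega⟩
  ne h := by simp only [Fin.ext_iff] at h; omega
  apply_left := by ext; simp only [finRotate_val]; split_ifs <;> omega
  apply_right_ne h := by
    simp only [Fin.ext_iff, finRotate_val] at h
    split_ifs at h <;> omega
  apply_map k := by
    have hk := k.2
    by_cases hn : (k : ℕ) = n
    · rw [if_pos (by ext; simp only [finRotate_val]; split_ifs <;> omega)]
      ext
      simp only [finRotate_val]
      split_ifs <;> omega
    · rw [if_neg (fun h0 => by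
        rw [Fin.ext_iff, finRotate_val] at h0
        split_ifs at h0 <;> simp only at * <;> omega)]
      ext
      simp only [finRotate_val]
      split_ifs <;> omega

theorem isPairInsertion_annularRotation (m n : ℕ) : IsPairInsertion (annularRotation (m + 1) n)
    (annularRotation (m + 3) n) (fun k => ⟨k + 2, by omega⟩) ⟨0, by omega⟩ ⟨1, by omega⟩ where
  strictMono _ _ h := Nat.add_lt_add_right h 2
  ne_left k h := by simp only [Fin.ext_iff] at h; omega
  ne_right k h := by simp only [Fin.ext_iff] at h; omega
  exists_eq x h0 h1 := by
    simp only [ne_eq, Fin.ext_iff] at h0 h1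
    exact ⟨⟨x - 2, by omega⟩, by ext; simp only; omega⟩
  ne h := by simp only [Fin.ext_iff] at h; omega
  apply_left := by ext; simp only [annularRotation_val]; split_ifs <;> omega
  apply_right_ne h := by
    simp only [Fin.ext_iff, annularRotation_val] at h
    split_ifs at h <;> omega
  apply_map k := by
    have hk := k.2
    by_cases hn : (k : ℕ) = m
    · rw [if_pos (by ext; simp only [annularRotation_val]; split_ifs <;> omega)]
      ext
      simp only [annularRotation_val]
      split_ifs <;> omega
    · rw [if_neg (fun h0 => by
        rw [Fin.ext_iff, annularRotation_val] at h0
        split_ifs at h0 <;> simp only at * <;> omega)]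
      ext
      simp only [annularRotation_val]
      split_ifs <;> omega

/-! ### Cumulants of words with two neighbouring entries whose product is `1` -/

section MergedMap

variable {A : Type*} [Ring A] [Algebra ℂ A] (P : SecondOrderSpace A) {m n : ℕ}
  {π : Perm (Fin n)} {ρ : Perm (Fin m)} {f : Fin m → Fin n}

theorem map_mul_swap (hi : f.Injective) (hf : ∀ x, f (ρ x) = π (f x)) (i j x : Fin m) :
    f ((ρ * swap i j) x) = (π * swap (f i) (f j)) (f x) := by
  rw [Perm.mul_apply, Perm.mul_apply, hf, hi.map_swap]

theorem sum_sameCycle_map (hi : f.Injective) (hf : ∀ x, f (ρ x) = π (f x)) (x : Fin m)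
    (F : Fin n → ℂ) :
    ∑ z with π.SameCycle (f x) z, F z = ∑ j with ρ.SameCycle x j, F (f j) := by
  symm
  refine Finset.sum_bij (fun j _ => f j) ?_ (fun _ _ _ _ h => hi h) ?_ (fun _ _ => rfl)
  · intro j hj
    rw [Finset.mem_filter] at hj ⊢
    exact ⟨Finset.mem_univ _, sameCycle_of_maps hf hj.2⟩
  · intro z hz
    obtain ⟨j, hj, rfl⟩ := exists_of_sameCycle_map hf (Finset.mem_filter.1 hz).2
    exact ⟨j, Finset.mem_filter.2 ⟨Finset.mem_univ _, hj⟩, rfl⟩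

theorem splitTerm_map (hi : f.Injective) (hf : ∀ x, f (ρ x) = π (f x)) (w : Fin n → A)
    (x j : Fin m) :
    splitTerm P π w (f x) (f j) = splitTerm P ρ (fun k => w (f k)) x j := by
  simp only [splitTerm, hi.eq_iff, cycleCumulant_map P hi hf,
    cycleCumulant_map P hi (map_mul_swap hi hf x j)]

theorem mergedCumulant_map (hi : f.Injective) (hf : ∀ x, f (ρ x) = π (f x)) (w : Fin n → A)
    (x : Fin m) :
    mergedCumulant P π w (f x) = mergedCumulant P ρ (fun k => w (f k)) x := by
  rw [mergedCumulant, sum_sameCycle_map hi hf]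
  exact Finset.sum_congr rfl fun j _ => splitTerm_map P hi hf w x j

theorem mergedCumulant₂_map (hi : f.Injective) (hf : ∀ x, f (ρ x) = π (f x)) (w : Fin n → A)
    (x y : Fin m) :
    mergedCumulant₂ P π w (f x) (f y) = mergedCumulant₂ P ρ (fun k => w (f k)) x y := by
  rw [mergedCumulant₂, sum_sameCycle_map hi hf, sum_sameCycle_map hi hf]
  simp only [splitTerm₂, hi.eq_iff, cycleCumulant_map P hi (map_mul_swap hi hf x _),
    cycleCumulant₂_map P hi hf, cycleCumulant₂_map P hi (map_mul_swap hi hf x _)]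
  rfl

theorem two_le_cycleLength {i : Fin n} (h : π i ≠ i) : 2 ≤ cycleLength π i := by
  have h0 := cycleLength_pos π i
  have : cycleLength π i ≠ 1 := fun h1 => h (Function.minimalPeriod_eq_one_iff_isFixedPt.1 h1)
  omega

theorem cycleLength_eq_two_iff {i : Fin n} (h : π i ≠ i) : cycleLength π i = 2 ↔ π (π i) = i := by
  constructor
  · intro h2
    have := pow_cycleLength π i
    rwa [h2, sq, Perm.mul_apply] at this
  · intro h2
    have : cycleLength π i ≤ 2 := Function.IsPeriodicPt.minimalPeriod_le two_pos h2
    have := two_le_cycleLength h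
    omega

end MergedMap

/-! ### Evaluation of merged cumulants when the merged product is `1` -/

section Merged

theorem ofFn_prod_of_mul_eq_one {M : Type*} [Monoid M] {n : ℕ} (a : Fin (n + 2) → M)
    (h : a ⟨0, by omega⟩ * a ⟨1, by omega⟩ = 1) :
    (List.ofFn a).prod = (List.ofFn fun k : Fin n => a ⟨k + 2, by omega⟩).prod := by
  rw [List.ofFn_succ, List.ofFn_succ, List.prod_cons, List.prod_cons, ← mul_assoc]
  have : a 0 * a (Fin.succ 0) = 1 := h
  rw [this, one_mul]
  rfl

variable {A : Type*} [Ring A] [Algebra ℂ A] (P : SecondOrderSpace A)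

/-- In the moment grouped by `σ`, `ih` evaluates every merged factor except that of `γ`. The
surviving `σ` with cycle `(0, 1)` sum to the moment of the shortened word, which equals the full
moment, so nothing is left for `γ`. -/
theorem mergedCumulant_finRotate {n : ℕ} (hn : 2 ≤ n)
    (ih : ∀ (σ : Perm (Fin n)) (w : Fin n → A) (i : Fin n), σ i ≠ i → w i * w (σ i) = 1 →
      cycleLength σ i < n → mergedCumulant P σ w i = if σ (σ i) = i then 1 else 0)
    (a : Fin n → A) (ha : a ⟨0, by omega⟩ * a ⟨1, by omega⟩ = 1) :
    mergedCumulant P (finRotate n) a ⟨0, by omega⟩ = if n = 2 then 1 else 0 := by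
  obtain ⟨n, rfl⟩ : ∃ k, n = k + 2 := ⟨n - 2, by omega⟩
  set γ := finRotate (n + 2) with hγdef
  set i : Fin (n + 2) := ⟨0, by omega⟩ with hi
  set c : Fin (n + 2) := ⟨1, by omega⟩ with hc
  have hγ : γ i = c := by
    ext; simp only [hγdef, hi, hc, finRotate_val]; split_ifs <;> omega
  have hci : c ≠ i := by simp [hc, hi]
  have hmom := moment_eq_sum P (by omega) a
  rw [NC_eq_geodesic, ← hγdef, sum_geodesic_eq P _ i, hγ,
    ← Finset.add_sum_erase ((geodesic γ).filter (fun σ => σ i = c)) _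
      (Finset.mem_filter.2 ⟨self_mem_geodesic γ, hγ⟩), hγdef, otherMins_finRotate,
    Finset.prod_empty, mul_one, ← hγdef] at hmom
  have hlt : ∀ σ ∈ ((geodesic γ).filter (fun σ => σ i = c)).erase γ,
      σ i = c ∧ cycleLength σ i < n + 2 := by
    intro σ hσ
    simp only [Finset.mem_erase, Finset.mem_filter] at hσ
    exact ⟨hσ.2.2, cycleLength_lt (Finset.mem_erase.2 ⟨hσ.1, hσ.2.1⟩) i⟩
  -- On two points a cycle through `i` that moves it is already full, so `γ` is the only term and
  -- its value is `φ 1 = 1`.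
  rcases Nat.eq_zero_or_pos n with rfl | hn
  · rw [Finset.sum_eq_zero, add_zero, ofFn_prod_of_mul_eq_one a ha] at hmom
    · rw [if_pos rfl, ← P.φ_one]
      simpa using hmom.symm
    · intro σ hσ
      have := hlt σ hσ
      have := two_le_cycleLength (π := σ) (i := i) (by rw [this.1]; exact hci)
      omega
  · obtain ⟨n, rfl⟩ : ∃ k, n = k + 1 := ⟨n - 1, by omega⟩
    rw [if_neg (by omega)]
    have hins : IsPairInsertion (finRotate (n + 1)) γ _ i c := isPairInsertion_finRotate n
    have hs := hins.sum_eq_sum_insertPair (geodesic γ) (geodesic (finRotate (n + 1)))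
      hins.insertPair_mem_geodesic (fun σ => ∏ x ∈ otherMins σ i, cycleCumulant P σ a x)
    -- Removing the two-cycle leaves the moment-cumulant formula of the word without its first two
    -- letters.
    have hT : ∑ σ ∈ geodesic (finRotate (n + 1)),
        ∏ x ∈ otherMins (hins.insertPair σ) i, cycleCumulant P (hins.insertPair σ) a x =
        P.φ (List.ofFn a).prod := by
      rw [ofFn_prod_of_mul_eq_one a ha, moment_eq_sum P (by omega), NC_eq_geodesic]
      refine Finset.sum_congr rfl fun σ _ => ?_
      rw [hins.otherMins_insertPair σ, Finset.prod_map]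
      exact Finset.prod_congr rfl fun x _ =>
        cycleCumulant_map P hins.strictMono.injective (fun k => (hins.insertPair_map σ k).symm) a x
    have hE : ∑ σ ∈ ((geodesic γ).filter (fun σ => σ i = c)).erase γ,
        mergedCumulant P σ a i * ∏ x ∈ otherMins σ i, cycleCumulant P σ a x =
        ∑ σ ∈ geodesic γ with σ i = c ∧ σ c = i, ∏ x ∈ otherMins σ i, cycleCumulant P σ a x := by
      have hset : (geodesic γ).filter (fun σ => σ i = c ∧ σ c = i) =
          (((geodesic γ).filter (fun σ => σ i = c)).erase γ).filter (fun σ => σ c = i) := by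
        ext σ
        simp only [Finset.mem_filter, Finset.mem_erase]
        constructor
        · rintro ⟨h1, h2, h3⟩
          exact ⟨⟨fun e => hins.apply_right_ne (e ▸ h3), h1, h2⟩, h3⟩
        · rintro ⟨⟨-, h1, h2⟩, h3⟩
          exact ⟨h1, h2, h3⟩
      rw [hset, Finset.sum_filter]
      refine Finset.sum_congr rfl fun σ hσ => ?_
      obtain ⟨h1, h2⟩ := hlt σ hσ
      rw [ih σ a i (by rw [h1]; exact hci) (by rw [h1]; exact ha) h2, h1, ite_mul, one_mul,
        zero_mul]
    rw [hE, hs, hT] at hmom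
    linear_combination -hmom

/-- A free cumulant with an entry `1` vanishes, except for the cumulant of order one. -/
theorem mergedCumulant_eq {N : ℕ} (σ : Perm (Fin N)) (w : Fin N → A) (i : Fin N) (hi : σ i ≠ i)
    (h1 : w i * w (σ i) = 1) :
    mergedCumulant P σ w i = if σ (σ i) = i then 1 else 0 := by
  induction hl : cycleLength σ i using Nat.strong_induction_on generalizing N with
  | _ l ih =>
  subst hl
  have h2 := two_le_cycleLength hi
  have hmap := mergedCumulant_map P (cycleMap_injective σ i) (cycleMap_finRotate σ i) w
    ⟨0, by omega⟩
  rw [cycleMap_zero, mergedCumulant_finRotate P h2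
    (fun τ v j hj hv hlt => ih _ hlt τ v j hj hv rfl)] at hmap
  · rw [hmap]; simp only [← cycleLength_eq_two_iff hi]
  · simpa [cycleMap] using h1

theorem mem_circle_iff_mem_circle {m n : ℕ} {e : Fin (m + 1 + n) → Fin (m + 3 + n)}
    (he : ∀ k, (e k : ℕ) = k + 2) (k : Fin (m + 1 + n)) :
    e k ∈ circle (m + 3) n ↔ k ∈ circle (m + 1) n := by
  rw [mem_circle, mem_circle, he]; omega

theorem otherMins_annularRotation {m n : ℕ} (hm : 0 < m) (hn : 0 < n) :
    otherMins (annularRotation m n) (Fin.castAdd n ⟨0, hm⟩) = {Fin.natAdd m ⟨0, hn⟩} := by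
  ext x
  rw [mem_otherMins, annularRotation_eq_prodPerm, cycleMins_prodPerm, cycleMins_finRotate hm,
    cycleMins_finRotate hn]
  simp only [Finset.map_singleton, Finset.mem_union, Finset.mem_singleton]
  constructor
  · rintro ⟨rfl | rfl, h⟩
    · exact absurd .rfl h
    · rfl
  · rintro rfl
    refine ⟨Or.inr rfl, fun h => ?_⟩
    have := mem_of_sameCycle (S := {x | x ∈ circle m n})
      (fun x => (prodPerm_mem_circle_iff _ _ x).symm) h
    exact natAdd_notMem_circle _ (this.1 (castAdd_mem_circle _))

/-- First order merged factors keep only the `σ` with cycle `(i, c)`, and these reproduce the moment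
of the shortened word. The second order merged factors vanish by `ih` except the one of `γ`, which
must then vanish too. -/
theorem mergedCumulant₂_annularRotation {m n : ℕ} (hm : 2 ≤ m) (hn : 0 < n)
    (ih : ∀ (σ : Perm (Fin (m + n))) (w : Fin (m + n) → A) (i y : Fin (m + n)), σ i ≠ i →
      w i * w (σ i) = 1 → ¬ σ.SameCycle i y → cycleLength σ i + cycleLength σ y < m + n →
      mergedCumulant₂ P σ w i y = 0)
    (w : Fin (m + n) → A)
    (ha : w (Fin.castAdd n ⟨0, by omega⟩) * w (Fin.castAdd n ⟨1, by omega⟩) = 1) :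
    mergedCumulant₂ P (annularRotation m n) w (Fin.castAdd n ⟨0, by omega⟩)
      (Fin.natAdd m ⟨0, hn⟩) = 0 := by
  obtain ⟨m, rfl⟩ : ∃ k, m = k + 2 := ⟨m - 2, by omega⟩
  set γ := annularRotation (m + 2) n with hγdef
  set C := circle (m + 2) n with hCdef
  set i : Fin (m + 2 + n) := Fin.castAdd n ⟨0, by omega⟩ with hi
  set c : Fin (m + 2 + n) := Fin.castAdd n ⟨1, by omega⟩ with hc
  set y : Fin (m + 2 + n) := Fin.natAdd (m + 2) ⟨0, hn⟩ with hy
  have hγ : γ i = c := by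
    ext; simp only [hγdef, hi, hc, annularRotation_val, Fin.val_castAdd]; split_ifs <;> omega
  have hci : c ≠ i := by simp [hc, hi, Fin.ext_iff]
  have hiC : i ∈ C := castAdd_mem_circle _
  have hcC : c ∈ C := castAdd_mem_circle _
  have hyC : y ∉ C := natAdd_notMem_circle _
  have hom : otherMins γ i = {y} := otherMins_annularRotation _ hn
  have hmom := moment₂_eq_sum P (m := m + 2) (by omega) hn (fun k => w (Fin.castAdd n k))
    (fun k => w (Fin.natAdd _ k))
  rw [show (Fin.append (fun k => w (Fin.castAdd n k)) fun k => w (Fin.natAdd _ k)) = w from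
    Fin.append_castAdd_natAdd, ofFn_prod_of_mul_eq_one _ ha,
    sum_annulus_add_sum_geodesic P (i := i) annularRotation_mem_circle_iff hiC,
    ← hγdef, ← hCdef, hγ] at hmom
  have hm1 : ∀ σ : Perm (Fin (m + 2 + n)), σ i = c →
      mergedCumulant P σ w i = if σ c = i then 1 else 0 := by
    intro σ hσ
    rw [mergedCumulant_eq P σ w i (by rw [hσ]; exact hci) (by rw [hσ]; exact ha), hσ]
  have hA : ∑ σ ∈ annulus γ C with σ i = c,
        mergedCumulant P σ w i * ∏ x ∈ otherMins σ i, cycleCumulant P σ w x =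
      ∑ σ ∈ annulus γ C with σ i = c ∧ σ c = i,
        ∏ x ∈ otherMins σ i, cycleCumulant P σ w x := by
    rw [← Finset.filter_filter, Finset.sum_filter (fun σ : Perm (Fin (m + 2 + n)) => σ c = i)]
    refine Finset.sum_congr rfl fun σ hσ => ?_
    rw [hm1 σ (Finset.mem_filter.1 hσ).2, ite_mul, one_mul, zero_mul]
  have hG : ∑ σ ∈ geodesic γ with σ i = c, mergedCumulant P σ w i *
        markedSum (otherMins σ i) C (cycleCumulant P σ w) (cycleCumulant₂ P σ w) =
      ∑ σ ∈ geodesic γ with σ i = c ∧ σ c = i,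
        markedSum (otherMins σ i) C (cycleCumulant P σ w) (cycleCumulant₂ P σ w) := by
    rw [← Finset.filter_filter, Finset.sum_filter (fun σ : Perm (Fin (m + 2 + n)) => σ c = i)]
    refine Finset.sum_congr rfl fun σ hσ => ?_
    rw [hm1 σ (Finset.mem_filter.1 hσ).2, ite_mul, one_mul, zero_mul]
  have hM : ∑ σ ∈ geodesic γ with σ i = c, ∑ y ∈ otherMins σ i with y ∉ C,
      mergedCumulant₂ P σ w i y * ∏ z ∈ (otherMins σ i).erase y, cycleCumulant P σ w z =
      mergedCumulant₂ P γ w i y := by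
    rw [Finset.sum_eq_single γ]
    · rw [hom, Finset.filter_singleton, if_pos hyC, Finset.sum_singleton, Finset.erase_singleton,
        Finset.prod_empty, mul_one]
    · intro σ hσ hne
      obtain ⟨h1, h2⟩ := Finset.mem_filter.1 hσ
      refine Finset.sum_eq_zero fun z hz => ?_
      obtain ⟨hz, hzC⟩ := Finset.mem_filter.1 hz
      rw [ih σ w i z (by rw [h2]; exact hci) (by rw [h2]; exact ha) (mem_otherMins.1 hz).2
        (cycleLength_add_lt_of_mem (Finset.mem_erase.2 ⟨hne, h1⟩) hiC hzC), zero_mul]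
    · intro h
      exact absurd (Finset.mem_filter.2 ⟨self_mem_geodesic γ, hγ⟩) h
  rw [Finset.sum_add_distrib, hA, hG, hM] at hmom
  -- Here `i` and `c` fill the first circle. A cycle `(i, c)` leaves nothing to cross the annulus or
  -- to be marked, and the moment is `φ₂(1, ·) = 0`.
  rcases Nat.eq_zero_or_pos m with rfl | hm
  · have hC2 : ∀ x ∈ C, x = i ∨ x = c := by
      intro x hx
      rw [hCdef, mem_circle] at hx
      simp only [hi, hc, Fin.ext_iff, Fin.val_castAdd]
      omega
    rw [Finset.sum_eq_zero, Finset.sum_eq_zero] at hmom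
    · simpa [P.φ₂_one_left] using hmom.symm
    · intro σ hσ
      obtain ⟨-, h1, h2⟩ := Finset.mem_filter.1 hσ
      rw [markedSum, Finset.filter_false_of_mem, Finset.sum_empty]
      intro x hx hxC
      refine (mem_otherMins.1 hx).2 ?_
      rcases hC2 x hxC with rfl | rfl
      · exact .rfl
      · exact h1 ▸ sameCycle_apply_self σ i
    · intro σ hσ
      obtain ⟨hσ, h1, h2⟩ := Finset.mem_filter.1 hσ
      exfalso
      obtain ⟨⟨x, z, hx, hz, hxz⟩, -⟩ := mem_annulus.1 hσ
      have hσC : ∀ x ∈ C, σ x ∈ C := by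
        intro x hx
        rcases hC2 x hx with rfl | rfl
        · rwa [h1]
        · rwa [h2]
      have hσC' : ∀ x, x ∈ C ↔ σ x ∈ C := fun x => ⟨hσC x, fun hx' => by
        rcases hC2 _ hx' with e | e
        · rw [σ.injective (e.trans h2.symm)]; exact hcC
        · rw [σ.injective (e.trans h1.symm)]; exact hiC⟩
      exact hz ((mem_of_sameCycle (S := {x | x ∈ C}) hσC' hxz).1 hx)
  · obtain ⟨m, rfl⟩ : ∃ k, m = k + 1 := ⟨m - 1, by omega⟩
    have hins : IsPairInsertion (annularRotation (m + 1) n) γ _ i c :=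
      isPairInsertion_annularRotation m n
    have hmem : ∀ k : Fin (m + 1 + n), (⟨k + 2, by omega⟩ : Fin (m + 3 + n)) ∈ C ↔
        k ∈ circle (m + 1) n := mem_circle_iff_mem_circle (fun _ => rfl)
    have hmap : ∀ σ k, (⟨(σ k : Fin (m + 1 + n)) + 2, by omega⟩ : Fin (m + 3 + n)) =
      hins.insertPair σ ⟨k + 2, by omega⟩ := fun σ k => (hins.insertPair_map σ k).symm
    have hinj := hins.strictMono.injective
    have hs1 := hins.sum_eq_sum_insertPair (annulus γ C)
      (annulus (annularRotation (m + 1) n) (circle (m + 1) n))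
      (fun σ => hins.insertPair_mem_annulus σ hiC hcC hmem)
      (fun σ => ∏ x ∈ otherMins σ i, cycleCumulant P σ w x)
    have hs2 := hins.sum_eq_sum_insertPair (geodesic γ) (geodesic (annularRotation (m + 1) n))
      hins.insertPair_mem_geodesic (fun σ => markedSum (otherMins σ i) C (cycleCumulant P σ w)
        (cycleCumulant₂ P σ w))
    have hmom' := moment₂_eq_sum P (m := m + 1) (n := n) (by omega) hn
      (fun k => w (Fin.castAdd n ⟨k + 2, by omega⟩)) (fun k => w (Fin.natAdd _ k))
    have hw : (Fin.append (fun k : Fin (m + 1) => w (Fin.castAdd n ⟨k + 2, by omega⟩))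
        fun k => w (Fin.natAdd _ k)) = fun k : Fin (m + 1 + n) => w ⟨k + 2, by omega⟩ := by
      funext k
      refine Fin.addCases (fun i => ?_) (fun j => ?_) k
      · rw [Fin.append_left]; rfl
      · rw [Fin.append_right]; congr 1; ext; simp; omega
    rw [hw] at hmom'
    have hT1 : ∀ σ, ∏ x ∈ otherMins (hins.insertPair σ) i,
        cycleCumulant P (hins.insertPair σ) w x =
        ∏ x ∈ cycleMins σ, cycleCumulant P σ (fun k => w ⟨k + 2, by omega⟩) x := by
      intro σ
      rw [hins.otherMins_insertPair σ, Finset.prod_map]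
      exact Finset.prod_congr rfl fun x _ => cycleCumulant_map P hinj (hmap σ) w x
    have hT2 : ∀ σ, markedSum (otherMins (hins.insertPair σ) i) C
        (cycleCumulant P (hins.insertPair σ) w) (cycleCumulant₂ P (hins.insertPair σ) w) =
        markedSum (cycleMins σ) (circle (m + 1) n)
          (cycleCumulant P σ (fun k => w ⟨k + 2, by omega⟩))
          (cycleCumulant₂ P σ (fun k => w ⟨k + 2, by omega⟩)) := by
      intro σ
      rw [hins.otherMins_insertPair σ]
      symm
      refine markedSum_bij (fun k => ⟨k + 2, by omega⟩) ⟨?_, hinj.injOn, ?_⟩ (fun x _ => hmem x)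
        (fun x _ => (cycleCumulant_map P hinj (hmap σ) w x).symm)
        (fun x _ y _ _ _ => (cycleCumulant₂_map P hinj (hmap σ) w x y).symm)
      · intro x hx
        exact Finset.mem_coe.2 (Finset.mem_map.2 ⟨x, hx, rfl⟩)
      · intro x hx
        obtain ⟨z, hz, rfl⟩ := Finset.mem_map.1 (Finset.mem_coe.1 hx)
        exact ⟨z, hz, rfl⟩
    simp only [hT1] at hs1
    simp only [hT2] at hs2
    rw [hs1, hs2, hmom'] at hmom
    linear_combination -hmom

/-- A second order cumulant with an entry `1` vanishes. -/
theorem mergedCumulant₂_eq_zero {N : ℕ} (σ : Perm (Fin N)) (w : Fin N → A) (i y : Fin N)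
    (hi : σ i ≠ i) (h1 : w i * w (σ i) = 1) (hy : ¬ σ.SameCycle i y) :
    mergedCumulant₂ P σ w i y = 0 := by
  induction hl : cycleLength σ i + cycleLength σ y using Nat.strong_induction_on
    generalizing N with
  | _ l ih =>
  subst hl
  have h2 := two_le_cycleLength hi
  have h3 := cycleLength_pos σ y
  -- The two disjoint cycles are unrolled into the two circles of an annulus, on which `σ` acts as
  -- the rotation.
  set f := Fin.append (cycleMap σ i) (cycleMap σ y) with hfdef
  have hinj : f.Injective := by
    intro x z
    refine Fin.addCases (fun k => ?_) (fun k => ?_) x <;>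
      refine Fin.addCases (fun l => ?_) (fun l => ?_) z <;>
      simp only [hfdef, Fin.append_left, Fin.append_right]
    · intro h; rw [cycleMap_injective σ i h]
    · intro h
      exact absurd ((sameCycle_cycleMap σ i k).trans (h ▸ (sameCycle_cycleMap σ y l).symm)) hy
    · intro h
      exact absurd ((sameCycle_cycleMap σ i l).trans (h ▸ (sameCycle_cycleMap σ y k).symm)) hy
    · intro h; rw [cycleMap_injective σ y h]
  have hf : ∀ x, f (annularRotation _ _ x) = σ (f x) := by
    intro x
    rw [annularRotation_eq_prodPerm]
    refine Fin.addCases (fun k => ?_) (fun k => ?_) x <;>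
      simp only [hfdef, prodPerm_castAdd, prodPerm_natAdd, Fin.append_left, Fin.append_right,
        cycleMap_finRotate]
  have hmap := mergedCumulant₂_map P hinj hf w (Fin.castAdd _ ⟨0, by omega⟩)
    (Fin.natAdd _ ⟨0, h3⟩)
  rw [mergedCumulant₂_annularRotation P h2 h3
    (fun τ v j z hj hv hz hlt => ih _ hlt τ v j z hj hv hz rfl)] at hmap
  · rw [hfdef, Fin.append_left, Fin.append_right, cycleMap_zero, cycleMap_zero] at hmap
    exact hmap
  · simp only [hfdef, Fin.append_left]
    simpa [cycleMap] using h1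

end Merged

/-! ### Cycle lengths -/

section CycleLengths

variable {n : ℕ} {π : Perm (Fin n)}

theorem card_sameCycle (π : Perm (Fin n)) (x : Fin n) :
    (Finset.univ.filter fun y => π.SameCycle x y).card = cycleLength π x := by
  have : (Finset.univ.filter fun y => π.SameCycle x y) =
      Finset.univ.map ⟨cycleMap π x, cycleMap_injective π x⟩ := by
    ext y
    simp only [Finset.mem_filter, Finset.mem_univ, true_and, Finset.mem_map,
      Function.Embedding.coeFn_mk]
    exact ⟨exists_cycleMap_eq, fun ⟨k, hk⟩ => hk ▸ sameCycle_cycleMap π x k⟩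
  rw [this, Finset.card_map, Finset.card_univ, Fintype.card_fin]

theorem sum_cycleLength (π : Perm (Fin n)) : ∑ x ∈ cycleMins π, cycleLength π x = n := by
  have h := isTransversal_cycleMins π
  simp only [← card_sameCycle]
  rw [← Finset.card_biUnion]
  · have : ((cycleMins π).biUnion fun x => Finset.univ.filter fun y => π.SameCycle x y) =
        Finset.univ := by
      rw [Finset.eq_univ_iff_forall]
      intro y
      obtain ⟨r, hr, hy⟩ := h.exists_mem y
      simp only [Finset.mem_biUnion, Finset.mem_filter, Finset.mem_univ, true_and]
      exact ⟨r, hr, hy.symm⟩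
    rw [this, Finset.card_univ, Fintype.card_fin]
  · intro x hx y hy hxy
    rw [Function.onFun, Finset.disjoint_left]
    intro z hz hz'
    simp only [Finset.mem_filter, Finset.mem_univ, true_and] at hz hz'
    exact hxy (h.eq_of_sameCycle x hx y hy (hz.trans hz'.symm))

theorem cycleLength_add_lt_of_not_sameCycle {x y z : Fin n} (hxy : ¬ π.SameCycle x y)
    (hxz : ¬ π.SameCycle x z) (hyz : ¬ π.SameCycle y z) :
    cycleLength π x + cycleLength π y < n := by
  rw [← card_sameCycle, ← card_sameCycle, ← Finset.card_union_of_disjoint]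
  · conv_rhs => rw [← Fintype.card_fin n, ← Finset.card_univ]
    refine Finset.card_lt_card (Finset.ssubset_univ_iff.2 fun h => ?_)
    have := Finset.eq_univ_iff_forall.1 h z
    simp only [Finset.mem_union, Finset.mem_filter, Finset.mem_univ, true_and] at this
    tauto
  · rw [Finset.disjoint_left]
    intro t ht ht'
    simp only [Finset.mem_filter, Finset.mem_univ, true_and] at ht ht'
    exact hxy (ht.trans ht'.symm)

/-- Without fixed points every cycle has length at least two. Together with the case of equality
this is the count that recognises spoke diagrams. -/
theorem two_mul_numCycles_le (h : ∀ x, π x ≠ x) : 2 * numCycles π ≤ n := by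
  have := Finset.card_nsmul_le_sum (cycleMins π) (cycleLength π) 2
    fun x _ => two_le_cycleLength (h x)
  rw [sum_cycleLength, smul_eq_mul, mul_comm] at this
  exact this

theorem two_mul_numCycles_eq_iff (h : ∀ x, π x ≠ x) :
    2 * numCycles π = n ↔ ∀ x, π (π x) = x := by
  have h1 : ∑ x ∈ cycleMins π, 2 = 2 * numCycles π := by
    rw [Finset.sum_const, smul_eq_mul, mul_comm]; rfl
  have h2 := Finset.sum_eq_sum_iff_of_le (s := cycleMins π) (f := fun _ => 2)
    (g := cycleLength π) fun x _ => two_le_cycleLength (h x)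
  rw [h1, sum_cycleLength] at h2
  rw [h2]
  constructor
  · intro h' x
    obtain ⟨r, hr, hx⟩ := (isTransversal_cycleMins π).exists_mem x
    rw [← cycleLength_eq_two_iff (h x), cycleLength_congr hx, ← h' r hr]
  · exact fun h' x _ => ((cycleLength_eq_two_iff (h x)).2 (h' x)).symm

end CycleLengths

/-! ### Sign patterns -/

section Signs

variable {n : ℕ} {γ : Perm (Fin n)} {ε : Fin n → ℤˣ}

theorem units_add_eq_zero_iff {s t : ℤˣ} : (s : ℤ) + (t : ℤ) = 0 ↔ s ≠ t := by
  rcases Int.units_eq_one_or s with rfl | rfl <;> rcases Int.units_eq_one_or t with rfl | rfl <;>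
    decide

theorem alternating_iff : Alternating ε ↔ ∀ i j : Fin n, (j : ℕ) = i + 1 → ε i ≠ ε j := by
  simp only [Alternating, units_add_eq_zero_iff]

/-- A sign that is repeated along a cycle of `γ` is repeated immediately before a change of the
sign, unless the signs along this cycle are constant. -/
theorem exists_repeat_before_change {k : Fin n} (hk : ε (γ k) = ε k) :
    (∃ h, γ.SameCycle k h ∧ ε (γ h) = ε h ∧ ε (γ (γ h)) ≠ ε (γ h)) ∨
      ∀ x, γ.SameCycle k x → ε x = ε k := by
  by_cases hex : ∃ h, γ.SameCycle k h ∧ ε (γ h) = ε h ∧ ε (γ (γ h)) ≠ ε (γ h)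
  · exact Or.inl hex
  · push Not at hex
    refine Or.inr fun x hx => ?_
    obtain ⟨m, rfl⟩ := hx.exists_nat_pow_eq
    have key : ∀ m : ℕ, ε ((γ ^ m) k) = ε k ∧ ε (γ ((γ ^ m) k)) = ε ((γ ^ m) k) := by
      intro m
      induction m with
      | zero => exact ⟨rfl, hk⟩
      | succ m ih =>
        rw [pow_succ', Perm.mul_apply]
        exact ⟨ih.2.trans ih.1, hex _ ⟨m, by simp⟩ ih.2⟩
    exact (key m).1

/-- Signs that change at each step around a circle alternate, and their number is even. -/
theorem even_and_alternating (h : ∀ k, ε (finRotate n k) ≠ ε k) : Even n ∧ Alternating ε := by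
  have hneg : ∀ k, ε (finRotate n k) = -ε k := fun k => Int.units_ne_iff_eq_neg.1 (h k)
  constructor
  · have h1 : ∏ k, ε k = (-1) ^ n * ∏ k, ε k := by
      conv_lhs => rw [← Equiv.prod_comp (finRotate n)]
      simp only [hneg, Finset.prod_neg, Finset.card_univ, Fintype.card_fin]
    have h2 : (-1 : ℤˣ) ^ n = 1 := by
      have := mul_right_cancel ((one_mul _).trans h1)
      exact this.symm
    by_contra hodd
    rw [Nat.not_even_iff_odd] at hodd
    rw [hodd.neg_one_pow] at h2
    exact absurd h2 (by decide)
  · rw [alternating_iff]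
    intro i j hij
    have : finRotate n i = j := by
      ext; rw [finRotate_val, if_neg (by omega), hij]
    rw [← this]
    exact (h i).symm

/-- Reindexing by `γ` negates the sum. Used contrapositively: with unbalanced signs every
permutation has a repetition along some cycle. -/
theorem sum_eq_zero_of_forall_apply_ne (γ : Perm (Fin n)) (h : ∀ k, ε (γ k) ≠ ε k) :
    ∑ k, (ε k : ℤ) = 0 := by
  have h1 : ∑ k, (ε k : ℤ) = -∑ k, (ε k : ℤ) := by
    conv_lhs => rw [← Equiv.sum_comp γ]
    rw [← Finset.sum_neg_distrib]
    refine Finset.sum_congr rfl fun k _ => ?_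
    rw [Int.units_ne_iff_eq_neg.1 (h k), Units.val_neg]
  omega

theorem altSigns_finRotate (n : ℕ) (k : Fin (2 * n)) :
    altSigns (2 * n) (finRotate (2 * n) k) = -altSigns (2 * n) k := by
  simp only [altSigns, finRotate_val]
  split_ifs with h
  · have : (k : ℕ) = 2 * (n - 1) + 1 := by omega
    rw [this, pow_succ, pow_mul]; simp
  · rw [pow_succ]; simp

theorem eq_altSigns_or {ε : Fin (2 * n) → ℤˣ} (h : Alternating ε) :
    ε = altSigns (2 * n) ∨ ε = fun k => altSigns (2 * n) (finRotate (2 * n) k) := by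
  rw [alternating_iff] at h
  rcases Nat.eq_zero_or_pos n with rfl | hn
  · exact Or.inl (funext fun k => k.elim0)
  have key : ∀ (k : ℕ) (hk : k < 2 * n), ε ⟨k, hk⟩ = (-1) ^ k * ε ⟨0, by omega⟩ := by
    intro k
    induction k with
    | zero => intro _; simp
    | succ k ih =>
      intro hk
      rw [Int.units_ne_iff_eq_neg.1 (h ⟨k, by omega⟩ ⟨k + 1, hk⟩ rfl).symm, ih, pow_succ]
      simp
  simp only [altSigns_finRotate]
  rcases Int.units_eq_one_or (ε ⟨0, by omega⟩) with h0 | h0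
  · left; funext k; rw [key k k.2, h0, mul_one]; rfl
  · right; funext k; rw [key k k.2, h0]; simp [altSigns]

end Signs

/-! ### First order cumulants of Haar unitaries -/

section Haar

variable {A : Type*} [Ring A] [Algebra ℂ A] [StarRing A] {P : SecondOrderSpace A} {u : A}

theorem IsSecondOrderHaarUnitary.signed_mul_signed (hu : IsSecondOrderHaarUnitary P u) {s t : ℤˣ}
    (h : t ≠ s) : signed u s * signed u t = 1 := by
  have h1 := Unitary.star_mul_self_of_mem hu.unitary
  have h2 := Unitary.mul_star_self_of_mem hu.unitary
  rcases Int.units_eq_one_or s with rfl | rfl <;> rcases Int.units_eq_one_or t with rfl | rfl <;>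
    simp_all [signed, show ¬ ((-1 : ℤˣ) = 1) by decide]

theorem IsSecondOrderHaarUnitary.φ_signed_pow (hu : IsSecondOrderHaarUnitary P u) (s : ℤˣ) {k : ℕ}
    (hk : 1 ≤ k) : P.φ (signed u s ^ k) = 0 := by
  rw [signed]
  split_ifs
  exacts [hu.φ_pow k hk, hu.φ_star_pow k hk]

/-- Vanishing is assumed only for the length of this cycle, so the lemma applies both during the
induction and after it. -/
theorem cycleCumulant_signed_eq_zero {n : ℕ} {π : Perm (Fin n)} {ε : Fin n → ℤˣ} {x z : Fin n}
    (ih : ∀ η : Fin (cycleLength π x) → ℤˣ, (∃ k, η (finRotate _ k) = η k) →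
      cumulant P (cycleLength π x) (fun k => signed u (η k)) = 0)
    (hz : π.SameCycle x z) (h : ε (π z) = ε z) :
    cycleCumulant P π (fun k => signed u (ε k)) x = 0 := by
  obtain ⟨k, rfl⟩ := exists_cycleMap_eq hz
  refine ih (fun k => ε (cycleMap π x k)) ⟨k, ?_⟩
  rw [cycleMap_finRotate, h]

/-- After multiplication with a transposition `swap i j`, the cycle of `i` still contains a
repeated sign if `i` and its predecessor have the same sign. -/
theorem exists_repeat_mul_swap {n : ℕ} {γ : Perm (Fin n)} {ε : Fin n → ℤˣ} {h i j : Fin n}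
    (hi : γ h = i) (hhi : h ≠ i) (hε : ε i = ε h) :
    ∃ z, (γ * swap i j).SameCycle i z ∧
      (i ≠ j → ε ((γ * swap i j) z) = ε z) := by
  by_cases hj : h = j
  · subst hj
    exact ⟨i, .rfl, fun _ => by rw [mul_swap_apply_left, hi]⟩
  · have e : (γ * swap i j) h = i := by rw [mul_swap_apply_of_ne γ hhi hj, hi]
    refine ⟨h, ?_, fun _ => by rw [e, hε]⟩
    have := sameCycle_apply_self (γ * swap i j) h
    rw [e] at this
    exact this.symm

theorem ofFn_signed_const_prod {B : Type*} [Ring B] [StarRing B] {a : B} (s : ℤˣ) {n : ℕ} {ε : Fin n → ℤˣ} (h : ∀ k, ε k = s) :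
    (List.ofFn fun k => signed a (ε k)).prod = signed a s ^ n := by
  simp [h]

/-- A repetition before a change is handled by merging the changing pair: all summands but `j = i`
contain a shorter cycle with a repetition. For constant signs the moment and all terms with shorter
cycles vanish. -/
theorem IsSecondOrderHaarUnitary.cumulant_eq_zero (hu : IsSecondOrderHaarUnitary P u) (n : ℕ)
    (ε : Fin n → ℤˣ) (h : ∃ k, ε (finRotate n k) = ε k) :
    cumulant P n (fun k => signed u (ε k)) = 0 := by
  induction n using Nat.strong_induction_on with
  | _ n ih =>
  obtain ⟨k, hk⟩ := h
  have hn : 0 < n := k.pos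
  rcases exists_repeat_before_change hk with ⟨h, -, h1, h2⟩ | hconst
  · set i := finRotate n h with hi
    have hne : finRotate n i ≠ i := fun e => h2 (by rw [e])
    have hhi : h ≠ i := fun e => hne (by rw [← e]; exact hi.symm.trans e.symm)
    have hmerge := mergedCumulant_eq P (finRotate n) (fun k => signed u (ε k)) i hne
      (hu.signed_mul_signed h2)
    rw [if_neg, mergedCumulant, Finset.sum_eq_single i] at hmerge
    · rw [splitTerm, if_pos rfl, cycleCumulant_congr P (sameCycle_finRotate i ⟨0, hn⟩),
        cycleCumulant_finRotate] at hmerge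
      exact hmerge
    · intro j _ hj
      obtain ⟨z, hz, hε⟩ := exists_repeat_mul_swap (j := j) hi.symm hhi h1
      have hlt : cycleLength (finRotate n * swap i j) i < n := by
        refine lt_of_le_of_ne (cycleLength_le _ _) fun e => ?_
        exact not_sameCycle_mul_swap (sameCycle_finRotate i j) hj.symm
          (sameCycle_of_cycleLength_eq e j)
      rw [splitTerm, if_neg hj.symm, cycleCumulant_signed_eq_zero (fun η => ih _ hlt η) hz
        (hε hj.symm), zero_mul]
    · intro hi
      exact absurd (Finset.mem_filter.2 ⟨Finset.mem_univ _, .rfl⟩) hi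
    -- The merged cycle does not have length two: otherwise `h` would follow `γ h`, and the change
    -- of sign after `i` would contradict the repetition at `h`.
    · intro e
      have : finRotate n i = h := (finRotate n).injective (e.trans hi)
      rw [this] at h2
      exact h2 h1.symm
  · have hc : ∀ x, ε x = ε k := fun x => hconst x (sameCycle_finRotate k x)
    rw [cumulant_eq_sub, ofFn_signed_const_prod _ hc, hu.φ_signed_pow _ hn, Finset.sum_eq_zero,
      sub_zero]
    intro π hπ
    obtain ⟨r, hr, -⟩ := (isTransversal_cycleMins π).exists_mem k
    exact Finset.prod_eq_zero hr (cycleCumulant_signed_eq_zero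
      (fun η => ih _ (cycleLength_lt hπ r) η) .rfl ((hc _).trans (hc _).symm))

theorem IsSecondOrderHaarUnitary.cycleCumulant_eq_zero (hu : IsSecondOrderHaarUnitary P u) {n : ℕ}
    {π : Perm (Fin n)} {ε : Fin n → ℤˣ} {x z : Fin n} (hz : π.SameCycle x z)
    (h : ε (π z) = ε z) : cycleCumulant P π (fun k => signed u (ε k)) x = 0 :=
  cycleCumulant_signed_eq_zero (fun η => hu.cumulant_eq_zero _ η) hz h

theorem IsSecondOrderHaarUnitary.prod_cycleMins_eq_zero (hu : IsSecondOrderHaarUnitary P u) {n : ℕ}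
    {π : Perm (Fin n)} {ε : Fin n → ℤˣ} {z : Fin n} (h : ε (π z) = ε z) :
    ∏ x ∈ cycleMins π, cycleCumulant P π (fun k => signed u (ε k)) x = 0 := by
  obtain ⟨r, hr, hz⟩ := (isTransversal_cycleMins π).exists_mem z
  exact Finset.prod_eq_zero hr (hu.cycleCumulant_eq_zero hz.symm h)

/-- The cumulants `κ₂(u, u*)` and `κ₂(u*, u)` are `1`. -/
theorem IsSecondOrderHaarUnitary.cycleCumulant_eq_one (hu : IsSecondOrderHaarUnitary P u) {n : ℕ}
    {π : Perm (Fin n)} {ε : Fin n → ℤˣ} {x : Fin n} (h2 : π (π x) = x) (h : ε (π x) ≠ ε x) :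
    cycleCumulant P π (fun k => signed u (ε k)) x = 1 := by
  have hne : π x ≠ x := fun e => h (by rw [e])
  have hmerge := mergedCumulant_eq P π (fun k => signed u (ε k)) x hne (hu.signed_mul_signed h)
  rw [if_pos h2, mergedCumulant, Finset.sum_eq_single x] at hmerge
  · rwa [splitTerm, if_pos rfl] at hmerge
  · intro j hj hjx
    have hS := mem_of_sameCycle (S := {y | y = x ∨ y = π x}) (π := π) (fun y => ?_)
      (Finset.mem_filter.1 hj).2
    -- The only proper split cuts the pair into two fixed points, and a first order cumulant of
    -- order one is zero.
    · obtain rfl : j = π x := (hS.1 (Or.inl rfl)).resolve_left hjx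
      rw [splitTerm, if_neg hjx.symm, hu.cycleCumulant_eq_zero (z := x) .rfl, zero_mul]
      rw [mul_swap_apply_left, h2]
    · constructor
      · rintro (rfl | rfl)
        exacts [Or.inr rfl, Or.inl h2]
      · rintro (h' | h')
        · exact Or.inr (π.injective (h'.trans h2.symm))
        · exact Or.inl (π.injective h')
  · intro hx
    exact absurd (Finset.mem_filter.2 ⟨Finset.mem_univ _, .rfl⟩) hx

end Haar

/-! ### Spoke diagrams -/

section Spokes

variable {p : ℕ}

/-- The non-crossing annular pairing that connects the point `k` of the first circle with the
point `c - k` of the second circle. -/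
def spoke (c : Fin (p + 1)) : Perm (Fin (p + 1 + (p + 1))) :=
  Function.Involutive.toPerm
    (Fin.addCases (fun k => Fin.natAdd (p + 1) (c - k)) (fun k => Fin.castAdd (p + 1) (c - k)))
    (fun x => by refine Fin.addCases (fun k => ?_) (fun k => ?_) x <;>
      simp only [Fin.addCases_left, Fin.addCases_right, sub_sub_cancel])

theorem spoke_castAdd (c k : Fin (p + 1)) :
    spoke c (Fin.castAdd (p + 1) k) = Fin.natAdd (p + 1) (c - k) := by
  exact Fin.addCases_left (motive := fun _ => Fin (p + 1 + (p + 1)))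
    (left := fun k => Fin.natAdd (p + 1) (c - k)) (right := fun k => Fin.castAdd (p + 1) (c - k)) k

theorem spoke_natAdd (c k : Fin (p + 1)) :
    spoke c (Fin.natAdd (p + 1) k) = Fin.castAdd (p + 1) (c - k) := by
  exact Fin.addCases_right (motive := fun _ => Fin (p + 1 + (p + 1)))
    (left := fun k => Fin.natAdd (p + 1) (c - k)) (right := fun k => Fin.castAdd (p + 1) (c - k)) k

theorem spoke_spoke (c : Fin (p + 1)) (x) : spoke c (spoke c x) = x := by
  refine Fin.addCases (fun k => ?_) (fun k => ?_) x <;>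
    simp only [spoke_castAdd, spoke_natAdd, sub_sub_cancel]

theorem spoke_inv (c : Fin (p + 1)) : (spoke c)⁻¹ = spoke c := by
  rw [inv_eq_iff_mul_eq_one]
  exact Perm.ext (spoke_spoke c)

theorem spoke_mem_circle_iff (c : Fin (p + 1)) (x) :
    spoke c x ∈ circle (p + 1) (p + 1) ↔ x ∉ circle (p + 1) (p + 1) := by
  refine Fin.addCases (fun k => ?_) (fun k => ?_) x <;>
    simp only [spoke_castAdd, spoke_natAdd, castAdd_mem_circle, natAdd_notMem_circle,
      not_true_eq_false, not_false_eq_true]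

theorem annularRotation_castAdd {m n : ℕ} (k : Fin (m + 1)) :
    annularRotation (m + 1) n (Fin.castAdd n k) = Fin.castAdd n (k + 1) := by
  rw [annularRotation_eq_prodPerm, prodPerm_castAdd, finRotate_apply]

theorem annularRotation_natAdd {m n : ℕ} (k : Fin (n + 1)) :
    annularRotation m (n + 1) (Fin.natAdd m k) = Fin.natAdd m (k + 1) := by
  rw [annularRotation_eq_prodPerm, prodPerm_natAdd, finRotate_apply]

/-- The complement is again a pairing by spokes, with `c - 1` in place of `c`. -/
theorem spoke_rotation_involutive (c : Fin (p + 1)) (x) :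
    ((spoke c)⁻¹ * annularRotation (p + 1) (p + 1))
      (((spoke c)⁻¹ * annularRotation (p + 1) (p + 1)) x) = x := by
  rw [spoke_inv]
  refine Fin.addCases (fun k => ?_) (fun k => ?_) x <;>
    simp only [Perm.mul_apply, spoke_castAdd, spoke_natAdd, annularRotation_castAdd,
      annularRotation_natAdd, sub_add_eq_sub_sub, sub_add_cancel, sub_sub_cancel]

theorem apply_ne_of_mem_circle_iff {m n : ℕ} {π : Perm (Fin (m + n))}
    (h : ∀ x, π x ∈ circle m n ↔ x ∉ circle m n) (x) : π x ≠ x := fun e => by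
  have := h x
  rw [e] at this
  tauto

/-- The rotation preserves circles, so the complement changes circles along with `π`; in particular
it has no fixed points either. -/
theorem inv_mul_mem_circle_iff {m n : ℕ} {π : Perm (Fin (m + n))}
    (h : ∀ x, π x ∈ circle m n ↔ x ∉ circle m n) (x) :
    (π⁻¹ * annularRotation m n) x ∈ circle m n ↔ x ∉ circle m n := by
  have h1 := h ((π⁻¹ * annularRotation m n) x)
  rw [← Perm.mul_apply, mul_inv_cancel_left, annularRotation_mem_circle_iff] at h1
  tauto

theorem permLength_annularRotation (m n : ℕ) :
    permLength (annularRotation (m + 1) (n + 1)) = m + n := by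
  have h : ∀ k, permLength (finRotate (k + 1)) = k := fun k => by
    rw [permLength, numCycles, cycleMins_finRotate (Nat.succ_pos k), Finset.card_singleton]
    rfl
  rw [annularRotation_eq_prodPerm, permLength_prodPerm, h, h]

theorem spoke_mem_annulus (c : Fin (p + 1)) :
    spoke c ∈ annulus (annularRotation (p + 1) (p + 1)) (circle (p + 1) (p + 1)) := by
  have h1 := apply_ne_of_mem_circle_iff (spoke_mem_circle_iff c)
  have h2 := apply_ne_of_mem_circle_iff (inv_mul_mem_circle_iff (spoke_mem_circle_iff c))
  have h3 := (two_mul_numCycles_eq_iff h1).2 (spoke_spoke c)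
  have h4 := (two_mul_numCycles_eq_iff h2).2 (spoke_rotation_involutive c)
  have h5 := permLength_add_numCycles (spoke c)
  have h6 := permLength_add_numCycles ((spoke c)⁻¹ * annularRotation (p + 1) (p + 1))
  rw [mem_annulus, permLength_annularRotation]
  refine ⟨⟨_, _, castAdd_mem_circle 0, natAdd_notMem_circle (c - 0), ?_⟩, by omega⟩
  rw [← spoke_castAdd]
  exact sameCycle_apply_self _ _

/-- The only non-crossing annular permutations all of whose steps lead from one circle to the
other one are the spoke diagrams. -/
theorem eq_spoke_of_mem_annulus {π : Perm (Fin (p + 1 + (p + 1)))}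
    (h : π ∈ annulus (annularRotation (p + 1) (p + 1)) (circle (p + 1) (p + 1)))
    (hC : ∀ x, π x ∈ circle (p + 1) (p + 1) ↔ x ∉ circle (p + 1) (p + 1)) :
    ∃ c, spoke c = π := by
  have h1 := apply_ne_of_mem_circle_iff hC
  have h2 := apply_ne_of_mem_circle_iff (inv_mul_mem_circle_iff hC)
  have h3 := two_mul_numCycles_le h1
  have h4 := two_mul_numCycles_le h2
  have h5 := permLength_add_numCycles π
  have h6 := permLength_add_numCycles (π⁻¹ * annularRotation (p + 1) (p + 1))
  have h7 := (mem_annulus.1 h).2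
  rw [permLength_annularRotation] at h7
  -- On `2p + 2` points the annular condition gives `π` and its complement `2p + 2` cycles in total,
  -- while each has at most `p + 1`. Both are therefore pairings.
  have hπ := (two_mul_numCycles_eq_iff h1).1 (by omega)
  have hK := (two_mul_numCycles_eq_iff h2).1 (by omega)
  have hinv : π⁻¹ = π := by
    rw [inv_eq_iff_mul_eq_one]
    exact Perm.ext hπ
  rw [hinv] at hK
  simp only [Perm.mul_apply] at hK
  obtain ⟨c, hc⟩ : ∃ c, π (Fin.castAdd (p + 1) 0) = Fin.natAdd (p + 1) c := by
    have hn : π (Fin.castAdd (p + 1) 0) ∉ circle (p + 1) (p + 1) := fun h' =>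
      (hC _).1 h' (castAdd_mem_circle 0)
    revert hn
    refine Fin.addCases (fun k hk => absurd (castAdd_mem_circle k) hk) (fun k _ => ⟨k, rfl⟩)
      (π (Fin.castAdd (p + 1) 0))
  -- Since the complement is an involution, moving one step forward on the first circle moves the
  -- partner one step back on the second. The partner `c` of `0` thus determines `π`.
  have key : ∀ k, π (Fin.castAdd (p + 1) k) = Fin.natAdd (p + 1) (c - k) := by
    intro k
    induction k using Fin.induction with
    | zero => rw [hc, sub_zero]
    | succ k ih =>
      have e := hK (Fin.castAdd (p + 1) k.castSucc)
      rw [annularRotation_castAdd] at e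
      have e2 := congrArg π e
      rw [hπ, ih] at e2
      apply (annularRotation (p + 1) (p + 1)).injective
      rw [annularRotation_natAdd, ← Fin.coeSucc_eq_succ, e2, sub_add_eq_sub_sub, sub_add_cancel]
  refine ⟨c, perm_ext_add (fun k => by rw [spoke_castAdd, key]) fun k => ?_⟩
  rw [spoke_natAdd, ← hπ (Fin.castAdd (p + 1) (c - k)), key, sub_sub_cancel]

theorem spoke_injective : Function.Injective (spoke (p := p)) := by
  intro c d h
  have := congrArg (fun σ => σ (Fin.castAdd (p + 1) 0)) h
  simp only [spoke_castAdd, sub_zero] at this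
  exact Fin.natAdd_injective _ _ this

end Spokes

/-! ### Second order cumulants of Haar unitaries -/

section Haar₂

variable {A : Type*} [Ring A] [Algebra ℂ A] [StarRing A] {P : SecondOrderSpace A} {u : A}

theorem append_signed {B : Type*} [Ring B] [StarRing B] {a : B} {m n : ℕ} (ε : Fin m → ℤˣ) (η : Fin n → ℤˣ) :
    Fin.append (fun k => signed a (ε k)) (fun k => signed a (η k)) =
      fun k => signed a (Fin.append ε η k) := by
  funext k
  refine Fin.addCases (fun i => ?_) (fun j => ?_) k <;> simp

theorem cycleCumulant₂_signed_eq_zero {n : ℕ} {π : Perm (Fin n)} {ε : Fin n → ℤˣ} {x y z : Fin n}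
    (ih : ∀ (η : Fin (cycleLength π x) → ℤˣ) (θ : Fin (cycleLength π y) → ℤˣ),
      (∃ k, η (finRotate _ k) = η k) →
        cumulant₂ P _ _ (fun k => signed u (η k)) (fun k => signed u (θ k)) = 0)
    (hz : π.SameCycle x z) (h : ε (π z) = ε z) :
    cycleCumulant₂ P π (fun k => signed u (ε k)) x y = 0 := by
  obtain ⟨k, rfl⟩ := exists_cycleMap_eq hz
  refine ih (fun k => ε (cycleMap π x k)) (fun k => ε (cycleMap π y k)) ⟨k, ?_⟩
  rw [cycleMap_finRotate, h]

/-- The case of a word on the first circle that has a repeated sign followed by a change. -/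
theorem IsSecondOrderHaarUnitary.cumulant₂_eq_zero_of_change (hu : IsSecondOrderHaarUnitary P u)
    {m n : ℕ} (hn : 0 < n)
    (ih : ∀ m' n' : ℕ, m' + n' < m + n → 0 < n' → ∀ (ε : Fin m' → ℤˣ) (η : Fin n' → ℤˣ),
      (∃ k, ε (finRotate _ k) = ε k) →
        cumulant₂ P m' n' (fun k => signed u (ε k)) (fun k => signed u (η k)) = 0)
    (ε : Fin m → ℤˣ) (η : Fin n → ℤˣ) {h : Fin m} (h1 : ε (finRotate m h) = ε h)
    (h2 : ε (finRotate m (finRotate m h)) ≠ ε (finRotate m h)) :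
    cumulant₂ P m n (fun k => signed u (ε k)) (fun k => signed u (η k)) = 0 := by
  have hm : 0 < m := h.pos
  set γ := annularRotation m n with hγ
  set θ := Fin.append ε η with hθ
  set h' : Fin (m + n) := Fin.castAdd n h with hh'
  set i : Fin (m + n) := γ h' with hi
  set y : Fin (m + n) := Fin.natAdd m ⟨0, hn⟩ with hy
  have hrot : ∀ k, γ (Fin.castAdd n k) = Fin.castAdd n (finRotate m k) := fun k => by
    rw [hγ, annularRotation_eq_prodPerm, prodPerm_castAdd]
  have h1' : θ i = θ h' := by
    rw [hi, hh', hrot, hθ, Fin.append_left, Fin.append_left, h1]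
  have h2' : θ (γ i) ≠ θ i := by
    rw [hi, hh', hrot, hrot, hθ, Fin.append_left, Fin.append_left]; exact h2
  have hne : γ i ≠ i := fun e => h2' (by rw [e])
  have hhi : h' ≠ i := fun e => hne (by rw [← e]; exact hi.symm.trans e.symm)
  have hsC : ∀ {x y}, γ.SameCycle x y → (x ∈ circle m n ↔ y ∈ circle m n) := fun h =>
    mem_of_sameCycle (S := {x | x ∈ circle m n})
      (fun x => (annularRotation_mem_circle_iff x).symm) h
  have hiC : i ∈ circle m n := (annularRotation_mem_circle_iff _).2 (castAdd_mem_circle h)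
  have hyC : y ∉ circle m n := natAdd_notMem_circle _
  have hiy : ¬ γ.SameCycle i y := fun hs => hyC ((hsC hs).1 hiC)
  have hmerge := mergedCumulant₂_eq_zero P γ (fun k => signed u (θ k)) i y hne
    (hu.signed_mul_signed h2') hiy
  rw [mergedCumulant₂, Finset.sum_eq_single i, Finset.sum_eq_zero, add_zero, splitTerm₂,
    if_pos rfl] at hmerge
  · have hs : γ.SameCycle i (Fin.castAdd n ⟨0, hm⟩) := by
      have hf : ∀ k, Fin.castAdd n (finRotate m k) = γ (Fin.castAdd n k) := fun k => (hrot k).symm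
      rw [hi, hh', hrot]
      exact sameCycle_of_maps (f := Fin.castAdd n) hf (sameCycle_finRotate _ _)
    rw [cycleCumulant₂_congr P hs (.refl γ y), hγ, hy, cycleCumulant₂_annularRotation] at hmerge
    simpa only [hθ, Fin.append_left, Fin.append_right] using hmerge
  -- Summands from joins are first order cumulants of a cycle that still contains the repetition at
  -- `i`, so the first order result removes them.
  · intro j hj
    have hj : ¬ γ.SameCycle i j := fun hs => hiy (hs.trans (Finset.mem_filter.1 hj).2.symm)
    obtain ⟨z, hz, hε⟩ := exists_repeat_mul_swap (ε := θ) (j := j) hi.symm hhi h1'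
    exact hu.cycleCumulant_eq_zero hz (hε fun e => hj (e ▸ .rfl))
  · intro j hj hji
    replace hj := (Finset.mem_filter.1 hj).2
    obtain ⟨z, hz, hε⟩ := exists_repeat_mul_swap (ε := θ) (j := j) hi.symm hhi h1'
    have hsub := fun {x y} => (sameCycle_iff_of_sameCycle_mul_swap hj hji.symm (x := x) (y := y)).2
    -- The piece containing `j` is a third cycle, which makes the cycles of `i` and `y` together
    -- strictly shorter.
    have hlt := cycleLength_add_lt_of_not_sameCycle (π := γ * swap i j) (x := i) (y := y) (z := j)
      (fun hs => hiy (hsub (Or.inl hs))) (not_sameCycle_mul_swap hj hji.symm)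
      (fun hs => hiy (hj.trans (hsub (Or.inl hs)).symm))
    rw [splitTerm₂, if_neg hji.symm, hu.cycleCumulant_eq_zero hz (hε hji.symm),
      cycleCumulant₂_signed_eq_zero (ih _ _ hlt (cycleLength_pos _ _)) hz (hε hji.symm)]
    simp
  · intro hi
    exact absurd (Finset.mem_filter.2 ⟨Finset.mem_univ _, .rfl⟩) hi

/-- Neighbouring letters cancel in pairs. An alternating circle therefore has moment `φ₂(·, 1) = 0`.
-/
theorem IsSecondOrderHaarUnitary.ofFn_alternating_prod (hu : IsSecondOrderHaarUnitary P u) (n : ℕ)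
    (ε : Fin (2 * n) → ℤˣ) (h : Alternating ε) :
    (List.ofFn fun k => signed u (ε k)).prod = 1 := by
  rw [alternating_iff] at h
  induction n with
  | zero => simp
  | succ n ih =>
    change (List.ofFn fun k : Fin (2 * n + 2) => signed u (ε k)).prod = 1
    rw [ofFn_prod_of_mul_eq_one]
    · exact ih (fun k => ε ⟨k + 2, by omega⟩) fun i j hij => h _ _ (by simp only [hij])
    · exact hu.signed_mul_signed (h _ _ rfl).symm

/-- The sum over the spoke diagrams. -/
theorem IsSecondOrderHaarUnitary.sum_annulus_const (hu : IsSecondOrderHaarUnitary P u) (p : ℕ)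
    {s t : ℤˣ} (hst : s ≠ t) {θ : Fin (p + 1 + (p + 1)) → ℤˣ}
    (hθ : ∀ x, θ x = if x ∈ circle (p + 1) (p + 1) then s else t) :
    ∑ π ∈ annulus (annularRotation (p + 1) (p + 1)) (circle (p + 1) (p + 1)),
      ∏ x ∈ cycleMins π, cycleCumulant P π (fun k => signed u (θ k)) x = (p + 1 : ℕ) := by
  have hne : ∀ x y, θ x ≠ θ y ↔ (x ∈ circle (p + 1) (p + 1) ↔ y ∉ circle (p + 1) (p + 1)) := by
    intro x y
    rw [hθ, hθ]
    split_ifs <;> simp_all [hst.symm]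
  have h1 : ((p + 1 : ℕ) : ℂ) = ∑ c : Fin (p + 1), (1 : ℂ) := by simp
  rw [h1]
  symm
  refine Finset.sum_bij_ne_zero (fun c _ _ => spoke c) (fun c _ _ => spoke_mem_annulus c)
    (fun c _ _ d _ _ h => spoke_injective h) ?_ ?_
  · intro π hπ hne0
    -- The signs are constant on each circle, so a nonzero term needs every step to change circles.
    obtain ⟨c, rfl⟩ := eq_spoke_of_mem_annulus hπ fun x => (hne _ _).1 fun e =>
      hne0 (hu.prod_cycleMins_eq_zero e)
    exact ⟨c, Finset.mem_univ c, one_ne_zero, rfl⟩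
  · intro c _ _
    rw [Finset.prod_eq_one]
    intro x _
    exact hu.cycleCumulant_eq_one (spoke_spoke c x) ((hne _ _).2 (spoke_mem_circle_iff c x))

theorem IsSecondOrderHaarUnitary.φ₂_signed_pow (hu : IsSecondOrderHaarUnitary P u) (s t : ℤˣ)
    {k l : ℕ} (hk : 1 ≤ k) (hl : 1 ≤ l) :
    P.φ₂ (signed u s ^ k) (signed u t ^ l) = if s ≠ t ∧ k = l then (k : ℂ) else 0 := by
  have hne : ¬ ((-1 : ℤˣ) = 1) := by decide
  have hne' : ¬ ((1 : ℤˣ) = -1) := by decide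
  rcases Int.units_eq_one_or s with rfl | rfl <;> rcases Int.units_eq_one_or t with rfl | rfl
  · simp [signed, hu.φ₂_pow_pow k l hk hl]
  · simp [signed, hne, hne', hu.φ₂_pow_star_pow k l hk hl]
  · rw [P.φ₂_symm]
    simp only [signed, hne, if_true, if_false, hu.φ₂_pow_star_pow l k hl hk, eq_comm (a := l)]
    split_ifs with h1 h2 h2
    · rw [h1]
    · exact absurd ⟨hne, h1⟩ h2
    · exact absurd h2.2 h1
    · rfl
  · simp [signed, hne, hu.φ₂_star_pow_star_pow k l hk hl]

/-- The case of a word on the first circle with constant signs and a word on the second circle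
with constant or alternating signs. -/
theorem IsSecondOrderHaarUnitary.cumulant₂_eq_zero_of_const (hu : IsSecondOrderHaarUnitary P u)
    {m n : ℕ} (hm : 0 < m) (hn : 0 < n)
    (ih : ∀ m' n' : ℕ, m' + n' < m + n → 0 < n' → ∀ (ε : Fin m' → ℤˣ) (η : Fin n' → ℤˣ),
      (∃ k, ε (finRotate _ k) = ε k) →
        cumulant₂ P m' n' (fun k => signed u (ε k)) (fun k => signed u (η k)) = 0)
    (ε : Fin m → ℤˣ) (η : Fin n → ℤˣ) {s : ℤˣ} (hε : ∀ k, ε k = s)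
    (hη : (∃ t, ∀ k, η k = t) ∨ ∀ k, η (finRotate n k) ≠ η k) :
    cumulant₂ P m n (fun k => signed u (ε k)) (fun k => signed u (η k)) = 0 := by
  have hθ : ∀ x ∈ circle m n, Fin.append ε η x = s := by
    intro x
    refine Fin.addCases (fun k _ => ?_) (fun k hk => absurd hk (natAdd_notMem_circle k)) x
    rw [Fin.append_left, hε]
  -- The second order factor of every term has a cycle inside the first circle, where constant signs
  -- give a repetition, so `ih` applies whatever the second circle carries.
  have hzero : ∑ π ∈ (geodesic (annularRotation m n)).erase (annularRotation m n),
      markedSum (cycleMins π) (circle m n)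
        (cycleCumulant P π (fun k => signed u (Fin.append ε η k)))
        (cycleCumulant₂ P π (fun k => signed u (Fin.append ε η k))) = 0 := by
    refine Finset.sum_eq_zero fun π hπ => ?_
    refine Finset.sum_eq_zero fun x hx => Finset.sum_eq_zero fun y hy => ?_
    replace hx := (Finset.mem_filter.1 hx).2
    replace hy := (Finset.mem_filter.1 hy).2
    have hπx := (mem_circle_iff_of_mem_geodesic (Finset.mem_of_mem_erase hπ)
      (sameCycle_apply_self π x)).1 hx
    rw [cycleCumulant₂_signed_eq_zero (ih _ _ (cycleLength_add_lt_of_mem hπ hx hy)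
      (cycleLength_pos _ _)) .rfl ((hθ _ hπx).trans (hθ _ hx).symm), zero_mul]
  -- Unless the signs balance, every annular permutation has a repetition along some cycle, and its
  -- first order factor kills the term.
  have hann : ∑ k, ((Fin.append ε η k : ℤˣ) : ℤ) ≠ 0 → ∑ π ∈ annulus (annularRotation m n) (circle m n),
      ∏ x ∈ cycleMins π, cycleCumulant P π (fun k => signed u (Fin.append ε η k)) x = 0 := by
    intro hsum
    refine Finset.sum_eq_zero fun π _ => ?_
    by_cases hex : ∃ z, Fin.append ε η (π z) = Fin.append ε η z
    · obtain ⟨z, hz⟩ := hex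
      exact hu.prod_cycleMins_eq_zero hz
    · push Not at hex
      exact absurd (sum_eq_zero_of_forall_apply_ne π hex) hsum
  rw [Fin.sum_univ_add] at hann
  simp only [Fin.append_left, Fin.append_right, hε, Finset.sum_const, Finset.card_univ,
    Fintype.card_fin, nsmul_eq_mul] at hann
  rw [cumulant₂_eq_sub, append_signed, hzero, sub_zero, annularNC_eq_annulus,
    ofFn_signed_const_prod s hε]
  rcases hη with ⟨t, ht⟩ | hη
  · rw [ofFn_signed_const_prod t ht, hu.φ₂_signed_pow s t hm hn]
    simp only [ht, Finset.sum_const, Finset.card_univ, Fintype.card_fin, nsmul_eq_mul] at hann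
    split_ifs with h
    · obtain ⟨hst, rfl⟩ := h
      obtain ⟨p, rfl⟩ : ∃ p, m = p + 1 := ⟨m - 1, by omega⟩
      rw [hu.sum_annulus_const p hst, sub_self]
      intro x
      refine Fin.addCases (fun k => ?_) (fun k => ?_) x
      · rw [Fin.append_left, hε, if_pos (castAdd_mem_circle k)]
      · rw [Fin.append_right, ht, if_neg (natAdd_notMem_circle k)]
    · rw [hann, sub_zero]
      rcases Int.units_eq_one_or s with rfl | rfl <;> rcases Int.units_eq_one_or t with rfl | rfl
      · simp; omega
      · have : m ≠ n := fun e => h ⟨by decide, e⟩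
        simp; omega
      · have : m ≠ n := fun e => h ⟨by decide, e⟩
        simp; omega
      · simp; omega
  · obtain ⟨⟨l, hl⟩, halt⟩ := even_and_alternating hη
    obtain rfl : n = 2 * l := by omega
    rw [hu.ofFn_alternating_prod l η halt, P.φ₂_one_right, hann, sub_zero]
    rw [sum_eq_zero_of_forall_apply_ne _ hη, add_zero]
    rcases Int.units_eq_one_or s with rfl | rfl <;> simp <;> omega

/-- A change after a repetition on either circle is merged away, by symmetry if it is on the second.
Otherwise the first circle is constant and the second is constant or without repetitions. -/
theorem IsSecondOrderHaarUnitary.cumulant₂_eq_zero_left (hu : IsSecondOrderHaarUnitary P u)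
    (m n : ℕ) (hn : 0 < n) (ε : Fin m → ℤˣ) (η : Fin n → ℤˣ) (h : ∃ k, ε (finRotate m k) = ε k) :
    cumulant₂ P m n (fun k => signed u (ε k)) (fun k => signed u (η k)) = 0 := by
  induction hN : m + n using Nat.strong_induction_on generalizing m n with
  | _ N ih =>
  subst hN
  replace ih : ∀ m' n' : ℕ, m' + n' < m + n → 0 < n' → ∀ (ε : Fin m' → ℤˣ) (η : Fin n' → ℤˣ),
      (∃ k, ε (finRotate _ k) = ε k) →
        cumulant₂ P m' n' (fun k => signed u (ε k)) (fun k => signed u (η k)) = 0 :=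
    fun m' n' hlt hn' ε η hk => ih _ hlt m' n' hn' ε η hk rfl
  obtain ⟨k, hk⟩ := h
  rcases exists_repeat_before_change hk with ⟨h, -, h1, h2⟩ | hconst
  · exact hu.cumulant₂_eq_zero_of_change hn ih ε η h1 h2
  have hε : ∀ x, ε x = ε k := fun x => hconst x (sameCycle_finRotate k x)
  by_cases hη : ∃ l, η (finRotate n l) = η l
  · obtain ⟨l, hl⟩ := hη
    rcases exists_repeat_before_change hl with ⟨h, -, h1, h2⟩ | hconst'
    · rw [cumulant₂_symm]
      exact hu.cumulant₂_eq_zero_of_change k.pos (fun m' n' hlt => ih m' n' (by omega)) η ε h1 h2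
    · exact hu.cumulant₂_eq_zero_of_const k.pos hn ih ε η hε
        (Or.inl ⟨η l, fun x => hconst' x (sameCycle_finRotate l x)⟩)
  · push Not at hη
    exact hu.cumulant₂_eq_zero_of_const k.pos hn ih ε η hε (Or.inr hη)

theorem IsSecondOrderHaarUnitary.cumulant₂_eq_zero (hu : IsSecondOrderHaarUnitary P u)
    {m n : ℕ} (hm : 1 ≤ m) (hn : 1 ≤ n) (ε : Fin m → ℤˣ) (η : Fin n → ℤˣ)
    (h : ¬ (Even m ∧ Even n ∧ Alternating ε ∧ Alternating η)) :
    cumulant₂ P m n (fun k => signed u (ε k)) (fun k => signed u (η k)) = 0 := by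
  by_cases hε : ∃ k, ε (finRotate m k) = ε k
  · exact hu.cumulant₂_eq_zero_left m n hn ε η hε
  by_cases hη : ∃ k, η (finRotate n k) = η k
  · rw [cumulant₂_symm]
    exact hu.cumulant₂_eq_zero_left n m hm η ε hη
  push Not at hε hη
  have h1 := even_and_alternating hε
  have h2 := even_and_alternating hη
  exact absurd ⟨h1.1, h2.1, h1.2, h2.2⟩ h

end Haar₂

/-! ### Equality of all alternating second order cumulants -/

section Symmetric

variable {A : Type*} [Ring A] [Algebra ℂ A] [StarRing A] (P : SecondOrderSpace A) (a : A)

/-- Alternating second order cumulants do not depend on the signs at which the words start. -/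
theorem cumulant₂_alternating (p q : ℕ) {ε : Fin (2 * p) → ℤˣ} {η : Fin (2 * q) → ℤˣ}
    (hε : Alternating ε) (hη : Alternating η) :
    cumulant₂ P (2 * p) (2 * q) (fun i => signed a (ε i)) (fun j => signed a (η j)) =
      cumulant₂ P (2 * p) (2 * q) (fun i => signed a (altSigns (2 * p) i))
        (fun j => signed a (altSigns (2 * q) j)) := by
  have h1 := fun b => (cumulant₂_comp_finRotate P (2 * p) (2 * q)
    (fun i => signed a (altSigns (2 * p) i)) b).1
  have h2 := fun b => (cumulant₂_comp_finRotate P (2 * p) (2 * q) b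
    (fun i => signed a (altSigns (2 * q) i))).2
  -- Each circle carries either the standard pattern or its rotation by one step.
  rcases eq_altSigns_or hε with rfl | rfl <;> rcases eq_altSigns_or hη with rfl | rfl
  · rfl
  · exact h2 _
  · exact h1 _
  · exact (h1 _).trans (h2 _)

end Symmetric

end SecondOrder

theorem proposition8p2 {A : Type*} [Ring A] [Algebra ℂ A] [StarRing A] [StarModule ℂ A]
    (P : SecondOrder.SecondOrderSpace A) (u : A)
    (hu : SecondOrder.IsSecondOrderHaarUnitary P u) :
    SecondOrder.IsSecondOrderRDiagonal P u ∧
      ∀ p q : ℕ, 1 ≤ p → 1 ≤ q → ∀ (ε : Fin p → ℤˣ) (η : Fin q → ℤˣ),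
        ¬ (Even p ∧ Even q ∧ SecondOrder.Alternating ε ∧ SecondOrder.Alternating η) →
          SecondOrder.cumulant₂ P p q (fun i => SecondOrder.signed u (ε i))
            (fun j => SecondOrder.signed u (η j)) = 0 := by
  refine ⟨⟨fun n _ ε h => hu.cumulant_eq_zero n ε ?_,
    fun p q hp hq ε η h => hu.cumulant₂_eq_zero hp hq ε η h,
    fun p q _ _ ε η hε hη => SecondOrder.cumulant₂_alternating P u p q hε hη⟩,
    fun p q hp hq ε η h => hu.cumulant₂_eq_zero hp hq ε η h⟩
  -- Without a repetition around the circle the signs alternate and their number is even, which `h`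
  -- excludes.
  by_contra! hne
  exact h (SecondOrder.even_and_alternating hne)
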